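/- **Setting.** Let $M$ be a smooth manifold and $\Delta\subset TM$ a smooth distribution (vector subbundle). Its weak derived flag is given by $\Delta_0=0$, $\Delta_1=\Delta$ and $\Gamma(\Delta_{s+1})=\Gamma(\Delta_s)+[\Gamma(\Delta),\Gamma(\Delta_s)]$. Assume that $\Delta$ is regular (all $\Delta_s$ have constant rank) and completely non-holonomic ($\Delta_\kappa=TM$ for some $\kappa$). Fix $x\in M$. *Tanaka algebra.* Let $\mathfrak m_x=\bigoplus_{i<0}\mathfrak g_i$, where $\mathfrak g_{-s}$ is the fibre at $x$ of $\Delta_s/\Delta_{s-1}$, with the bracket induced by the commutator of vector fields. For $k\ge 0$ let, successively, $$\mathfrak g_k=\Big\{u\in\bigoplus_{i<0}\mathfrak g_{k+i}\otimes\mathfrak g_i^*:\ u([X,Y])=[u(X),Y]+[X,u(Y)]\ \ \forall X,Y\in\mathfrak m_x\Big\}.$$ The Tanaka algebra is $\mathfrak g_x=\bigoplus_{i\in\mathbb Z}\mathfrak g_i$, the graded Lie algebra with negative part $\mathfrak m_x$ and $[u,X]=u(X)$ for $u\in\mathfrak g_k$, $k\ge0$, $X\in\mathfrak m_x$. *Local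 symmetries.* Let $\mathcal L(x)$ be the Lie algebra of germs at $x$ of smooth vector fields $X$ with $[X,\Gamma(\Delta)]\subset\Gamma(\Delta)$. For $s\ge 0$ put $\mathcal L(x)^{-s}=\{X\in\mathcal L(x):X_x\in\Delta_s(x)\}$ (so $X_x=0$ for $s=0$), and for $i\ge0$ let $$\mathcal L(x)^{i+1}=\{X\in\mathcal L(x)^i:\ \Psi_X^{i+1}=0\},\qquad \Psi_X^{j}(Y_1,\dots,Y_{j})=[[\dots[[X,Y_1],Y_2],\dots],Y_{j}]_x,\quad Y_1,\dots,Y_j\in\Gamma(\Delta).$$ Let $\mathbf g_i(x)=\mathcal L(x)^i/\mathcal L(x)^{i+1}$ $(i\in\mathbb Z)$, $L^\Delta_x=\varprojlim_{i\to+\infty}\mathcal L(x)/\mathcal L(x)^i$ and $\operatorname{gr}(L^\Delta_x)=\bigoplus_i\mathbf g_i(x)$. **Theorem.** The filtration respects brackets, $[\mathcal L(x)^i,\mathcal L(x)^j]\subset\mathcal L(x)^{i+j}$, so that $\operatorname{gr}(L^\Delta_x)$ is a graded Lie algebra, and there are injective linear maps $\iota_i:\mathbf g_i(x)\hookrightarrow\mathfrak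 g_i$, for all $i\in\mathbb Z$, such that: 1. for $i\ge 0$, $\iota_i$ is induced by $X\mapsto\Psi_X^{i+1}$: for $X\in\mathcal L(x)^i$ and $Y_1,\dots,Y_{i+1}\in\Gamma(\Delta)$ the vector $\Psi_X^{i+1}(Y_1,\dots,Y_{i+1})$ lies in $\Delta_x=\mathfrak g_{-1}$, and $u=\iota_i([X])$ satisfies $$[[\dots[u,Y_{i+1}],\dots,Y_2],Y_1]=\Psi_X^{i+1}(Y_1,\dots,Y_{i+1}),$$ where on the left $Y_j$ stands for its value in $\mathfrak g_{-1}$; 2. for $s\ge1$ and $X\in\mathcal L(x)^{-s}$, $\iota_{-s}([X])=(-1)^{s+1}\,(X_x \bmod \Delta_{s-1}(x))\in\mathfrak g_{-s}$; 3. together the $\iota_i$ form a monomorphism of graded Lie algebras $\operatorname{gr}(L^\Delta_x)=\bigoplus_i\mathbf g_i(x)\hookrightarrow\bigoplus_i\mathfrak g_i=\mathfrak g_x$. Consequently $\dim L^\Delta_x\le\dim\mathfrak g_x$, with dimensions in $\mathbb N\cup\{\infty\}$. -/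

import Mathlib

open scoped Manifold ContDiff Topology DirectSum

noncomputable section

namespace TanakaTheory

universe u

/-- A `ℤ`-graded real Lie algebra `⨁ V i`, given by its homogeneous components and the brackets
`V i × V j → V (i + j)`. Skew symmetry and the Jacobi identity are stated in the direct sum, so that
no casts between `V (i + j)` and `V (j + i)` are needed. -/
structure GradedLieAlg where
  V : ℤ → Type u
  [acg : ∀ i, AddCommGroup (V i)]
  [mod : ∀ i, Module ℝ (V i)]
  br : ∀ i j, V i →ₗ[ℝ] V j →ₗ[ℝ] V (i + j)
  br_self : ∀ i (x : V i), br i i x x = 0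
  jacobi : ∀ i j k (x : V i) (y : V j) (z : V k),
    DirectSum.lof ℝ ℤ V _ (br i (j + k) x (br j k y z)) =
      DirectSum.lof ℝ ℤ V _ (br (i + j) k (br i j x y) z) +
      DirectSum.lof ℝ ℤ V _ (br j (i + k) y (br i k x z))
  br_skew : ∀ i j (x : V i) (y : V j),
    DirectSum.lof ℝ ℤ V _ (br i j x y) = - DirectSum.lof ℝ ℤ V _ (br j i y x)

namespace GradedLieAlg

attribute [instance] GradedLieAlg.acg GradedLieAlg.mod

variable (D : GradedLieAlg.{u})

/-- The total Lie algebra `⨁ i, V i`. -/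
def Total : Type u := ⨁ i, D.V i

instance : AddCommGroup D.Total := inferInstanceAs (AddCommGroup (⨁ i, D.V i))
instance : Module ℝ D.Total := inferInstanceAs (Module ℝ (⨁ i, D.V i))

/-- The inclusion of the component of degree `i`. -/
def incl (i : ℤ) : D.V i →ₗ[ℝ] D.Total := DirectSum.lof ℝ ℤ D.V i

def brLeft (i : ℤ) : D.V i →ₗ[ℝ] D.Total →ₗ[ℝ] D.Total :=
  (DirectSum.toModule ℝ ℤ (D.V i →ₗ[ℝ] D.Total)
    fun j => ((D.br i j).compr₂ (D.incl (i + j))).flip).flip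

/-- The bilinear extension of the homogeneous brackets to the direct sum. -/
def brTotal : D.Total →ₗ[ℝ] D.Total →ₗ[ℝ] D.Total :=
  DirectSum.toModule ℝ ℤ (D.Total →ₗ[ℝ] D.Total) D.brLeft

theorem brTotal_incl (i j : ℤ) (x : D.V i) (y : D.V j) :
    D.brTotal (D.incl i x) (D.incl j y) = D.incl (i + j) (D.br i j x y) := by
  have h1 : D.brTotal (D.incl i x) = D.brLeft i x := DirectSum.toModule_lof ℝ i x
  have h2 : D.brLeft i x (D.incl j y) = (((D.br i j).compr₂ (D.incl (i + j))).flip y) x :=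
    LinearMap.congr_fun (DirectSum.toModule_lof (R := ℝ) (N := D.V i →ₗ[ℝ] D.Total)
      (φ := fun j => ((D.br i j).compr₂ (D.incl (i + j))).flip) j y) x
  rw [h1, h2]
  rfl

theorem total_induction {p : D.Total → Prop} (h0 : p 0)
    (hi : ∀ i (x : D.V i), p (D.incl i x)) (ha : ∀ x y, p x → p y → p (x + y)) (x : D.Total) :
    p x :=
  DirectSum.induction_on x h0 hi ha

theorem brTotal_skew (x y : D.Total) : D.brTotal x y = - D.brTotal y x := by
  induction x using D.total_induction with
  | h0 => simp
  | ha x x' hx hx' => simp only [map_add, LinearMap.add_apply, hx, hx']; abel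
  | hi i x =>
    induction y using D.total_induction with
    | h0 => simp
    | ha y y' hy hy' => simp only [map_add, LinearMap.add_apply, hy, hy']; abel
    | hi j y => rw [brTotal_incl, brTotal_incl]; exact D.br_skew i j x y

theorem brTotal_self (x : D.Total) : D.brTotal x x = 0 := by
  have h := D.brTotal_skew x x
  have h2 : (2 : ℝ) • D.brTotal x x = 0 := by
    rw [two_smul]; nth_rewrite 2 [h]; simp
  simpa using h2

theorem brTotal_jacobi (x y z : D.Total) :
    D.brTotal x (D.brTotal y z) = D.brTotal (D.brTotal x y) z + D.brTotal y (D.brTotal x z) := by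
  induction x using D.total_induction with
  | h0 => simp
  | ha x x' hx hx' => simp only [map_add, LinearMap.add_apply, hx, hx']; abel
  | hi i x =>
    induction y using D.total_induction with
    | h0 => simp
    | ha y y' hy hy' => simp only [map_add, LinearMap.add_apply, hy, hy']; abel
    | hi j y =>
      induction z using D.total_induction with
      | h0 => simp
      | ha z z' hz hz' => simp only [map_add, hz, hz']; abel
      | hi k z => simp only [brTotal_incl]; exact D.jacobi i j k x y z

instance : LieRing D.Total where
  bracket x y := D.brTotal x y
  add_lie x y z := by change D.brTotal _ _ = D.brTotal _ _ + D.brTotal _ _; simp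
  lie_add x y z := by change D.brTotal _ _ = D.brTotal _ _ + D.brTotal _ _; simp
  lie_self x := D.brTotal_self x
  leibniz_lie x y z := D.brTotal_jacobi x y z

instance : LieAlgebra ℝ D.Total where
  lie_smul c x y := by change D.brTotal _ _ = c • D.brTotal _ _; simp

theorem lie_incl (i j : ℤ) (x : D.V i) (y : D.V j) :
    ⁅D.incl i x, D.incl j y⁆ = D.incl (i + j) (D.br i j x y) := D.brTotal_incl i j x y

end GradedLieAlg

section Graded

variable {L : Type u} [LieRing L] [LieAlgebra ℝ L]

theorem GradedLieAlg.lof_coe_congr {F : ℤ → Submodule ℝ L} {i j : ℤ} (e : i = j) (x : F i)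
    (y : F j) (hxy : (x : L) = y) :
    DirectSum.lof ℝ ℤ (fun i => F i) i x = DirectSum.lof ℝ ℤ (fun i => F i) j y := by
  subst e
  rw [Subtype.ext hxy]

/-- The graded Lie algebra `⨁ F i` of subspaces `F i` of a Lie algebra with `[F i, F j] ⊆ F (i + j)`. -/
def GradedLieAlg.ofGrading (F : ℤ → Submodule ℝ L)
    (h : ∀ i j, ∀ x ∈ F i, ∀ y ∈ F j, ⁅x, y⁆ ∈ F (i + j)) : GradedLieAlg.{u} where
  V i := F i
  br i j := LinearMap.mk₂ ℝ (fun x y => ⟨⁅(x : L), (y : L)⁆, h i j x x.2 y y.2⟩)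
    (fun x x' y => by ext; simp) (fun c x y => by ext; simp)
    (fun x y y' => by ext; simp) (fun c x y => by ext; simp)
  br_self i x := by ext; simp
  br_skew i j x y := by
    rw [← map_neg]
    exact lof_coe_congr (add_comm i j) _ _ (by simp)
  jacobi i j k x y z := by
    simp only [LinearMap.mk₂_apply]
    rw [lof_coe_congr (add_assoc i j k).symm _
      ⟨⁅(x : L), ⁅(y : L), (z : L)⁆⁆, by
        rw [add_assoc]; exact h _ _ _ x.2 _ (h _ _ _ y.2 _ z.2)⟩ rfl,
      lof_coe_congr (show j + (i + k) = i + j + k by ring) _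
      ⟨⁅(y : L), ⁅(x : L), (z : L)⁆⁆, by
        rw [add_comm i j, add_assoc]
        exact h _ _ _ y.2 _ (h _ _ _ x.2 _ z.2)⟩ rfl,
      ← map_add]
    congr 1
    ext
    simp

end Graded

section Subquotient

variable {L : Type u} [LieRing L] [LieAlgebra ℝ L]

/-- Families of subspaces `F i`, `N i` of a Lie algebra such that the bracket descends to
`F i / N i × F j / N j → F (i + j) / N (i + j)`. -/
structure IsGradedPair (F N : ℤ → Submodule ℝ L) : Prop where
  lie_mem : ∀ i j, ∀ x ∈ F i, ∀ y ∈ F j, ⁅x, y⁆ ∈ F (i + j)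
  lie_mem_sub : ∀ i j, ∀ x ∈ N i, ∀ y ∈ F j, ⁅x, y⁆ ∈ N (i + j)

namespace IsGradedPair

variable {F N : ℤ → Submodule ℝ L}

/-- `F i / (N i ∩ F i)`. -/
abbrev Piece (F N : ℤ → Submodule ℝ L) (i : ℤ) : Type u := F i ⧸ (N i).comap (F i).subtype

theorem lie_mem_sub' (h : IsGradedPair F N) (i j : ℤ) (x : L) (hx : x ∈ F i) (y : L)
    (hy : y ∈ N j) : ⁅x, y⁆ ∈ N (i + j) := by
  rw [← lie_skew, add_comm]
  exact (N _).neg_mem (h.lie_mem_sub j i y hy x hx)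

def pre (h : IsGradedPair F N) (i j : ℤ) : F i →ₗ[ℝ] F j →ₗ[ℝ] Piece F N (i + j) :=
  LinearMap.mk₂ ℝ (fun x y => Submodule.Quotient.mk ⟨⁅(x : L), (y : L)⁆, h.lie_mem i j x x.2 y y.2⟩)
    (fun x x' y => by
      rw [← Submodule.Quotient.mk_add]; congr 1; ext; simp)
    (fun c x y => by
      rw [← Submodule.Quotient.mk_smul]; congr 1; ext; simp)
    (fun x y y' => by
      rw [← Submodule.Quotient.mk_add]; congr 1; ext; simp)
    (fun c x y => by
      rw [← Submodule.Quotient.mk_smul]; congr 1; ext; simp)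

def br (h : IsGradedPair F N) (i j : ℤ) :
    Piece F N i →ₗ[ℝ] Piece F N j →ₗ[ℝ] Piece F N (i + j) :=
  Submodule.liftQ _
    ((Submodule.liftQ _ (h.pre i j).flip (by
      intro y hy
      rw [LinearMap.mem_ker]
      ext x
      exact (Submodule.Quotient.mk_eq_zero _).2 (h.lie_mem_sub' i j x x.2 y hy))).flip)
    (by
      intro x hx
      rw [LinearMap.mem_ker]
      ext y
      exact (Submodule.Quotient.mk_eq_zero _).2 (h.lie_mem_sub i j x hx y y.2))

theorem br_mk (h : IsGradedPair F N) (i j : ℤ) (x : F i) (y : F j) :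
    h.br i j (Submodule.Quotient.mk x) (Submodule.Quotient.mk y) =
      Submodule.Quotient.mk ⟨⁅(x : L), (y : L)⁆, h.lie_mem i j x x.2 y y.2⟩ := rfl

theorem lof_congr {i j : ℤ} (e : i = j) (x : F i) (y : F j) (hxy : (x : L) = y) :
    DirectSum.lof ℝ ℤ (Piece F N) i (Submodule.Quotient.mk x) =
      DirectSum.lof ℝ ℤ (Piece F N) j (Submodule.Quotient.mk y) := by
  subst e
  rw [Subtype.ext hxy]

/-- The graded Lie algebra `⨁ F i / (N i ∩ F i)` with the bracket induced from the ambient Lie algebra. -/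
def toGraded (h : IsGradedPair F N) : GradedLieAlg.{u} where
  V := Piece F N
  br := h.br
  br_self i x := by
    obtain ⟨x, rfl⟩ := Submodule.Quotient.mk_surjective _ x
    rw [br_mk, Submodule.Quotient.mk_eq_zero]
    simp
  br_skew i j x y := by
    obtain ⟨x, rfl⟩ := Submodule.Quotient.mk_surjective _ x
    obtain ⟨y, rfl⟩ := Submodule.Quotient.mk_surjective _ y
    rw [br_mk, br_mk, ← map_neg, ← Submodule.Quotient.mk_neg]
    exact lof_congr (add_comm i j) _ _ (by simp)
  jacobi i j k x y z := by
    obtain ⟨x, rfl⟩ := Submodule.Quotient.mk_surjective _ x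
    obtain ⟨y, rfl⟩ := Submodule.Quotient.mk_surjective _ y
    obtain ⟨z, rfl⟩ := Submodule.Quotient.mk_surjective _ z
    simp only [br_mk]
    rw [lof_congr (add_assoc i j k).symm _
      ⟨⁅(x : L), ⁅(y : L), (z : L)⁆⁆, by
        rw [add_assoc]; exact h.lie_mem _ _ _ x.2 _ (h.lie_mem _ _ _ y.2 _ z.2)⟩ rfl,
      lof_congr (show j + (i + k) = i + j + k by ring) _
      ⟨⁅(y : L), ⁅(x : L), (z : L)⁆⁆, by
        rw [add_comm i j, add_assoc]
        exact h.lie_mem _ _ _ y.2 _ (h.lie_mem _ _ _ x.2 _ z.2)⟩ rfl,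
      ← map_add, ← Submodule.Quotient.mk_add]
    congr 2
    ext
    simp

def proj (h : IsGradedPair F N) (i : ℤ) : F i →ₗ[ℝ] h.toGraded.V i :=
  ((N i).comap (F i).subtype).mkQ

end IsGradedPair

/-- A decreasing filtration of a Lie algebra that respects the bracket: `[F i, F j] ⊆ F (i + j)`. -/
structure IsLieFiltration (F : ℤ → Submodule ℝ L) : Prop where
  antitone : Antitone F
  lie_mem : ∀ i j, ∀ x ∈ F i, ∀ y ∈ F j, ⁅x, y⁆ ∈ F (i + j)

theorem IsLieFiltration.isGradedPair {F : ℤ → Submodule ℝ L} (h : IsLieFiltration F) :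
    IsGradedPair F (fun i => F (i + 1)) where
  lie_mem := h.lie_mem
  lie_mem_sub i j x hx y hy := by
    have := h.lie_mem (i + 1) j x hx y hy
    rwa [add_right_comm] at this

/-- The associated graded Lie algebra `⨁ F i / F (i + 1)`, with the induced bracket. -/
def IsLieFiltration.gr {F : ℤ → Submodule ℝ L} (h : IsLieFiltration F) : GradedLieAlg.{u} :=
  h.isGradedPair.toGraded

/-- The class in `F i / F (i + 1)` of an element of `F i`. -/
def IsLieFiltration.cls {F : ℤ → Submodule ℝ L} (h : IsLieFiltration F) (i : ℤ) :
    F i →ₗ[ℝ] h.gr.V i :=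
  h.isGradedPair.proj i

end Subquotient

end TanakaTheory

namespace TanakaTheory

universe w

set_option linter.unusedSectionVars false

section Coinduced

variable (𝔫 : Type w) [LieRing 𝔫] [LieAlgebra ℝ 𝔫]

/-- The ambient space in which the algebraic prolongation of a graded Lie algebra `𝔫` is built.
An element `u` of the prolongation is recorded by the function sending a list `Y₁, …, Yⱼ` of elements of
`𝔫` to the component in `𝔫` of the iterated bracket `[[…[u, Y₁], …], Yⱼ]`. Such a function is linear in
each argument and satisfies `[[v, X], Y] - [[v, Y], X] = [v, [X, Y]]` at each place; `Coind 𝔫` is the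
space of all functions with these two properties. -/
def Coind : Submodule ℝ (List 𝔫 → 𝔫) where
  carrier := {w |
    (∀ p r X Y, w (p ++ (X + Y) :: r) = w (p ++ X :: r) + w (p ++ Y :: r)) ∧
    (∀ p r (c : ℝ) X, w (p ++ (c • X) :: r) = c • w (p ++ X :: r)) ∧
    (∀ p r X Y, w (p ++ ⁅X, Y⁆ :: r) = w (p ++ X :: Y :: r) - w (p ++ Y :: X :: r))}
  add_mem' := by
    rintro u v ⟨h1, h2, h3⟩ ⟨k1, k2, k3⟩
    refine ⟨fun p r X Y => ?_, fun p r c X => ?_, fun p r X Y => ?_⟩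
    · simp only [Pi.add_apply, h1, k1]; abel
    · simp only [Pi.add_apply, h2, k2, smul_add]
    · simp only [Pi.add_apply, h3, k3]; abel
  zero_mem' := by simp
  smul_mem' := by
    rintro c u ⟨h1, h2, h3⟩
    refine ⟨fun p r X Y => ?_, fun p r d X => ?_, fun p r X Y => ?_⟩
    · simp only [Pi.smul_apply, h1, smul_add]
    · simp only [Pi.smul_apply, h2, smul_comm c d]
    · simp only [Pi.smul_apply, h3, smul_sub]

namespace Coind

variable {𝔫}

/-- The bracket `[u, X]` with an element `X` of `𝔫`: the function `(Y₁, …) ↦ u (X, Y₁, …)`. -/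
def act (u : Coind 𝔫) (X : 𝔫) : Coind 𝔫 :=
  ⟨fun l => u.1 (X :: l), fun p => u.2.1 (X :: p), fun p => u.2.2.1 (X :: p),
    fun p => u.2.2.2 (X :: p)⟩

@[simp] theorem act_apply (u : Coind 𝔫) (X : 𝔫) (l : List 𝔫) : (act u X).1 l = u.1 (X :: l) := rfl

theorem ext' {u v : Coind 𝔫} (h0 : u.1 [] = v.1 []) (h : ∀ X, act u X = act v X) : u = v := by
  apply Subtype.ext
  funext l
  cases l with
  | nil => exact h0
  | cons X l => exact congrFun (congrArg Subtype.val (h X)) l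

@[simp] theorem act_add (u : Coind 𝔫) (X Y : 𝔫) : act u (X + Y) = act u X + act u Y :=
  Subtype.ext (funext fun l => u.2.1 [] l X Y)

@[simp] theorem act_smul (u : Coind 𝔫) (c : ℝ) (X : 𝔫) : act u (c • X) = c • act u X :=
  Subtype.ext (funext fun l => u.2.2.1 [] l c X)

@[simp] theorem act_zero (u : Coind 𝔫) : act u 0 = 0 := by
  simpa using act_smul u 0 0

theorem act_lie (u : Coind 𝔫) (X Y : 𝔫) : act u ⁅X, Y⁆ = act (act u X) Y - act (act u Y) X :=
  Subtype.ext (funext fun l => u.2.2.2 [] l X Y)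

@[simp] theorem add_act (u v : Coind 𝔫) (X : 𝔫) : act (u + v) X = act u X + act v X := rfl
@[simp] theorem sub_act (u v : Coind 𝔫) (X : 𝔫) : act (u - v) X = act u X - act v X := rfl
@[simp] theorem neg_act (u : Coind 𝔫) (X : 𝔫) : act (-u) X = - act u X := rfl
@[simp] theorem smul_act (c : ℝ) (u : Coind 𝔫) (X : 𝔫) : act (c • u) X = c • act u X := rfl
@[simp] theorem zero_act (X : 𝔫) : act (0 : Coind 𝔫) X = 0 := rfl

/-- Construct an element from its value at the empty list and its action. -/
def cons (Z : 𝔫) (f : 𝔫 →ₗ[ℝ] Coind 𝔫)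
    (hf : ∀ X Y, f ⁅X, Y⁆ = act (f X) Y - act (f Y) X) : Coind 𝔫 :=
  ⟨fun l => match l with
    | [] => Z
    | X :: l => (f X).1 l, by
    refine ⟨fun p r X Y => ?_, fun p r c X => ?_, fun p r X Y => ?_⟩
    · cases p with
      | nil => simp
      | cons T p => exact (f T).2.1 p r X Y
    · cases p with
      | nil => simp
      | cons T p => exact (f T).2.2.1 p r c X
    · cases p with
      | nil => simp [hf]
      | cons T p => exact (f T).2.2.2 p r X Y⟩

@[simp] theorem cons_nil (Z : 𝔫) (f : 𝔫 →ₗ[ℝ] Coind 𝔫) (hf) : (cons Z f hf).1 [] = Z := rfl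
@[simp] theorem act_cons (Z : 𝔫) (f : 𝔫 →ₗ[ℝ] Coind 𝔫) (hf) (X : 𝔫) :
    act (cons Z f hf) X = f X := rfl

/-- The iterated bracket `[[…[Z, Y₁], …], Yⱼ]` in `𝔫`. -/
def iter (Z : 𝔫) (l : List 𝔫) : 𝔫 := l.foldl (fun A Y => ⁅A, Y⁆) Z

theorem iter_add (Z Z' : 𝔫) (l : List 𝔫) : iter (Z + Z') l = iter Z l + iter Z' l := by
  induction l generalizing Z Z' with
  | nil => rfl
  | cons Y l ih => simp only [iter, List.foldl_cons, add_lie] at ih ⊢; exact ih _ _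

theorem iter_smul (c : ℝ) (Z : 𝔫) (l : List 𝔫) : iter (c • Z) l = c • iter Z l := by
  induction l generalizing Z with
  | nil => rfl
  | cons Y l ih => simp only [iter, List.foldl_cons, smul_lie] at ih ⊢; exact ih _

theorem iter_append (Z : 𝔫) (p r : List 𝔫) : iter Z (p ++ r) = iter (iter Z p) r :=
  List.foldl_append

theorem iter_cons (Z Y : 𝔫) (r : List 𝔫) : iter Z (Y :: r) = iter ⁅Z, Y⁆ r := rfl

/-- The embedding of `𝔫` into `Coind 𝔫`. It is a Lie algebra homomorphism (`emb_lie`), and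
`⁅u, emb X⁆ = act u X` (`lie_emb`). -/
def emb : 𝔫 →ₗ[ℝ] Coind 𝔫 where
  toFun Z := ⟨iter Z, by
    refine ⟨fun p r X Y => ?_, fun p r c X => ?_, fun p r X Y => ?_⟩
    · simp only [iter_append, iter_cons, lie_add, iter_add]
    · simp only [iter_append, iter_cons, lie_smul, iter_smul]
    · simp only [iter_append, iter_cons]
      rw [sub_eq_add_neg, ← neg_one_smul ℝ (iter _ r), ← iter_smul, ← iter_add]
      congr 1
      rw [leibniz_lie (iter Z p) X Y, ← lie_skew X, neg_one_smul]⟩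
  map_add' Z Z' := Subtype.ext (funext fun l => iter_add Z Z' l)
  map_smul' c Z := Subtype.ext (funext fun l => iter_smul c Z l)

@[simp] theorem emb_nil (Z : 𝔫) : (emb Z).1 [] = Z := rfl
@[simp] theorem act_emb (Z X : 𝔫) : act (emb Z) X = emb ⁅Z, X⁆ := rfl

/-- The bracket of `Coind 𝔫`. The value at the empty list is the `𝔫`-component of `[u, v]`; the
remaining values are forced by the Leibniz rule `[[u, v], X] = [[u, X], v] + [u, [v, X]]`. -/
def brFun : (u v : Coind 𝔫) → List 𝔫 → 𝔫
  | u, v, [] => u.1 [v.1 []] - v.1 [u.1 []] - ⁅u.1 [], v.1 []⁆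
  | u, v, X :: l => brFun (act u X) v l + brFun u (act v X) l

theorem single_add (u : Coind 𝔫) (X Y : 𝔫) : u.1 [X + Y] = u.1 [X] + u.1 [Y] := u.2.1 [] [] X Y
theorem single_smul (u : Coind 𝔫) (c : ℝ) (X : 𝔫) : u.1 [c • X] = c • u.1 [X] := u.2.2.1 [] [] c X

theorem brFun_add_left (u u' v : Coind 𝔫) (l : List 𝔫) :
    brFun (u + u') v l = brFun u v l + brFun u' v l := by
  induction l generalizing u u' v with
  | nil =>
    simp only [brFun, Submodule.coe_add, Pi.add_apply, single_add, add_lie]; abel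
  | cons X l ih => simp only [brFun, add_act, ih]; abel

theorem brFun_smul_left (c : ℝ) (u v : Coind 𝔫) (l : List 𝔫) :
    brFun (c • u) v l = c • brFun u v l := by
  induction l generalizing u v with
  | nil =>
    simp only [brFun, Submodule.coe_smul, Pi.smul_apply, single_smul, smul_lie, smul_sub]
  | cons X l ih => simp only [brFun, smul_act, ih, smul_add]

theorem brFun_skew (u v : Coind 𝔫) (l : List 𝔫) : brFun u v l = - brFun v u l := by
  induction l generalizing u v with
  | nil => simp only [brFun]; rw [← lie_skew]; abel
  | cons X l ih => simp only [brFun]; rw [ih (act u X) v, ih u]; abel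

theorem brFun_add_right (u v v' : Coind 𝔫) (l : List 𝔫) :
    brFun u (v + v') l = brFun u v l + brFun u v' l := by
  rw [brFun_skew, brFun_add_left, brFun_skew u v, brFun_skew u v']; abel

theorem brFun_smul_right (c : ℝ) (u v : Coind 𝔫) (l : List 𝔫) :
    brFun u (c • v) l = c • brFun u v l := by
  rw [brFun_skew, brFun_smul_left, brFun_skew u v, smul_neg]

theorem brFun_sub_left (u u' v : Coind 𝔫) (l : List 𝔫) :
    brFun (u - u') v l = brFun u v l - brFun u' v l := by
  rw [sub_eq_add_neg, ← neg_one_smul ℝ u', brFun_add_left, brFun_smul_left]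
  simp [sub_eq_add_neg]

theorem brFun_sub_right (u v v' : Coind 𝔫) (l : List 𝔫) :
    brFun u (v - v') l = brFun u v l - brFun u v' l := by
  rw [sub_eq_add_neg, ← neg_one_smul ℝ v', brFun_add_right, brFun_smul_right]
  simp [sub_eq_add_neg]

theorem brFun_mem (u v : Coind 𝔫) : brFun u v ∈ Coind 𝔫 := by
  refine ⟨fun p r X Y => ?_, fun p r c X => ?_, fun p r X Y => ?_⟩
  · induction p generalizing u v with
    | nil => simp only [List.nil_append, brFun, act_add, brFun_add_left, brFun_add_right]; abel
    | cons T p ih => simp only [List.cons_append, brFun, ih]; abel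
  · induction p generalizing u v with
    | nil =>
      simp only [List.nil_append, brFun, act_smul, brFun_smul_left, brFun_smul_right, smul_add]
    | cons T p ih => simp only [List.cons_append, brFun, ih, smul_add]
  · induction p generalizing u v with
    | nil =>
      simp only [List.nil_append, brFun, act_lie, brFun_sub_left, brFun_sub_right]; abel
    | cons T p ih => simp only [List.cons_append, brFun, ih]; abel

def br (u v : Coind 𝔫) : Coind 𝔫 := ⟨brFun u v, brFun_mem u v⟩

theorem br_nil (u v : Coind 𝔫) :
    (br u v).1 [] = u.1 [v.1 []] - v.1 [u.1 []] - ⁅u.1 [], v.1 []⁆ := rfl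

theorem act_br (u v : Coind 𝔫) (X : 𝔫) : act (br u v) X = br (act u X) v + br u (act v X) := rfl

theorem br_single (u v : Coind 𝔫) (X : 𝔫) :
    (br u v).1 [X] = (br (act u X) v).1 [] + (br u (act v X)).1 [] := rfl

theorem br_jacobi_fun (u v t : Coind 𝔫) (l : List 𝔫) :
    (br u (br v t)).1 l = (br (br u v) t).1 l + (br v (br u t)).1 l := by
  induction l generalizing u v t with
  | nil =>
    have lie1 : ∀ (a : Coind 𝔫) (X Y : 𝔫), a.1 [⁅X, Y⁆] = a.1 [X, Y] - a.1 [Y, X] :=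
      fun a X Y => a.2.2.2 [] [] X Y
    have sub1 : ∀ (a : Coind 𝔫) (X Y : 𝔫), a.1 [X - Y] = a.1 [X] - a.1 [Y] := by
      intro a X Y
      rw [sub_eq_add_neg, ← neg_one_smul ℝ Y, single_add, single_smul]; simp [sub_eq_add_neg]
    simp only [br_nil, br_single, act_apply, sub1, lie1, lie_sub, sub_lie]
    rw [leibniz_lie (u.1 []) (v.1 []) (t.1 []), ← lie_skew (u.1 [t.1 []]) (v.1 [])]
    abel
  | cons X l ih =>
    have h : ∀ a b : Coind 𝔫, (br a b).1 (X :: l) = (br (act a X) b).1 l + (br a (act b X)).1 l :=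
      fun _ _ => rfl
    have hl : ∀ a b c : Coind 𝔫, (br (a + b) c).1 l = (br a c).1 l + (br b c).1 l :=
      fun a b c => brFun_add_left a b c l
    have hr : ∀ a b c : Coind 𝔫, (br a (b + c)).1 l = (br a b).1 l + (br a c).1 l :=
      fun a b c => brFun_add_right a b c l
    rw [h, act_br, hr, h, act_br, hl, h, act_br, hr, ih (act u X) v t, ih u (act v X) t,
      ih u v (act t X)]
    abel

instance : LieRing (Coind 𝔫) where
  bracket := br
  add_lie u v t := Subtype.ext (funext fun l => brFun_add_left u v t l)
  lie_add u v t := Subtype.ext (funext fun l => brFun_add_right u v t l)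
  lie_self u := Subtype.ext (funext fun l => by
    have h := brFun_skew u u l
    have h2 : (2 : ℝ) • brFun u u l = 0 := by
      rw [two_smul]; nth_rewrite 2 [h]; simp
    exact (smul_eq_zero.1 h2).resolve_left two_ne_zero)
  leibniz_lie u v t := Subtype.ext (funext fun l => br_jacobi_fun u v t l)

instance : LieAlgebra ℝ (Coind 𝔫) where
  lie_smul c u v := Subtype.ext (funext fun l => brFun_smul_right c u v l)

theorem lie_nil (u v : Coind 𝔫) :
    (⁅u, v⁆ : Coind 𝔫).1 [] = u.1 [v.1 []] - v.1 [u.1 []] - ⁅u.1 [], v.1 []⁆ := rfl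

theorem act_bracket (u v : Coind 𝔫) (X : 𝔫) : act ⁅u, v⁆ X = ⁅act u X, v⁆ + ⁅u, act v X⁆ := rfl

theorem lie_emb_fun (u : Coind 𝔫) (X : 𝔫) (l : List 𝔫) :
    (⁅u, emb X⁆ : Coind 𝔫).1 l = u.1 (X :: l) := by
  induction l generalizing u X with
  | nil =>
    rw [lie_nil, emb_nil, ← act_apply (emb X), act_emb, emb_nil, ← lie_skew]; abel
  | cons Y l ih =>
    rw [← act_apply, act_bracket, act_emb, Submodule.coe_add, Pi.add_apply, ih, ih]
    have := congrFun (congrArg Subtype.val (act_lie u X Y)) l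
    simp only [act_apply, Submodule.coe_sub, Pi.sub_apply] at this ⊢
    rw [this]; abel

theorem lie_emb (u : Coind 𝔫) (X : 𝔫) : ⁅u, emb X⁆ = act u X :=
  Subtype.ext (funext fun l => lie_emb_fun u X l)

theorem emb_lie (X Y : 𝔫) : emb ⁅X, Y⁆ = ⁅emb X, emb Y⁆ := by rw [lie_emb, act_emb]

end Coind

end Coinduced

section Prolongation

variable (D : GradedLieAlg.{w})

open Coind

/-- `IsProl D i u`: the element `u` belongs to the component `𝔤ᵢ` of the Tanaka prolongation of the
negatively graded Lie algebra `D`. For `i < 0` this is the component of degree `i` of `D` itself. For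
`k ≥ 0`, `𝔤ₖ` consists of the linear maps `u` from `D` to the sum of the components already constructed
that have degree `k` and satisfy `u [X, Y] = [u X, Y] + [X, u Y]`, where `u X` is `⁅u, emb X⁆`; linearity
and the derivation rule are part of `Coind`. See `prolongation_existsUnique`: each such map comes from a
unique element of `𝔤ₖ`. -/
inductive IsProl : ℤ → Coind D.Total → Prop
  | neg (i : ℤ) (hi : i < 0) (Z : D.V i) : IsProl i (emb (D.incl i Z))
  | nonneg (k : ℤ) (hk : 0 ≤ k) (u : Coind D.Total) (h0 : u.1 [] = 0)
      (h : ∀ i < 0, ∀ X : D.V i, IsProl (k + i) ⁅u, emb (D.incl i X)⁆) : IsProl k u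

theorem isProl_neg_iff {i : ℤ} (hi : i < 0) (u : Coind D.Total) :
    IsProl D i u ↔ ∃ Z : D.V i, emb (D.incl i Z) = u := by
  constructor
  · rintro (⟨_, _, Z⟩ | ⟨_, hk, _⟩)
    · exact ⟨Z, rfl⟩
    · omega
  · rintro ⟨Z, rfl⟩
    exact .neg i hi Z

theorem isProl_nonneg_iff {k : ℤ} (hk : 0 ≤ k) (u : Coind D.Total) :
    IsProl D k u ↔ u.1 [] = 0 ∧ ∀ i < 0, ∀ X : D.V i, IsProl D (k + i) ⁅u, emb (D.incl i X)⁆ := by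
  constructor
  · rintro (⟨_, hi, Z⟩ | ⟨_, _, _, h0, h⟩)
    · omega
    · exact ⟨h0, h⟩
  · rintro ⟨h0, h⟩
    exact .nonneg k hk u h0 h

theorem IsProl.zero (i : ℤ) : IsProl D i 0 := by
  have : ∀ n : ℕ, ∀ i : ℤ, i < n → IsProl D i 0 := by
    intro n
    induction n with
    | zero =>
      intro i hi
      exact (isProl_neg_iff D (by simpa using hi) 0).2 ⟨0, by simp⟩
    | succ n ih =>
      intro i hi
      rcases lt_or_ge i 0 with h | h
      · exact (isProl_neg_iff D h 0).2 ⟨0, by simp⟩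
      · refine (isProl_nonneg_iff D h 0).2 ⟨rfl, fun j hj X => ?_⟩
        rw [zero_lie]
        exact ih _ (by push_cast at hi; omega)
  exact this (i.toNat + 1) i (by omega)

theorem IsProl.add {i : ℤ} {u v : Coind D.Total} (hu : IsProl D i u) (hv : IsProl D i v) :
    IsProl D i (u + v) := by
  induction hu generalizing v with
  | neg i hi Z =>
    obtain ⟨Z', rfl⟩ := (isProl_neg_iff D hi v).1 hv
    exact (isProl_neg_iff D hi _).2 ⟨Z + Z', by simp⟩
  | nonneg k hk u h0 h ih =>
    obtain ⟨k0, kh⟩ := (isProl_nonneg_iff D hk v).1 hv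
    refine (isProl_nonneg_iff D hk _).2 ⟨by simp [h0, k0], fun j hj X => ?_⟩
    rw [add_lie]
    exact ih j hj X (kh j hj X)

theorem IsProl.smul {i : ℤ} (c : ℝ) {u : Coind D.Total} (hu : IsProl D i u) :
    IsProl D i (c • u) := by
  induction hu with
  | neg i hi Z => exact (isProl_neg_iff D hi _).2 ⟨c • Z, by simp⟩
  | nonneg k hk u h0 h ih =>
    refine (isProl_nonneg_iff D hk _).2 ⟨by simp [h0], fun j hj X => ?_⟩
    rw [smul_lie]
    exact ih j hj X

/-- The component `𝔤ᵢ` of the Tanaka prolongation, as a subspace. -/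
def prolGrade (i : ℤ) : Submodule ℝ (Coind D.Total) where
  carrier := {u | IsProl D i u}
  add_mem' := IsProl.add D
  zero_mem' := IsProl.zero D i
  smul_mem' c _ := IsProl.smul D c

theorem prolGrade_lie_neg {i j : ℤ} (hj : j < 0) {u : Coind D.Total} (hu : IsProl D i u)
    (Y : D.V j) : IsProl D (i + j) ⁅u, emb (D.incl j Y)⁆ := by
  cases hu with
  | neg _ hi Z =>
    rw [← emb_lie, D.lie_incl]
    exact .neg _ (by omega) _
  | nonneg _ hk _ h0 h => exact h j hj Y

theorem IsProl.lie {i j : ℤ} {u v : Coind D.Total} (hu : IsProl D i u) (hv : IsProl D j v) :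
    IsProl D (i + j) ⁅u, v⁆ := by
  induction hu generalizing j v with
  | neg i hi Z =>
    rw [← lie_skew, add_comm, ← neg_one_smul ℝ]
    exact (prolGrade_lie_neg D hi hv Z).smul D _
  | nonneg k hk u h0 h ihu =>
    induction hv with
    | neg j hj Z => exact h j hj Z
    | nonneg l hl v k0 k ihv =>
      refine .nonneg _ (by omega) _ ?_ fun i hi X => ?_
      · rw [lie_nil, h0, k0, ← act_apply, act_zero, ← act_apply, act_zero]; simp
      · rw [lie_emb, act_bracket, ← lie_emb, ← lie_emb]
        refine IsProl.add D ?_ ?_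
        · have := ihu i hi X (IsProl.nonneg l hl v k0 k)
          rwa [add_right_comm] at this
        · have := ihv i hi X
          rwa [← add_assoc] at this

/-- Each linear map `f` of degree `k ≥ 0` from `D` to the prolongation with
`f [X, Y] = [f X, Y] + [X, f Y]` is `X ↦ [u, X]` for exactly one `u` in `𝔤ₖ`. -/
theorem prolongation_existsUnique {k : ℤ} (hk : 0 ≤ k) (f : D.Total →ₗ[ℝ] Coind D.Total)
    (hdeg : ∀ i < 0, ∀ X : D.V i, f (D.incl i X) ∈ prolGrade D (k + i))
    (hder : ∀ X Y : D.Total, f ⁅X, Y⁆ = ⁅f X, emb Y⁆ + ⁅emb X, f Y⁆) :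
    ∃! u : prolGrade D k, ∀ X, ⁅(u : Coind D.Total), emb X⁆ = f X := by
  have hder' : ∀ X Y, f ⁅X, Y⁆ = act (f X) Y - act (f Y) X := by
    intro X Y
    rw [hder, ← lie_skew (emb X), lie_emb, lie_emb, sub_eq_add_neg]
  have key : ∀ X, ⁅cons 0 f hder', emb X⁆ = f X := fun X => by rw [lie_emb, act_cons]
  refine ⟨⟨cons 0 f hder', (isProl_nonneg_iff D hk _).2 ⟨rfl, fun i hi X => ?_⟩⟩, key, ?_⟩
  · rw [key]; exact hdeg i hi X
  · rintro ⟨v, hv⟩ hvX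
    apply Subtype.ext
    apply ext'
    · exact ((isProl_nonneg_iff D hk v).1 hv).1
    · intro X
      rw [← lie_emb, hvX, act_cons]

/-- The Tanaka prolongation `⨁ 𝔤ᵢ`, the direct sum over all integers `i`. -/
def GradedLieAlg.prolongation : GradedLieAlg.{w} :=
  GradedLieAlg.ofGrading (prolGrade D) (fun _ _ _ hx _ hy => IsProl.lie D hx hy)

/-- An element of `𝔤ᵢ` as a function of lists, see `Coind`. -/
def GradedLieAlg.prolVal (i : ℤ) : D.prolongation.V i →ₗ[ℝ] Coind D.Total :=
  (prolGrade D i).subtype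

end Prolongation
end TanakaTheory

namespace TanakaTheory

open VectorField Filter

set_option linter.unusedSectionVars false

section Germs

variable {E : Type*} [NormedAddCommGroup E] [NormedSpace ℝ E]
  {M : Type*} [TopologicalSpace M] [ChartedSpace E M]

variable (E M) in
/-- Arbitrary (not necessarily smooth) vector fields on `M`. -/
abbrev VField : Type _ := ∀ y : M, TangentSpace 𝓘(ℝ, E) y

variable [IsManifold 𝓘(ℝ, E) ∞ M]

/-- The vector field is smooth on a neighbourhood of `x`. (Mathlib's `ContMDiffAt … ∞` at the single
point `x` would be weaker.) -/
def SmoothNear (x : M) (X : VField E M) : Prop :=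
  ∀ᶠ y in 𝓝 x, ContMDiffAt 𝓘(ℝ, E) 𝓘(ℝ, E).tangent ∞
    (fun z => (⟨z, X z⟩ : TangentBundle 𝓘(ℝ, E) M)) y

/-- The function is smooth on a neighbourhood of `x`. -/
def SmoothFunNear (E : Type*) [NormedAddCommGroup E] [NormedSpace ℝ E]
    {M : Type*} [TopologicalSpace M] [ChartedSpace E M] (x : M) (f : M → ℝ) : Prop :=
  ∀ᶠ y in 𝓝 x, ContMDiffAt 𝓘(ℝ, E) 𝓘(ℝ, ℝ) ∞ f y

variable (E) in
/-- Vector fields that are smooth near `x`. -/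
def smoothFields (x : M) : Submodule ℝ (VField E M) where
  carrier := {X | SmoothNear x X}
  add_mem' := fun hX hY => by
    filter_upwards [hX, hY] with y h k using h.add_section k
  zero_mem' := Eventually.of_forall fun y =>
    (Bundle.contMDiff_zeroSection ℝ (TangentSpace 𝓘(ℝ, E) : M → Type _)).contMDiffAt
  smul_mem' := fun c X hX => by
    filter_upwards [hX] with y h using h.const_smul_section

variable (E) in
/-- Vector fields that vanish on a neighbourhood of `x`. -/
def nullFields (x : M) : Submodule ℝ (smoothFields E x) where
  carrier := {X | ∀ᶠ y in 𝓝 x, X.1 y = 0}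
  add_mem' := fun hX hY => by
    filter_upwards [hX, hY] with y h k
    simp [h, k]
  zero_mem' := Eventually.of_forall fun y => rfl
  smul_mem' := fun c X hX => by
    filter_upwards [hX] with y h
    simp [h]

variable (E) in
/-- The Lie algebra of germs at `x` of smooth vector fields. -/
abbrev VGerm (x : M) : Type _ := smoothFields E x ⧸ nullFields E x

/-- The germ at `x` of a vector field. -/
def VGerm.of (x : M) (X : VField E M) (hX : SmoothNear x X) : VGerm E x :=
  Submodule.Quotient.mk ⟨X, hX⟩

theorem VGerm.of_eq_of_iff {x : M} {X Y : VField E M} (hX : SmoothNear x X) (hY : SmoothNear x Y) :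
    VGerm.of x X hX = VGerm.of x Y hY ↔ ∀ᶠ y in 𝓝 x, X y = Y y := by
  rw [VGerm.of, VGerm.of, Submodule.Quotient.eq]
  exact eventually_congr (Eventually.of_forall fun y => sub_eq_zero)

theorem VGerm.exists_of {x : M} (a : VGerm E x) : ∃ X hX, VGerm.of x X hX = a := by
  obtain ⟨⟨X, hX⟩, rfl⟩ := Submodule.Quotient.mk_surjective _ a
  exact ⟨X, hX, rfl⟩

/-- The value of a germ at `x`. -/
def VGerm.ev (x : M) : VGerm E x →ₗ[ℝ] TangentSpace 𝓘(ℝ, E) x :=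
  (nullFields E x).liftQ
    { toFun := fun X => X.1 x
      map_add' := fun _ _ => rfl
      map_smul' := fun _ _ => rfl }
    (fun _ hX => hX.self_of_nhds)

theorem VGerm.ev_of (x : M) (X : VField E M) (hX : SmoothNear x X) :
    VGerm.ev x (VGerm.of x X hX) = X x := rfl

theorem SmoothNear.add {x : M} {X Y : VField E M} (hX : SmoothNear x X) (hY : SmoothNear x Y) :
    SmoothNear x (X + Y) := (smoothFields E x).add_mem hX hY

theorem SmoothNear.smul {x : M} {X : VField E M} (c : ℝ) (hX : SmoothNear x X) :
    SmoothNear x (c • X) := (smoothFields E x).smul_mem c hX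

theorem SmoothNear.fsmul {x : M} {f : M → ℝ} {X : VField E M} (hf : SmoothFunNear E x f)
    (hX : SmoothNear x X) : SmoothNear x (f • X) := by
  filter_upwards [hX, hf] with y h k
  exact ContMDiffAt.smul_section k h

/-- Multiplication of a germ of vector fields by a smooth function. -/
def VGerm.fsmul {x : M} (f : M → ℝ) (hf : SmoothFunNear E x f) : VGerm E x →ₗ[ℝ] VGerm E x :=
  (nullFields E x).mapQ (nullFields E x)
    { toFun := fun X => ⟨f • X.1, SmoothNear.fsmul hf X.2⟩
      map_add' := fun X Y => Subtype.ext (smul_add f X.1 Y.1)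
      map_smul' := fun c X => Subtype.ext (funext fun y => smul_comm (f y) c (X.1 y)) }
    (fun X hX => by
      change ∀ᶠ y in 𝓝 x, f y • X.1 y = 0
      filter_upwards [hX] with y h
      simp [h])

theorem VGerm.fsmul_of {x : M} (f : M → ℝ) (hf : SmoothFunNear E x f) (X : VField E M)
    (hX : SmoothNear x X) :
    VGerm.fsmul f hf (VGerm.of x X hX) = VGerm.of x (f • X) (hX.fsmul hf) := rfl

variable [FiniteDimensional ℝ E]

theorem SmoothNear.bracket {x : M} {X Y : VField E M} (hX : SmoothNear x X) (hY : SmoothNear x Y) :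
    SmoothNear x (mlieBracket 𝓘(ℝ, E) X Y) := by
  have : CompleteSpace E := FiniteDimensional.complete ℝ E
  have : IsManifold 𝓘(ℝ, E) (((⊤ : ℕ∞) : WithTop ℕ∞) + 1) M := by
    simpa using (inferInstance : IsManifold 𝓘(ℝ, E) ∞ M)
  have : IsManifold 𝓘(ℝ, E) (minSmoothness ℝ 2) M := by
    rw [minSmoothness_of_isRCLikeNormedField]; infer_instance
  filter_upwards [hX, hY] with y h k
  exact ContMDiffAt.mlieBracket_vectorField (m := ⊤) (n := ⊤) h k
    (by simp [minSmoothness_of_isRCLikeNormedField])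

theorem SmoothNear.mdiff {x : M} {X : VField E M} (hX : SmoothNear x X) :
    ∀ᶠ y in 𝓝 x, MDifferentiableAt 𝓘(ℝ, E) 𝓘(ℝ, E).tangent
      (fun z => (⟨z, X z⟩ : TangentBundle 𝓘(ℝ, E) M)) y := by
  filter_upwards [hX] with y h using h.mdifferentiableAt (by simp)

def preBracket (x : M) : smoothFields E x →ₗ[ℝ] smoothFields E x →ₗ[ℝ] VGerm E x :=
  LinearMap.mk₂ ℝ
    (fun X Y => VGerm.of x (mlieBracket 𝓘(ℝ, E) X.1 Y.1) (SmoothNear.bracket X.2 Y.2))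
    (fun X X' Y => by
      have : CompleteSpace E := FiniteDimensional.complete ℝ E
      refine (VGerm.of_eq_of_iff _ (SmoothNear.bracket X.2 Y.2 |>.add
        (SmoothNear.bracket X'.2 Y.2))).2 ?_
      filter_upwards [SmoothNear.mdiff X.2, SmoothNear.mdiff X'.2] with y h h'
      exact mlieBracket_add_left h h')
    (fun c X Y => by
      have : CompleteSpace E := FiniteDimensional.complete ℝ E
      refine (VGerm.of_eq_of_iff _ ((SmoothNear.bracket X.2 Y.2).smul c)).2 ?_
      filter_upwards [SmoothNear.mdiff X.2] with y h
      exact mlieBracket_const_smul_left h)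
    (fun X Y Y' => by
      have : CompleteSpace E := FiniteDimensional.complete ℝ E
      refine (VGerm.of_eq_of_iff _ (SmoothNear.bracket X.2 Y.2 |>.add
        (SmoothNear.bracket X.2 Y'.2))).2 ?_
      filter_upwards [SmoothNear.mdiff Y.2, SmoothNear.mdiff Y'.2] with y h h'
      exact mlieBracket_add_right h h')
    (fun c X Y => by
      have : CompleteSpace E := FiniteDimensional.complete ℝ E
      refine (VGerm.of_eq_of_iff _ ((SmoothNear.bracket X.2 Y.2).smul c)).2 ?_
      filter_upwards [SmoothNear.mdiff Y.2] with y h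
      exact mlieBracket_const_smul_right h)

theorem preBracket_null_left (x : M) (X Y : smoothFields E x) (hX : X ∈ nullFields E x) :
    preBracket x X Y = 0 := by
  refine (VGerm.of_eq_of_iff _ (smoothFields E x).zero_mem).2 ?_
  have h : X.1 =ᶠ[𝓝 x] (0 : VField E M) := hX
  filter_upwards [h.mlieBracket_vectorField (EventuallyEq.refl _ Y.1)] with y hy
  exact hy.trans (congrFun mlieBracket_zero_left y)

theorem preBracket_null_right (x : M) (X Y : smoothFields E x) (hY : Y ∈ nullFields E x) :
    preBracket x X Y = 0 := by
  refine (VGerm.of_eq_of_iff _ (smoothFields E x).zero_mem).2 ?_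
  have h : Y.1 =ᶠ[𝓝 x] (0 : VField E M) := hY
  filter_upwards [(EventuallyEq.refl _ X.1).mlieBracket_vectorField h] with y hy
  exact hy.trans (congrFun mlieBracket_zero_right y)

/-- The commutator of germs of vector fields. -/
def VGerm.bracket (x : M) : VGerm E x →ₗ[ℝ] VGerm E x →ₗ[ℝ] VGerm E x :=
  Submodule.liftQ _
    ((Submodule.liftQ _ (preBracket x).flip (fun Y hY =>
      LinearMap.ext fun X => preBracket_null_right x X Y hY)).flip)
    (fun X hX => by
      rw [LinearMap.mem_ker]
      ext Y
      exact preBracket_null_left x X Y hX)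

theorem VGerm.bracket_of {x : M} {X Y : VField E M} (hX : SmoothNear x X) (hY : SmoothNear x Y) :
    VGerm.bracket x (VGerm.of x X hX) (VGerm.of x Y hY) =
      VGerm.of x (mlieBracket 𝓘(ℝ, E) X Y) (hX.bracket hY) := rfl

instance (x : M) : LieRing (VGerm E x) where
  bracket a b := VGerm.bracket x a b
  add_lie a b c := by
    change VGerm.bracket x _ _ = VGerm.bracket x _ _ + VGerm.bracket x _ _
    simp
  lie_add a b c := by
    change VGerm.bracket x _ _ = VGerm.bracket x _ _ + VGerm.bracket x _ _
    simp
  lie_self a := by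
    obtain ⟨X, hX, rfl⟩ := a.exists_of
    change VGerm.bracket x _ _ = 0
    rw [VGerm.bracket_of]
    refine (VGerm.of_eq_of_iff _ (smoothFields E x).zero_mem).2 ?_
    exact Eventually.of_forall fun y => by rw [mlieBracket_self]
  leibniz_lie a b c := by
    have : CompleteSpace E := FiniteDimensional.complete ℝ E
    have : IsManifold 𝓘(ℝ, E) (minSmoothness ℝ 3) M := by
      rw [minSmoothness_of_isRCLikeNormedField]; infer_instance
    obtain ⟨X, hX, rfl⟩ := a.exists_of
    obtain ⟨Y, hY, rfl⟩ := b.exists_of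
    obtain ⟨Z, hZ, rfl⟩ := c.exists_of
    change VGerm.bracket x _ (VGerm.bracket x _ _) = VGerm.bracket x (VGerm.bracket x _ _) _ +
      VGerm.bracket x _ (VGerm.bracket x _ _)
    simp only [VGerm.bracket_of]
    refine (VGerm.of_eq_of_iff _ (((hX.bracket hY).bracket hZ).add
      (hY.bracket (hX.bracket hZ)))).2 ?_
    have h2 : minSmoothness ℝ 2 ≤ (∞ : WithTop ℕ∞) := by
      rw [minSmoothness_of_isRCLikeNormedField]; exact WithTop.coe_le_coe.2 le_top
    filter_upwards [hX, hY, hZ] with y h k l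
    exact leibniz_identity_mlieBracket_apply (h.of_le h2) (k.of_le h2) (l.of_le h2)

instance (x : M) : LieAlgebra ℝ (VGerm E x) where
  lie_smul c a b := by
    change VGerm.bracket x _ _ = c • VGerm.bracket x _ _
    simp

theorem VGerm.lie_of {x : M} {X Y : VField E M} (hX : SmoothNear x X) (hY : SmoothNear x Y) :
    ⁅VGerm.of x X hX, VGerm.of x Y hY⁆ =
      VGerm.of x (mlieBracket 𝓘(ℝ, E) X Y) (hX.bracket hY) := rfl

theorem SmoothFunNear.lieDeriv {x : M} {f : M → ℝ} {Z : VField E M} (hf : SmoothFunNear E x f)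
    (hZ : SmoothNear x Z) : SmoothFunNear E x (fun y => mvfderiv 𝓘(ℝ, E) f y (Z y)) := by
  obtain ⟨U, hU, hUo, hxU⟩ := eventually_nhds_iff.1 (hf.and hZ)
  have hfU : ContMDiffOn 𝓘(ℝ, E) 𝓘(ℝ, ℝ) ∞ f U := fun y hy => (hU y hy).1.contMDiffWithinAt
  have hZU : ContMDiffOn 𝓘(ℝ, E) 𝓘(ℝ, E).tangent ∞
      (fun z => (⟨z, Z z⟩ : TangentBundle 𝓘(ℝ, E) M)) U :=
    fun y hy => (hU y hy).2.contMDiffWithinAt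
  have h1 := (hfU.contMDiffOn_tangentMapWithin (m := ∞) (by simp) hUo.uniqueMDiffOn).comp hZU
    (fun y hy => hy)
  have h2 := (contMDiff_snd_tangentBundle_modelSpace ℝ 𝓘(ℝ, ℝ) (n := ∞)).comp_contMDiffOn h1
  filter_upwards [hUo.mem_nhds hxU] with y hy
  refine ((h2 y hy).contMDiffAt (hUo.mem_nhds hy)).congr_of_eventuallyEq ?_
  filter_upwards [hUo.mem_nhds hy] with z hz
  change (mfderiv 𝓘(ℝ, E) 𝓘(ℝ, ℝ) f z) (Z z) = (mfderivWithin 𝓘(ℝ, E) 𝓘(ℝ, ℝ) f U z) (Z z)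
  rw [mfderivWithin_of_isOpen hUo hz]

theorem VGerm.fsmul_lie {x : M} {f : M → ℝ} (hf : SmoothFunNear E x f) {Z : VField E M}
    (hZ : SmoothNear x Z) (a : VGerm E x) :
    ⁅VGerm.fsmul f hf a, VGerm.of x Z hZ⁆ = VGerm.fsmul f hf ⁅a, VGerm.of x Z hZ⁆ -
      VGerm.fsmul _ (hf.lieDeriv hZ) a := by
  have : CompleteSpace E := FiniteDimensional.complete ℝ E
  obtain ⟨X, hX, rfl⟩ := a.exists_of
  rw [VGerm.fsmul_of, VGerm.fsmul_of, VGerm.lie_of, VGerm.lie_of, VGerm.fsmul_of, eq_sub_iff_add_eq]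
  refine (VGerm.of_eq_of_iff (((hX.fsmul hf).bracket hZ).add (hX.fsmul (hf.lieDeriv hZ)))
    ((hX.bracket hZ).fsmul hf)).2 ?_
  filter_upwards [hX.mdiff, hf] with y h k
  have := mlieBracket_smul_left (V := X) (W := Z) (k.mdifferentiableAt (by simp)) h
  change mlieBracket 𝓘(ℝ, E) (f • X) Z y + mvfderiv 𝓘(ℝ, E) f y (Z y) • X y =
    f y • mlieBracket 𝓘(ℝ, E) X Z y
  rw [this]
  simp

end Germs
end TanakaTheory

namespace TanakaTheory

open VectorField Filter

set_option linter.unusedSectionVars false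

section Distributions

variable (E : Type*) [NormedAddCommGroup E] [NormedSpace ℝ E]
  (M : Type*) [TopologicalSpace M] [ChartedSpace E M] [IsManifold 𝓘(ℝ, E) ∞ M]

/-- A smooth distribution on `M`: a vector subbundle of the tangent bundle. -/
structure TangentDistribution where
  fiber : ∀ y : M, Submodule ℝ (TangentSpace 𝓘(ℝ, E) y)
  exists_frame : ∀ x : M, ∃ (k : ℕ) (Y : Fin k → VField E M), (∀ j, SmoothNear x (Y j)) ∧
    ∀ᶠ y in 𝓝 x, LinearIndependent ℝ (fun j => Y j y) ∧
      Submodule.span ℝ (Set.range fun j => Y j y) = fiber y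

namespace TangentDistribution

variable {E M} [FiniteDimensional ℝ E] (Δ : TangentDistribution E M) (x : M)

/-- Germs at `x` of sections of `Δ`. -/
def germs : Submodule ℝ (VGerm E x) where
  carrier := {a | ∃ (X : VField E M) (hX : SmoothNear x X), VGerm.of x X hX = a ∧
    ∀ᶠ y in 𝓝 x, X y ∈ Δ.fiber y}
  add_mem' := by
    rintro _ _ ⟨X, hX, rfl, h⟩ ⟨Y, hY, rfl, k⟩
    refine ⟨X + Y, hX.add hY, rfl, ?_⟩
    filter_upwards [h, k] with y h k using (Δ.fiber y).add_mem h k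
  zero_mem' := ⟨0, (smoothFields E x).zero_mem, rfl,
    Eventually.of_forall fun y => (Δ.fiber y).zero_mem⟩
  smul_mem' := by
    rintro c _ ⟨X, hX, rfl, h⟩
    refine ⟨c • X, hX.smul c, rfl, ?_⟩
    filter_upwards [h] with y h using (Δ.fiber y).smul_mem c h

/-- Germs at `x` of sections of the weak derived flag: `Γ(Δ₀) = 0`, `Γ(Δ₁) = Γ(Δ)` and
`Γ(Δ_{s+1}) = Γ(Δ_s) + [Γ(Δ), Γ(Δ_s)]`. This is a module over smooth functions (`fsmul_mem_sec`). -/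
def sec : ℕ → Submodule ℝ (VGerm E x)
  | 0 => ⊥
  | 1 => Δ.germs x
  | s + 2 => sec (s + 1) ⊔
      Submodule.span ℝ {c | ∃ a ∈ Δ.germs x, ∃ b ∈ sec (s + 1), c = ⁅a, b⁆}

/-- The subspace `Δ_s(x)` of the tangent space, the values at `x` of sections of `Δ_s`. -/
def flag (s : ℕ) : Submodule ℝ (TangentSpace 𝓘(ℝ, E) x) := (Δ.sec x s).map (VGerm.ev x)

/-- All `Δ_s` have constant rank. -/
def IsRegular : Prop := ∀ s : ℕ, ∃ r : ℕ, ∀ y : M, Module.finrank ℝ (Δ.flag y s) = r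

/-- `Δ_κ` is the whole tangent bundle for some `κ`. -/
def IsCompletelyNonholonomic : Prop := ∃ κ : ℕ, ∀ y : M, Δ.flag y κ = ⊤

theorem flag_one : Δ.flag x 1 = Δ.fiber x := by
  apply le_antisymm
  · rintro _ ⟨_, ⟨X, hX, rfl, h⟩, rfl⟩
    exact h.self_of_nhds
  · obtain ⟨k, Y, hY, h⟩ := Δ.exists_frame x
    rw [← h.self_of_nhds.2, Submodule.span_le]
    rintro _ ⟨j, rfl⟩
    refine ⟨VGerm.of x (Y j) (hY j), ⟨Y j, hY j, rfl, ?_⟩, rfl⟩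
    filter_upwards [h] with y hy
    rw [← hy.2]
    exact Submodule.subset_span ⟨j, rfl⟩

theorem sec_mono : Monotone (Δ.sec x) := by
  refine monotone_nat_of_le_succ fun s => ?_
  match s with
  | 0 => exact bot_le
  | s + 1 => exact le_sup_left

theorem lie_mem_sec_succ {s : ℕ} {a b : VGerm E x} (ha : a ∈ Δ.germs x) (hb : b ∈ Δ.sec x s) :
    ⁅a, b⁆ ∈ Δ.sec x (s + 1) := by
  match s with
  | 0 => rw [(Submodule.mem_bot ℝ).1 hb, lie_zero]; exact Submodule.zero_mem _
  | s + 1 => exact Submodule.mem_sup_right (Submodule.subset_span ⟨a, ha, b, hb, rfl⟩)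

theorem lie_mem_sec {s t : ℕ} {a b : VGerm E x} (ha : a ∈ Δ.sec x s) (hb : b ∈ Δ.sec x t) :
    ⁅a, b⁆ ∈ Δ.sec x (s + t) := by
  induction s using Nat.strong_induction_on generalizing a b t with
  | _ s ih =>
    match s with
    | 0 => rw [(Submodule.mem_bot ℝ).1 ha, zero_lie]; exact Submodule.zero_mem _
    | 1 => rw [add_comm]; exact Δ.lie_mem_sec_succ x ha hb
    | s + 2 =>
      obtain ⟨a1, ha1, a2, ha2, rfl⟩ := Submodule.mem_sup.1 ha
      rw [add_lie]
      refine Submodule.add_mem _ (Δ.sec_mono x (by omega) (ih (s + 1) (by omega) ha1 hb)) ?_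
      clear ha
      induction ha2 using Submodule.span_induction with
      | zero => rw [zero_lie]; exact Submodule.zero_mem _
      | add u v _ _ hu hv => rw [add_lie]; exact Submodule.add_mem _ hu hv
      | smul c u _ hu => rw [smul_lie]; exact Submodule.smul_mem _ c hu
      | mem u hu =>
        obtain ⟨p, hp, q, hq, rfl⟩ := hu
        rw [lie_lie]
        refine Submodule.sub_mem _ ?_ ?_
        · have := Δ.lie_mem_sec_succ x hp (ih (s + 1) (by omega) hq hb)
          rwa [show s + 1 + t + 1 = s + 2 + t by ring] at this
        · have := ih (s + 1) (by omega) hq (Δ.lie_mem_sec_succ x hp hb)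
          rwa [show s + 1 + (t + 1) = s + 2 + t by ring] at this

theorem fsmul_mem_germs {f : M → ℝ} (hf : SmoothFunNear E x f) {a : VGerm E x}
    (ha : a ∈ Δ.germs x) : VGerm.fsmul f hf a ∈ Δ.germs x := by
  obtain ⟨X, hX, rfl, h⟩ := ha
  refine ⟨f • X, hX.fsmul hf, rfl, ?_⟩
  filter_upwards [h] with y h using (Δ.fiber y).smul_mem _ h

theorem fsmul_mem_sec {f : M → ℝ} (hf : SmoothFunNear E x f) {s : ℕ} {a : VGerm E x}
    (ha : a ∈ Δ.sec x s) : VGerm.fsmul f hf a ∈ Δ.sec x s := by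
  induction s using Nat.strong_induction_on generalizing a f with
  | _ s ih =>
    match s with
    | 0 => rw [(Submodule.mem_bot ℝ).1 ha, map_zero]; exact Submodule.zero_mem _
    | 1 => exact Δ.fsmul_mem_germs x hf ha
    | s + 2 =>
      obtain ⟨a1, ha1, a2, ha2, rfl⟩ := Submodule.mem_sup.1 ha
      rw [map_add]
      refine Submodule.add_mem _ (Δ.sec_mono x (by omega) (ih (s + 1) (by omega) hf ha1)) ?_
      clear ha
      induction ha2 using Submodule.span_induction with
      | zero => rw [map_zero]; exact Submodule.zero_mem _
      | add u v _ _ hu hv => rw [map_add]; exact Submodule.add_mem _ hu hv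
      | smul c u _ hu => rw [map_smul]; exact Submodule.smul_mem _ c hu
      | mem u hu =>
        obtain ⟨p, hp, q, hq, rfl⟩ := hu
        obtain ⟨Z, hZ, rfl⟩ := q.exists_of
        rw [← sub_add_cancel (VGerm.fsmul f hf ⁅p, VGerm.of x Z hZ⁆)
          (VGerm.fsmul _ (hf.lieDeriv hZ) p), ← VGerm.fsmul_lie hf hZ p]
        refine Submodule.add_mem _ (Δ.lie_mem_sec_succ x (Δ.fsmul_mem_germs x hf hp) hq) ?_
        exact Δ.sec_mono x (show 1 ≤ s + 2 by omega)
          (Δ.fsmul_mem_germs x (hf.lieDeriv hZ) hp)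

/-- `Γ(Δ_{s-1}) + μ_x Γ(Δ_s)`, where `μ_x` is the ideal of functions vanishing at `x`. The quotient
`Γ(Δ_s) / (Γ(Δ_{s-1}) + μ_x Γ(Δ_s))` is the fibre at `x` of the quotient sheaf `Δ_s / Δ_{s-1}`; for regular
`Δ` it is `Δ_s(x) / Δ_{s-1}(x)`. -/
def symKer (s : ℕ) : Submodule ℝ (VGerm E x) :=
  Δ.sec x (s - 1) ⊔ Submodule.span ℝ {b | ∃ (f : M → ℝ) (hf : SmoothFunNear E x f),
    f x = 0 ∧ ∃ a ∈ Δ.sec x s, b = VGerm.fsmul f hf a}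

theorem lie_mem_symKer {s t : ℕ} (hs : 1 ≤ s) (ht : 1 ≤ t) {a b : VGerm E x}
    (ha : a ∈ Δ.symKer x s)
    (hb : b ∈ Δ.sec x t) : ⁅a, b⁆ ∈ Δ.symKer x (s + t) := by
  obtain ⟨a1, ha1, a2, ha2, rfl⟩ := Submodule.mem_sup.1 ha
  rw [add_lie]
  refine Submodule.add_mem _ ?_ ?_
  · exact Submodule.mem_sup_left
      (Δ.sec_mono x (by omega) (Δ.lie_mem_sec x ha1 hb))
  clear ha
  induction ha2 using Submodule.span_induction with
  | zero => rw [zero_lie]; exact Submodule.zero_mem _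
  | add u v _ _ hu hv => rw [add_lie]; exact Submodule.add_mem _ hu hv
  | smul c u _ hu => rw [smul_lie]; exact Submodule.smul_mem _ c hu
  | mem u hu =>
    obtain ⟨f, hf, hfx, p, hp, rfl⟩ := hu
    obtain ⟨Z, hZ, rfl⟩ := b.exists_of
    rw [VGerm.fsmul_lie hf hZ p]
    refine Submodule.sub_mem _ ?_ ?_
    · exact Submodule.mem_sup_right
        (Submodule.subset_span ⟨f, hf, hfx, _, Δ.lie_mem_sec x hp hb, rfl⟩)
    · exact Submodule.mem_sup_left
        (Δ.sec_mono x (by omega) (Δ.fsmul_mem_sec x (hf.lieDeriv hZ) hp))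

theorem symKer_zero : Δ.symKer x 0 = ⊥ := by
  rw [symKer, eq_bot_iff, sup_le_iff]
  refine ⟨le_rfl, Submodule.span_le.2 ?_⟩
  rintro _ ⟨f, hf, -, a, ha, rfl⟩
  rw [(Submodule.mem_bot ℝ).1 ha, map_zero]
  exact Submodule.zero_mem _

theorem isGradedPair_symbol :
    IsGradedPair (fun i : ℤ => Δ.sec x (-i).toNat) (fun i : ℤ => Δ.symKer x (-i).toNat) where
  lie_mem i j a ha b hb := by
    rcases le_or_gt 0 i with hi | hi
    · have ha : a ∈ Δ.sec x (-i).toNat := ha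
      rw [show (-i).toNat = 0 by omega] at ha
      rw [(Submodule.mem_bot ℝ).1 ha, zero_lie]; exact Submodule.zero_mem _
    rcases le_or_gt 0 j with hj | hj
    · have hb : b ∈ Δ.sec x (-j).toNat := hb
      rw [show (-j).toNat = 0 by omega] at hb
      rw [(Submodule.mem_bot ℝ).1 hb, lie_zero]; exact Submodule.zero_mem _
    have := Δ.lie_mem_sec x ha hb
    rwa [show (-i).toNat + (-j).toNat = (-(i + j)).toNat by omega] at this
  lie_mem_sub i j a ha b hb := by
    rcases le_or_gt 0 i with hi | hi
    · have ha : a ∈ Δ.symKer x (-i).toNat := ha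
      rw [show (-i).toNat = 0 by omega, symKer_zero] at ha
      rw [(Submodule.mem_bot ℝ).1 ha, zero_lie]; exact Submodule.zero_mem _
    rcases le_or_gt 0 j with hj | hj
    · have hb : b ∈ Δ.sec x (-j).toNat := hb
      rw [show (-j).toNat = 0 by omega] at hb
      rw [(Submodule.mem_bot ℝ).1 hb, lie_zero]; exact Submodule.zero_mem _
    have := Δ.lie_mem_symKer x (by omega) (by omega) ha hb
    rwa [show (-i).toNat + (-j).toNat = (-(i + j)).toNat by omega] at this

/-- The graded nilpotent Lie algebra `𝔪_x = ⨁_{i < 0} 𝔤ᵢ` where `𝔤_{-s}` is the fibre at `x` of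
`Δ_s / Δ_{s-1}`, with the bracket induced by the commutator of vector fields. The components of degree
`i ≥ 0` are zero. -/
def gnla : GradedLieAlg := (Δ.isGradedPair_symbol x).toGraded

/-- The class in `𝔤_{-s} ⊆ 𝔪_x` of a section of `Δ_s`. -/
def symbol (s : ℕ) : Δ.sec x s →ₗ[ℝ] (Δ.gnla x).Total :=
  (Δ.gnla x).incl (-(s : ℤ)) ∘ₗ (Δ.isGradedPair_symbol x).proj (-(s : ℤ)) ∘ₗ
    Submodule.inclusion (by simp)

/-- The Tanaka algebra `𝔤_x` of `Δ` at `x`. -/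
def tanaka : GradedLieAlg := (Δ.gnla x).prolongation

/-- The stalk at `x` of the sheaf of local symmetries: germs `X` with `[X, Γ(Δ)] ⊆ Γ(Δ)`. -/
def localSym : LieSubalgebra ℝ (VGerm E x) where
  carrier := {a | ∀ b ∈ Δ.germs x, ⁅a, b⁆ ∈ Δ.germs x}
  add_mem' := fun h k b hb => by rw [add_lie]; exact Submodule.add_mem _ (h b hb) (k b hb)
  zero_mem' := fun b _ => by rw [zero_lie]; exact Submodule.zero_mem _
  smul_mem' := fun c a h b hb => by rw [smul_lie]; exact Submodule.smul_mem _ c (h b hb)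
  lie_mem' := fun {a a'} h k b hb => by
    rw [lie_lie]
    exact Submodule.sub_mem _ (h _ (k b hb)) (k _ (h b hb))

/-- The iterated bracket `[[…[X, Y₁], …], Yⱼ]`. -/
def iterLie {x : M} (a : VGerm E x) (l : List (VGerm E x)) : VGerm E x :=
  l.foldl (fun c b => ⁅c, b⁆) a

theorem iterLie_add {x : M} (a a' : VGerm E x) (l : List (VGerm E x)) :
    iterLie (a + a') l = iterLie a l + iterLie a' l := by
  induction l generalizing a a' with
  | nil => rfl
  | cons b l ih => simp only [iterLie, List.foldl_cons, add_lie] at ih ⊢; exact ih _ _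

theorem iterLie_smul {x : M} (r : ℝ) (a : VGerm E x) (l : List (VGerm E x)) :
    iterLie (r • a) l = r • iterLie a l := by
  induction l generalizing a with
  | nil => rfl
  | cons b l ih => simp only [iterLie, List.foldl_cons, smul_lie] at ih ⊢; exact ih _

/-- The second (weighted) filtration `ℒ(x)ⁱ` of the stalk of local symmetries:
for `i = -s ≤ 0` the symmetries `X` with `X_x ∈ Δ_s(x)` (where `Δ₀ = 0`), and for `i ≥ 0` those with
`X_x = 0` and `Ψ_X^j (Y₁, …, Yⱼ) = [[…[X, Y₁], …], Yⱼ]_x = 0` for all sections `Y₁, …, Yⱼ` of `Δ`, `j ≤ i`.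
For `i = -s ≤ 0` the first condition is the one in force, as only `j = 0`, `i = 0` could enter the second. -/
def filtration (i : ℤ) : Submodule ℝ (Δ.localSym x) where
  carrier := {a | VGerm.ev x (a : VGerm E x) ∈ Δ.flag x (-i).toNat ∧
    ∀ l : List (VGerm E x), (∀ b ∈ l, b ∈ Δ.germs x) → (l.length : ℤ) ≤ i →
      VGerm.ev x (iterLie (a : VGerm E x) l) = 0}
  add_mem' := by
    rintro a b ⟨h, h'⟩ ⟨k, k'⟩
    refine ⟨?_, fun l hl hi => ?_⟩
    · simpa using Submodule.add_mem _ h k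
    · simp [iterLie_add, h' l hl hi, k' l hl hi]
  zero_mem' := by
    refine ⟨?_, fun l _ _ => ?_⟩
    · simp
    · have := iterLie_smul (0 : ℝ) (0 : VGerm E x) l
      simp only [zero_smul] at this
      simp [this]
  smul_mem' := by
    rintro c a ⟨h, h'⟩
    refine ⟨?_, fun l hl hi => ?_⟩
    · simpa using Submodule.smul_mem _ c h
    · simp [iterLie_smul, h' l hl hi]

theorem flag_mono : Monotone (Δ.flag x) := fun _ _ h => Submodule.map_mono (Δ.sec_mono x h)

theorem filtration_antitone : Antitone (Δ.filtration x) := fun _ _ hij _ ha =>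
  ⟨Δ.flag_mono x (by omega) ha.1, fun l hl hi => ha.2 l hl (by omega)⟩

/-- The inverse limit of `ℒ(x) / ℒ(x)ⁱ`, the space underlying the formal Lie algebra of symmetries. -/
def formalAlgebra : Submodule ℝ (∀ i : ℕ, Δ.localSym x ⧸ Δ.filtration x i) where
  carrier := {a | ∀ i j : ℕ, ∀ h : i ≤ j,
    Submodule.factor (Δ.filtration_antitone x (Int.ofNat_le.2 h)) (a j) = a i}
  add_mem' := fun ha hb i j h => by simp [ha i j h, hb i j h]
  zero_mem' := fun i j h => by simp
  smul_mem' := fun c a ha i j h => by simp [ha i j h]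

end TangentDistribution

end Distributions

end TanakaTheory

end

open TanakaTheory

/-!
Why the graded algebra of symmetries embeds into the Tanaka algebra.

Let `𝔫 = 𝔪_x`. An element of `Coind 𝔫` is the list of derivatives at the identity, along left-invariant
fields, of a formal vector field on the simply connected group of `𝔫`, written in the left-invariant
frame. In this picture `emb` is the inclusion of the left-invariant fields, `Coind.delta` that of the
right-invariant fields, and `Coind.inv` is the automorphism induced by inversion of the group.

* Germs of vector fields on `M` carry a filtration by weight, `wtFields`: functions are weighted by their
  order of vanishing along sections of `Δ` (`ordOps`), and sections of `Δ_s` have weight `-s`. It respects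
  brackets (`isLieFiltration_wtFields`), and on local symmetries it restricts to the filtration
  `ℒ(x)ⁱ` (`mem_filtration_iff`).
* The associated graded Lie algebra of the vector fields contains `𝔫`, and taking values at `x` projects
  it back to `𝔫`. These two maps give a homomorphism to `Coind 𝔫`, the symbol of a vector field
  (`Coind.lift`, `Coind.lift_lie`, `fieldSymbol`). That the value of a commutator is compatible with the
  projection (`fieldValue_br`) comes from the fact that the commutator of two fields vanishing at `x`
  vanishes at `x`.
* The symbol of a section of `Δ` with coefficients of weighted order `m` is a combination of left-invariant
  fields from `𝔤₋₁` (`expand_mulSymbol`). Hence the symbol of a local symmetry is an infinitesimal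
  symmetry of the left-invariant distribution defined by `𝔤₋₁` (`isSymmetry_fieldSymbol`).
* Brackets with right-invariant fields preserve these symmetries, and those of negative degree are
  right-invariant since `𝔤₋₁` generates `𝔫`. After inversion this is the recursive description of the
  Tanaka prolongation, so `inv` sends symmetries of degree `i` into `𝔤ᵢ` (`Coind.IsSymmetry.isProl_inv`).

The embedding is `X ↦ (-1)ⁱ inv (symbol of X)` on `ℒ(x)ⁱ`. A symmetry in `ℒ(x)ⁱ` whose symbol of degree `i`
vanishes lies in `ℒ(x)ⁱ⁺¹` (`symSymbol_eq_zero_iff`), which gives injectivity. Evaluating at `i + 1` elements of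
`𝔤₋₁`, inversion reverses the order of the arguments and contributes the sign `(-1)ⁱ`
(`Coind.inv_apply_of_length`), so that iterated brackets at `x` appear with sign one. Finally, the
dimension of a complete filtered algebra is at most that of its associated graded algebra
(`IsLieFiltration.toENat_rank_limit_le`).
-/

noncomputable section

namespace TanakaTheory

set_option linter.unusedSectionVars false

/-! ### Inversion on the coinduced Lie algebra -/

theorem lie_lie_right {L : Type*} [LieRing L] (a b c : L) :
    ⁅⁅a, b⁆, c⁆ = ⁅⁅a, c⁆, b⁆ + ⁅a, ⁅b, c⁆⁆ := by
  rw [leibniz_lie a b c, ← lie_skew b ⁅a, c⁆]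
  abel

namespace Coind

variable {𝔫 : Type*} [LieRing 𝔫] [LieAlgebra ℝ 𝔫]

/-- The element of `Coind 𝔫` with value `Z` at the empty list and zero at all other lists. If
`Coind 𝔫` is thought of as the formal vector fields on the group of `𝔫`, and `emb` as the inclusion of the
left-invariant ones, then this is the right-invariant field with value `Z` at the identity. -/
def delta : 𝔫 →ₗ[ℝ] Coind 𝔫 where
  toFun Z := cons Z 0 (by simp)
  map_add' X Y := ext' (by simp) (by simp)
  map_smul' c X := ext' (by simp) (by simp)

@[simp] theorem delta_nil (Z : 𝔫) : (delta Z).1 [] = Z := rfl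
@[simp] theorem act_delta (Z X : 𝔫) : act (delta Z) X = 0 := rfl

theorem delta_lie_nil (Y : 𝔫) (u : Coind 𝔫) :
    (⁅delta Y, u⁆ : Coind 𝔫).1 [] = - u.1 [Y] - ⁅Y, u.1 []⁆ := by
  rw [lie_nil, ← act_apply (delta Y), act_delta, delta_nil]
  simp

theorem act_delta_lie (Y : 𝔫) (u : Coind 𝔫) (X : 𝔫) :
    act ⁅delta Y, u⁆ X = ⁅delta Y, act u X⁆ := by
  rw [act_bracket, act_delta, zero_lie, zero_add]

theorem delta_lie_apply (Y : 𝔫) (u : Coind 𝔫) (l : List 𝔫) :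
    (⁅delta Y, u⁆ : Coind 𝔫).1 l = - u.1 (l ++ [Y]) - ⁅Y, u.1 l⁆ := by
  induction l generalizing u with
  | nil => exact delta_lie_nil Y u
  | cons X l ih => rw [← act_apply, act_delta_lie, ih]; rfl

theorem delta_lie_delta (X Y : 𝔫) : ⁅delta X, delta Y⁆ = - delta ⁅X, Y⁆ := by
  apply ext'
  · rw [delta_lie_nil, ← act_apply, act_delta]; simp
  · intro Z; rw [act_delta_lie, act_delta, neg_act, act_delta]; simp

/-- The values of the inverted field, see `inv`. -/
def invFun : Coind 𝔫 → List 𝔫 → 𝔫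
  | u, [] => - u.1 []
  | u, Y :: l => invFun ⁅delta Y, u⁆ l

theorem invFun_add (u v : Coind 𝔫) (l : List 𝔫) :
    invFun (u + v) l = invFun u l + invFun v l := by
  induction l generalizing u v with
  | nil => simp only [invFun, Submodule.coe_add, Pi.add_apply]; abel
  | cons X l ih => simp only [invFun, lie_add, ih]

theorem invFun_smul (c : ℝ) (u : Coind 𝔫) (l : List 𝔫) :
    invFun (c • u) l = c • invFun u l := by
  induction l generalizing u with
  | nil => simp [invFun]
  | cons X l ih => simp only [invFun, lie_smul, ih]

theorem invFun_sub (u v : Coind 𝔫) (l : List 𝔫) :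
    invFun (u - v) l = invFun u l - invFun v l := by
  rw [sub_eq_add_neg, ← neg_one_smul ℝ v, invFun_add, invFun_smul, neg_one_smul, ← sub_eq_add_neg]

theorem invFun_mem (u : Coind 𝔫) : invFun u ∈ Coind 𝔫 := by
  refine ⟨fun p r X Y => ?_, fun p r c X => ?_, fun p r X Y => ?_⟩
  · induction p generalizing u with
    | nil => simp only [List.nil_append, invFun, map_add, add_lie, invFun_add]
    | cons T p ih => exact ih _
  · induction p generalizing u with
    | nil => simp only [List.nil_append, invFun, map_smul, smul_lie, invFun_smul]
    | cons T p ih => exact ih _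
  · induction p generalizing u with
    | nil =>
      simp only [List.nil_append, invFun]
      rw [← invFun_sub, ← lie_lie, delta_lie_delta, ← lie_skew X Y, map_neg]
    | cons T p ih => exact ih _

/-- Inversion of the group of `𝔫`, acting on `Coind 𝔫` as on formal vector fields. It exchanges the
left-invariant fields `emb Z` and the right-invariant fields `delta Z` up to sign; the recursion
`[inv u, Y] = inv [delta Y, u]` expresses this. -/
def inv : Coind 𝔫 →ₗ[ℝ] Coind 𝔫 where
  toFun u := ⟨invFun u, invFun_mem u⟩
  map_add' u v := Subtype.ext (funext fun l => invFun_add u v l)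
  map_smul' c u := Subtype.ext (funext fun l => invFun_smul c u l)

@[simp] theorem inv_nil (u : Coind 𝔫) : (inv u).1 [] = - u.1 [] := rfl

theorem inv_cons (u : Coind 𝔫) (Y : 𝔫) (l : List 𝔫) :
    (inv u).1 (Y :: l) = (inv ⁅delta Y, u⁆).1 l := rfl

theorem act_inv (u : Coind 𝔫) (Y : 𝔫) : act (inv u) Y = inv ⁅delta Y, u⁆ := rfl

theorem inv_lie (u v : Coind 𝔫) : inv ⁅u, v⁆ = ⁅inv u, inv v⁆ := by
  apply Subtype.ext
  funext l
  induction l generalizing u v with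
  | nil =>
    rw [inv_nil, lie_nil, lie_nil, inv_nil, inv_nil, inv_cons, inv_cons, inv_nil, inv_nil,
      delta_lie_nil, delta_lie_nil, ← neg_one_smul ℝ (v.1 []), ← neg_one_smul ℝ (u.1 []),
      single_smul, single_smul]
    simp only [neg_one_smul, neg_lie, lie_neg]
    rw [← lie_skew (v.1 [])]
    abel
  | cons Y l ih =>
    rw [inv_cons, leibniz_lie, map_add, Submodule.coe_add, Pi.add_apply, ih, ih, ← act_inv, ← act_inv,
      ← act_apply ⁅inv u, inv v⁆, act_bracket]
    rfl

theorem inv_delta (Z : 𝔫) : inv (delta Z) = - emb Z := by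
  apply Subtype.ext
  funext l
  induction l generalizing Z with
  | nil => simp
  | cons Y l ih =>
    rw [inv_cons, delta_lie_delta, ← map_neg delta, ih, map_neg emb, neg_neg,
      ← act_apply, neg_act, act_emb, ← lie_skew, map_neg]

theorem inv_emb (Z : 𝔫) : inv (emb Z) = - delta Z := by
  apply ext'
  · simp
  · intro Y
    rw [act_inv, lie_emb, act_delta, map_zero, neg_act, act_delta, neg_zero]

theorem inv_inv (u : Coind 𝔫) : inv (inv u) = u := by
  apply Subtype.ext
  funext l
  induction l generalizing u with
  | nil => simp
  | cons Y l ih =>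
    have h : delta Y = inv (- emb Y) := by rw [map_neg, inv_emb, neg_neg]
    rw [inv_cons, h, ← inv_lie, ih, neg_lie, lie_skew, lie_emb, act_apply]

theorem inv_injective : Function.Injective (inv : Coind 𝔫 →ₗ[ℝ] Coind 𝔫) :=
  Function.LeftInverse.injective inv_inv

/-- Given a function `g` of lists, the function with value
`∑ [[…[g (Y_S), Y_{k₁}], …], Y_{kₘ}]` at `Y₁, …, Yⱼ`, where the sum is over all subsets `S` of the
indices and `k₁ < … < kₘ` are the indices outside `S`. For `g` with values in multiples of a fixed
vector `Z` this is the vector field `f · emb Z` whose coefficient `f` has the derivatives described by `g`. -/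
def expand : (List 𝔫 → 𝔫) → List 𝔫 → 𝔫
  | g, [] => g []
  | g, Y :: l => expand (fun m => g (Y :: m)) l + expand (fun m => ⁅g m, Y⁆) l

theorem expand_add (g h : List 𝔫 → 𝔫) (l : List 𝔫) :
    expand (fun m => g m + h m) l = expand g l + expand h l := by
  induction l generalizing g h with
  | nil => rfl
  | cons Y l ih => simp only [expand, add_lie, ih]; abel

theorem expand_smul (c : ℝ) (g : List 𝔫 → 𝔫) (l : List 𝔫) :
    expand (fun m => c • g m) l = c • expand g l := by
  induction l generalizing g with
  | nil => rfl
  | cons Y l ih => simp only [expand, smul_lie, ih, smul_add]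

theorem expand_zero (l : List 𝔫) : expand (fun _ => (0 : 𝔫)) l = 0 := by
  induction l with
  | nil => rfl
  | cons Y l ih => simp only [expand, zero_lie, ih, add_zero]

theorem expand_neg (g : List 𝔫 → 𝔫) (l : List 𝔫) :
    expand (fun m => - g m) l = - expand g l := by
  simpa only [neg_one_smul] using expand_smul (-1) g l

theorem expand_append_single (g : List 𝔫 → 𝔫) (l : List 𝔫) (Z : 𝔫) :
    expand g (l ++ [Z]) = expand (fun m => g (m ++ [Z])) l + ⁅expand g l, Z⁆ := by
  induction l generalizing g with
  | nil => rfl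
  | cons Y l ih =>
    simp only [List.cons_append, expand, ih, add_lie]
    abel

section Lift

variable {A : Type*} [LieRing A] [LieAlgebra ℝ A]

/-- The map to `Coind 𝔫` given by a homomorphism `j` from `𝔫` to a Lie algebra `A` and a linear map `e`
from `A` to `𝔫`: the element `a` is sent to `(Y₁, …, Yₖ) ↦ e [[…[a, j Y₁], …], j Yₖ]`. -/
def lift (j : 𝔫 →ₗ⁅ℝ⁆ A) (e : A →ₗ[ℝ] 𝔫) : A →ₗ[ℝ] Coind 𝔫 :=
  have hadd : ∀ (l : List 𝔫) (a b : A), l.foldl (fun c Y => ⁅c, j Y⁆) (a + b) =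
      l.foldl (fun c Y => ⁅c, j Y⁆) a + l.foldl (fun c Y => ⁅c, j Y⁆) b := by
    intro l
    induction l with
    | nil => exact fun _ _ => rfl
    | cons Y l ih => intro a b; simp only [List.foldl_cons, add_lie, ih]
  have hsmul : ∀ (l : List 𝔫) (c : ℝ) (a : A), l.foldl (fun c Y => ⁅c, j Y⁆) (c • a) =
      c • l.foldl (fun c Y => ⁅c, j Y⁆) a := by
    intro l
    induction l with
    | nil => exact fun _ _ => rfl
    | cons Y l ih => intro c a; simp only [List.foldl_cons, smul_lie, ih]
  { toFun := fun a => ⟨fun l => e (l.foldl (fun b Y => ⁅b, j Y⁆) a), by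
      refine ⟨fun p r X Y => ?_, fun p r c X => ?_, fun p r X Y => ?_⟩
      · simp only [List.foldl_append, List.foldl_cons, map_add, lie_add, hadd]
      · simp only [List.foldl_append, List.foldl_cons, map_smul, lie_smul, hsmul]
      · simp only [List.foldl_append, List.foldl_cons]
        rw [eq_sub_iff_add_eq, ← map_add, ← hadd, LieHom.map_lie, lie_lie_right _ (j X), add_comm]⟩
    map_add' := fun a b => Subtype.ext (funext fun l => by simp [hadd])
    map_smul' := fun c a => Subtype.ext (funext fun l => by simp [hsmul]) }

variable (j : 𝔫 →ₗ⁅ℝ⁆ A) (e : A →ₗ[ℝ] 𝔫)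

@[simp] theorem lift_nil (a : A) : (lift j e a).1 [] = e a := rfl

theorem act_lift (a : A) (Y : 𝔫) : act (lift j e a) Y = lift j e ⁅a, j Y⁆ := rfl

theorem lift_cons (a : A) (Y : 𝔫) (l : List 𝔫) :
    (lift j e a).1 (Y :: l) = (lift j e ⁅a, j Y⁆).1 l := rfl

/-- If `e` splits `j`, the hypothesis `he` says that the kernel of `e` is a subalgebra of `A`. -/
theorem lift_lie (he : ∀ a b, e ⁅a, b⁆ = e ⁅a, j (e b)⁆ + e ⁅j (e a), b⁆ - ⁅e a, e b⁆) (a b : A) :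
    lift j e ⁅a, b⁆ = ⁅lift j e a, lift j e b⁆ := by
  apply Subtype.ext
  funext l
  induction l generalizing a b with
  | nil =>
    rw [lift_nil, he, lie_nil, lift_nil, lift_nil, lift_cons, lift_cons, lift_nil, lift_nil,
      ← lie_skew b, map_neg]
    abel
  | cons Y l ih =>
    rw [lift_cons, lie_lie_right, map_add, Submodule.coe_add, Pi.add_apply, ih, ih]
    rfl

end Lift

end Coind

/-! ### Homogeneous elements and the Tanaka prolongation -/

universe w

namespace GradedLieAlg

variable (D : GradedLieAlg.{w})

/-- The component of degree `i` of an element of `⨁ V i`. -/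
def comp (i : ℤ) : D.Total →ₗ[ℝ] D.V i := DirectSum.component ℝ ℤ D.V i

theorem comp_incl_self (i : ℤ) (X : D.V i) : D.comp i (D.incl i X) = X :=
  DirectSum.component.lof_self ℝ i X

theorem comp_incl_of_ne {i j : ℤ} (h : i ≠ j) (X : D.V i) : D.comp j (D.incl i X) = 0 :=
  (DirectSum.component.of ℝ (M := D.V) j i X).trans (dif_neg h)

/-- The projection of `⨁ V i` to its component of degree `i`, as an endomorphism of `⨁ V i`. -/
def proj (i : ℤ) : D.Total →ₗ[ℝ] D.Total := D.incl i ∘ₗ D.comp i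

theorem proj_incl_self (i : ℤ) (X : D.V i) : D.proj i (D.incl i X) = D.incl i X := by
  rw [proj, LinearMap.comp_apply, comp_incl_self]

theorem proj_incl_of_ne {i j : ℤ} (h : i ≠ j) (X : D.V i) : D.proj j (D.incl i X) = 0 := by
  rw [proj, LinearMap.comp_apply, comp_incl_of_ne D h, map_zero]

/-- The component of degree `i`, as a subspace of `⨁ V i`. -/
def piece (i : ℤ) : Submodule ℝ D.Total := LinearMap.range (D.incl i)

theorem incl_mem_piece (i : ℤ) (X : D.V i) : D.incl i X ∈ D.piece i := ⟨X, rfl⟩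

theorem lie_mem_piece {i j : ℤ} {X Y : D.Total} (hX : X ∈ D.piece i) (hY : Y ∈ D.piece j) :
    ⁅X, Y⁆ ∈ D.piece (i + j) := by
  obtain ⟨X, rfl⟩ := hX
  obtain ⟨Y, rfl⟩ := hY
  rw [lie_incl]
  exact D.incl_mem_piece _ _

theorem proj_eq_zero {i j : ℤ} (h : i ≠ j) {X : D.Total} (hX : X ∈ D.piece i) : D.proj j X = 0 := by
  obtain ⟨X, rfl⟩ := hX
  exact D.proj_incl_of_ne h X

theorem proj_eq_self {i : ℤ} {X : D.Total} (hX : X ∈ D.piece i) : D.proj i X = X := by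
  obtain ⟨X, rfl⟩ := hX
  exact D.proj_incl_self i X

theorem incl_injective (i : ℤ) : Function.Injective (D.incl i) :=
  DirectSum.of_injective (β := D.V) i

/-- All components of nonnegative degree are zero. -/
def IsNegative : Prop := ∀ i : ℤ, 0 ≤ i → ∀ X : D.V i, X = 0

/-- The component of degree `-1` generates the Lie algebra. -/
def IsFundamental : Prop :=
  ∀ K : LieSubalgebra ℝ D.Total, (∀ Y : D.V (-1), D.incl (-1) Y ∈ K) → K = ⊤

variable {D}

/-- Induction over homogeneous elements of negative degree. -/
theorem IsNegative.induction (hD : D.IsNegative) {p : D.Total → Prop} (h0 : p 0)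
    (hi : ∀ i < 0, ∀ x : D.V i, p (D.incl i x)) (ha : ∀ x y, p x → p y → p (x + y)) (x : D.Total) :
    p x := by
  refine D.total_induction h0 (fun i x => ?_) ha x
  rcases lt_or_ge i 0 with h | h
  · exact hi i h x
  · rw [hD i h x, map_zero]; exact h0

theorem IsNegative.proj_lie (hD : D.IsNegative) (X Y : D.Total) : D.proj (-1) ⁅X, Y⁆ = 0 := by
  induction X using hD.induction with
  | h0 => simp
  | ha x y hx hy => simp [hx, hy]
  | hi i hi x =>
    induction Y using hD.induction with
    | h0 => simp
    | ha x y hx hy => simp [hx, hy]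
    | hi j hj y => rw [lie_incl, proj_incl_of_ne D (by omega)]

theorem IsNegative.piece_eq_bot (hD : D.IsNegative) {i : ℤ} (hi : 0 ≤ i) : D.piece i = ⊥ := by
  rw [eq_bot_iff]
  rintro _ ⟨X, rfl⟩
  rw [hD i hi X, map_zero]
  exact Submodule.zero_mem _

end GradedLieAlg

namespace Coind

open GradedLieAlg

variable {D : GradedLieAlg.{w}}

/-- A list of homogeneous elements, as a list of elements of `⨁ V i`. -/
def homogList (l : List (Σ n, D.V n)) : List D.Total := l.map fun p => D.incl p.1 p.2

/-- The sum of the degrees in a list of homogeneous elements. -/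
def degSum (l : List (Σ n, D.V n)) : ℤ := (l.map Sigma.fst).sum

theorem homogList_cons (n : ℤ) (Y : D.V n) (l : List (Σ n, D.V n)) :
    homogList (⟨n, Y⟩ :: l) = D.incl n Y :: homogList l := rfl

theorem homogList_append (l m : List (Σ n, D.V n)) :
    homogList (l ++ m) = homogList l ++ homogList m := List.map_append

theorem degSum_cons (n : ℤ) (Y : D.V n) (l : List (Σ n, D.V n)) :
    degSum (⟨n, Y⟩ :: l) = n + degSum l := List.sum_cons

theorem degSum_append (l m : List (Σ n, D.V n)) : degSum (l ++ m) = degSum l + degSum m := by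
  rw [degSum, List.map_append, List.sum_append]; rfl

/-- `u` is homogeneous of degree `i`: it sends homogeneous elements of degrees `n₁, …, nⱼ` to an
element of degree `i + n₁ + … + nⱼ`. -/
def IsHomog (i : ℤ) (u : Coind D.Total) : Prop :=
  ∀ l : List (Σ n, D.V n), u.1 (homogList l) ∈ D.piece (i + degSum l)

theorem IsHomog.nil {i : ℤ} {u : Coind D.Total} (h : IsHomog i u) : u.1 [] ∈ D.piece i := by
  have := h []
  rwa [show i + degSum ([] : List (Σ n, D.V n)) = i from add_zero i] at this

theorem IsHomog.act {i : ℤ} {u : Coind D.Total} (h : IsHomog i u) {n : ℤ} (Y : D.V n) :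
    IsHomog (i + n) (act u (D.incl n Y)) := fun l => by
  have := h (⟨n, Y⟩ :: l)
  rwa [degSum_cons, ← add_assoc] at this

theorem IsHomog.delta_lie {i : ℤ} {u : Coind D.Total} (h : IsHomog i u) {n : ℤ} (Y : D.V n) :
    IsHomog (i + n) ⁅delta (D.incl n Y), u⁆ := fun l => by
  rw [delta_lie_apply]
  refine Submodule.sub_mem _ (Submodule.neg_mem _ ?_) ?_
  · have := h (l ++ [⟨n, Y⟩])
    rwa [homogList_append, degSum_append, show degSum [(⟨n, Y⟩ : Σ n, D.V n)] = n from add_zero n,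
      ← add_assoc, add_right_comm] at this
  · rw [add_comm i n, add_assoc]
    exact D.lie_mem_piece (D.incl_mem_piece n Y) (h l)

theorem homogList_map_incl (n : ℤ) (l : List (D.V n)) :
    homogList (l.map (Sigma.mk n)) = l.map (D.incl n) := by
  rw [homogList, List.map_map]; rfl

theorem degSum_map_mk (n : ℤ) (l : List (D.V n)) :
    degSum (l.map (Sigma.mk n)) = l.length * n := by
  induction l with
  | nil => simp [degSum]
  | cons Y l ih => rw [List.map_cons, degSum_cons, ih, List.length_cons]; push_cast; ring

/-- If there are just enough elements of degree `-1` to reach the component of degree `-1`, then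
inversion reverses their order, up to sign. All other terms of the inverted field would involve
components of nonnegative degree. -/
theorem inv_apply_of_length {i : ℤ} {u : Coind D.Total} (h : IsHomog i u) (hD : D.IsNegative)
    (l : List (D.V (-1))) (hl : (l.length : ℤ) = i + 1) :
    (inv u).1 (l.map (D.incl (-1))) = (-1 : ℝ) ^ i • u.1 (l.map (D.incl (-1))).reverse := by
  induction l generalizing u i with
  | nil =>
    have : i = -1 := by simp at hl; omega
    subst this
    simp
  | cons Y l ih =>
    have hlen : (l.length : ℤ) = i := by simpa using hl
    have h0 : u.1 (l.map (D.incl (-1))).reverse = 0 := by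
      have := h (l.reverse.map (Sigma.mk (-1)))
      rw [homogList_map_incl, degSum_map_mk, List.length_reverse, List.map_reverse,
        hD.piece_eq_bot (by omega)] at this
      simpa using this
    rw [List.map_cons, inv_cons, ih (h.delta_lie Y) (by omega), delta_lie_apply, List.reverse_cons,
      h0, lie_zero, sub_zero, smul_neg, ← neg_smul, zpow_add₀ (by norm_num)]
    norm_num

/-- An element that vanishes at lists of homogeneous elements of negative degree, after a linear map
has been applied, vanishes everywhere. -/
theorem apply_eq_zero_of_homogList (hD : D.IsNegative) {N : Type*} [AddCommGroup N] [Module ℝ N]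
    (f : D.Total →ₗ[ℝ] N) (u : Coind D.Total)
    (h : ∀ l : List (Σ n, D.V n), (∀ p ∈ l, p.1 < 0) → f (u.1 (homogList l)) = 0)
    (l : List D.Total) : f (u.1 l) = 0 := by
  induction l generalizing u with
  | nil => exact h [] (by simp)
  | cons Z l ih =>
    rw [← act_apply]
    induction Z using hD.induction with
    | h0 => simp
    | ha X Y hX hY => rw [act_add, Submodule.coe_add, Pi.add_apply, map_add, hX, hY, add_zero]
    | hi n hn Y =>
      refine ih _ fun m hm => h (⟨n, Y⟩ :: m) ?_
      rintro p (_ | ⟨_, hp⟩)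
      exacts [hn, hm p hp]

/-- `w` is a combination, with functions as coefficients, of left-invariant fields with values in the
component of degree `-1`. Such a field is determined by the components of degree `-1` of its
values. -/
def IsHorizontal (w : Coind D.Total) : Prop := expand (fun l => D.proj (-1) (w.1 l)) = w.1

theorem isHorizontal_zero : IsHorizontal (0 : Coind D.Total) := by
  funext l
  have : (fun l => D.proj (-1) ((0 : Coind D.Total).1 l)) = fun _ => 0 := funext fun l => map_zero _
  rw [this, expand_zero]
  rfl

theorem IsHorizontal.add {v w : Coind D.Total} (hv : IsHorizontal v) (hw : IsHorizontal w) :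
    IsHorizontal (v + w) := by
  funext l
  have : (fun l => D.proj (-1) ((v + w).1 l)) =
      fun l => D.proj (-1) (v.1 l) + D.proj (-1) (w.1 l) := funext fun l => map_add _ _ _
  rw [this, expand_add, congrFun hv, congrFun hw]
  rfl

/-- Right-invariant fields commute with left-invariant ones, so brackets with them preserve
horizontality. -/
theorem IsHorizontal.delta_lie (hD : D.IsNegative) {w : Coind D.Total} (hw : IsHorizontal w)
    (Z : D.Total) : IsHorizontal ⁅delta Z, w⁆ := by
  funext l
  have h1 : (fun m => D.proj (-1) ((⁅delta Z, w⁆ : Coind D.Total).1 m)) =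
      fun m => - D.proj (-1) (w.1 (m ++ [Z])) := by
    funext m
    rw [delta_lie_apply, map_sub, hD.proj_lie, sub_zero, map_neg]
  have h2 := expand_append_single (fun m => D.proj (-1) (w.1 m)) l Z
  rw [congrFun hw, congrFun hw] at h2
  rw [h1, expand_neg, delta_lie_apply, h2, ← lie_skew Z]
  abel

/-- There is no horizontal field of degree less than `-1`. -/
theorem IsHorizontal.eq_zero (hD : D.IsNegative) {w : Coind D.Total} (hw : IsHorizontal w) {i : ℤ}
    (hi : i < -1) (h : IsHomog i w) : w = 0 := by
  have h0 : ∀ l, D.proj (-1) (w.1 l) = 0 := by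
    refine apply_eq_zero_of_homogList hD _ w fun l hl => D.proj_eq_zero ?_ (h l)
    have : degSum l ≤ 0 := by
      clear h
      induction l with
      | nil => exact le_rfl
      | cons p l ih =>
        rw [show p = ⟨p.1, p.2⟩ from rfl, degSum_cons]
        have := hl p (by simp)
        have := ih fun q hq => hl q (by simp [hq])
        omega
    omega
  apply Subtype.ext
  rw [← hw]
  funext l
  simp only [h0]
  exact expand_zero l

/-- `u` is a homogeneous infinitesimal symmetry of degree `i` of the left-invariant distribution
spanned by the component of degree `-1`. -/
structure IsSymmetry (i : ℤ) (u : Coind D.Total) : Prop where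
  homog : IsHomog i u
  horizontal : ∀ Y : D.V (-1), IsHorizontal (Coind.act u (D.incl (-1) Y))

/-- Symmetries of negative degree of the left-invariant distribution are right-invariant. -/
theorem IsSymmetry.eq_delta (hD : D.IsNegative) (hF : D.IsFundamental) {i : ℤ} (hi : i < 0)
    {u : Coind D.Total} (h : IsSymmetry i u) : u = delta (u.1 []) := by
  let K : LieSubalgebra ℝ D.Total :=
    { carrier := {Y | act u Y = 0}
      add_mem' := fun {X Y} hX hY => by
        change act u (X + Y) = 0
        rw [act_add, show act u X = 0 from hX, show act u Y = 0 from hY, add_zero]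
      zero_mem' := act_zero u
      smul_mem' := fun c X hX => by
        change act u (c • X) = 0
        rw [act_smul, show act u X = 0 from hX, smul_zero]
      lie_mem' := fun {X Y} hX hY => by
        change act u ⁅X, Y⁆ = 0
        rw [act_lie, show act u X = 0 from hX, show act u Y = 0 from hY]
        simp }
  have hK : K = ⊤ := hF K fun Y =>
    (h.horizontal Y).eq_zero hD (by omega : i + (-1) < -1) (h.homog.act Y)
  refine ext' rfl fun Y => ?_
  rw [act_delta]
  exact (hK ▸ LieSubalgebra.mem_top Y : Y ∈ K)

theorem IsSymmetry.delta_lie (hD : D.IsNegative) {i : ℤ} {u : Coind D.Total} (h : IsSymmetry i u)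
    {n : ℤ} (Y : D.V n) : IsSymmetry (i + n) ⁅delta (D.incl n Y), u⁆ where
  homog := h.homog.delta_lie Y
  horizontal X := by
    rw [act_delta_lie]
    exact (h.horizontal X).delta_lie hD _

/-- Inversion of the group sends the symmetries of the left-invariant distribution into the Tanaka
prolongation: brackets of a symmetry with right-invariant fields are symmetries, those of negative
degree are right-invariant, and inversion turns right-invariant fields into left-invariant ones. -/
theorem IsSymmetry.isProl_inv (hD : D.IsNegative) (hF : D.IsFundamental) {i : ℤ}
    {u : Coind D.Total} (h : IsSymmetry i u) : IsProl D i (inv u) := by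
  have key : ∀ n : ℕ, ∀ i : ℤ, i < n → ∀ u : Coind D.Total, IsSymmetry i u →
      IsProl D i (inv u) := by
    intro n
    induction n with
    | zero =>
      intro i hi u h
      have hi : i < 0 := by simpa using hi
      obtain ⟨Z, hZ⟩ := h.homog.nil
      rw [h.eq_delta hD hF hi, ← hZ, inv_delta, ← map_neg, ← map_neg]
      exact .neg i hi _
    | succ n ih =>
      intro i hi u h
      rcases lt_or_ge i n with hn | hn
      · exact ih i hn u h
      · refine .nonneg i (by omega) _ ?_ fun j hj X => ?_
        · have := h.homog.nil
          rw [hD.piece_eq_bot (by omega)] at this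
          rw [inv_nil, (Submodule.mem_bot ℝ).1 this, neg_zero]
        · rw [lie_emb, act_inv]
          exact ih _ (by push_cast at hi; omega) _ (h.delta_lie hD X)
  exact key (i.toNat + 1) i (by omega) u h

end Coind

/-! ### Coefficients with respect to independent vector fields -/

section Coefficients

open Filter

variable {E : Type*} [NormedAddCommGroup E] [NormedSpace ℝ E]
  {M : Type*} [TopologicalSpace M] [ChartedSpace E M]

theorem contMDiffAt_det {r : ℕ} {N : M → Fin r → Fin r → ℝ} {y : M}
    (hN : ∀ i j, ContMDiffAt 𝓘(ℝ, E) 𝓘(ℝ, ℝ) ∞ (fun z => N z i j) y) :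
    ContMDiffAt 𝓘(ℝ, E) 𝓘(ℝ, ℝ) ∞ (fun z => (Matrix.of (N z)).det) y := by
  have hdet : ContDiff ℝ ∞ fun A : Fin r → Fin r → ℝ => Matrix.det (Matrix.of A) := by
    simp only [Matrix.det_apply, Matrix.of_apply]
    fun_prop
  have hN' : ContMDiffAt 𝓘(ℝ, E) 𝓘(ℝ, Fin r → Fin r → ℝ) ∞ N y :=
    contMDiffAt_pi_space.2 fun i => contMDiffAt_pi_space.2 fun j => hN i j
  exact hdet.comp_contMDiffAt hN'

variable [IsManifold 𝓘(ℝ, E) ∞ M] [FiniteDimensional ℝ E]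

/-- Vector fields that are independent at `x` stay independent near `x`, and the vector fields in their
span have smooth coefficients. -/
theorem exists_smooth_coeff {x : M} {r : ℕ} {A : Fin r → VField E M}
    (hA : ∀ k, SmoothNear x (A k)) (hind : LinearIndependent ℝ fun k => A k x) :
    (∀ᶠ y in 𝓝 x, LinearIndependent ℝ fun k => A k y) ∧
    ∀ C : VField E M, SmoothNear x C →
      (∀ᶠ y in 𝓝 x, C y ∈ Submodule.span ℝ (Set.range fun k => A k y)) →
      ∃ f : Fin r → M → ℝ, (∀ k, SmoothFunNear E x (f k)) ∧
        ∀ᶠ y in 𝓝 x, C y = ∑ k, f k y • A k y := by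
  have : IsManifold 𝓘(ℝ, E) (((⊤ : ℕ∞) : WithTop ℕ∞) + 1) M := by
    simpa using (inferInstance : IsManifold 𝓘(ℝ, E) ∞ M)
  let e := trivializationAt E (TangentSpace 𝓘(ℝ, E) : M → Type _) x
  have hxe : x ∈ e.baseSet := FiberBundle.mem_baseSet_trivializationAt' x
  have hev : ∀ᶠ y in 𝓝 x, y ∈ e.baseSet := e.open_baseSet.mem_nhds hxe
  let T : ∀ y : M, TangentSpace 𝓘(ℝ, E) y →ₗ[ℝ] E := fun y => e.linearMapAt ℝ y
  have hTsm : ∀ C : VField E M, SmoothNear x C →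
      ∀ᶠ y in 𝓝 x, ContMDiffAt 𝓘(ℝ, E) 𝓘(ℝ, E) ∞ (fun z => T z (C z)) y := by
    intro C hC
    filter_upwards [hC, hev] with y h hy
    refine ((e.contMDiffAt_section_iff hy).1 h).congr_of_eventuallyEq ?_
    filter_upwards [e.open_baseSet.mem_nhds hy] with z hz
    exact congrFun (e.coe_linearMapAt_of_mem hz) (C z)
  have hTinj : Function.Injective (T x) := by
    have : ⇑(T x) = ⇑(e.linearEquivAt ℝ x hxe) := e.coe_linearMapAt_of_mem hxe
    rw [this]
    exact (e.linearEquivAt ℝ x hxe).injective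
  have hind' : LinearIndependent ℝ fun k => T x (A k x) :=
    hind.map' (T x) (LinearMap.ker_eq_bot.2 hTinj)
  -- functionals on `E` dual to the values at `x`, so that the matrix `G` below is the identity at `x`
  obtain ⟨lam, hlam⟩ := LinearMap.exists_leftInverse_of_injective
    (Fintype.linearCombination ℝ fun k => T x (A k x))
    (LinearMap.ker_eq_bot.2 (linearIndependent_iff_injective_fintypeLinearCombination.1 hind'))
  let Λ : E →L[ℝ] (Fin r → ℝ) := LinearMap.toContinuousLinearMap lam
  have hΛsm : ∀ C : VField E M, SmoothNear x C → ∀ᶠ y in 𝓝 x, ∀ i,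
      ContMDiffAt 𝓘(ℝ, E) 𝓘(ℝ, ℝ) ∞ (fun z => lam (T z (C z)) i) y := by
    intro C hC
    filter_upwards [hTsm C hC] with y h
    exact contMDiffAt_pi_space.1 (Λ.contDiff.comp_contMDiffAt h)
  let G : M → Fin r → Fin r → ℝ := fun y i k => lam (T y (A k y)) i
  have hGsm : ∀ᶠ y in 𝓝 x, ∀ i k, ContMDiffAt 𝓘(ℝ, E) 𝓘(ℝ, ℝ) ∞ (fun z => G z i k) y := by
    have := eventually_all.2 fun k => hΛsm (A k) (hA k)
    filter_upwards [this] with y h i k using h k i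
  have hG : ∀ (y : M) (g : Fin r → ℝ),
      lam (T y (∑ k, g k • A k y)) = (Matrix.of (G y)).mulVec g := by
    intro y g
    ext i
    simp [Matrix.mulVec, dotProduct, G, Finset.sum_apply, mul_comm]
  have hdet : ∀ᶠ y in 𝓝 x, (Matrix.of (G y)).det ≠ 0 := by
    have hG1 : Matrix.of (G x) = 1 := by
      ext i k
      have := congrFun (LinearMap.congr_fun hlam (Pi.single k 1)) i
      simpa [Fintype.linearCombination_apply, Matrix.one_apply, Pi.single_apply] using this
    refine (contMDiffAt_det hGsm.self_of_nhds).continuousAt.eventually_ne ?_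
    rw [hG1, Matrix.det_one]
    exact one_ne_zero
  refine ⟨?_, fun C hC hspan => ?_⟩
  · filter_upwards [hdet] with y hy
    rw [Fintype.linearIndependent_iff]
    intro g hg
    have := hG y g
    rw [hg, map_zero, map_zero] at this
    exact congrFun (Matrix.eq_zero_of_mulVec_eq_zero hy this.symm)
  · refine ⟨fun k y => ((Matrix.of (G y)).det)⁻¹ *
      (Matrix.of (G y)).cramer (lam (T y (C y))) k, fun k => ?_, ?_⟩
    · filter_upwards [hdet, hGsm, hΛsm C hC] with y hy hGy hCy
      refine (ContMDiffAt.inv₀ (contMDiffAt_det hGy) hy).mul ?_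
      simp only [Matrix.cramer_apply]
      refine contMDiffAt_det
        (N := fun z => (Matrix.of (G z)).updateCol k (lam (T z (C z)))) fun i j => ?_
      simp only [Matrix.updateCol_apply, Matrix.of_apply]
      split_ifs
      · exact hCy i
      · exact hGy i j
    · filter_upwards [hdet, hspan] with y hy hCy
      obtain ⟨g, hg⟩ := (Submodule.mem_span_range_iff_exists_fun ℝ).1 hCy
      rw [← hg]
      refine Finset.sum_congr rfl fun k _ => ?_
      rw [hG, Matrix.cramer_eq_adjugate_mulVec, Matrix.mulVec_mulVec, Matrix.adjugate_mul,
        Matrix.smul_mulVec, Matrix.one_mulVec, Pi.smul_apply, smul_eq_mul, inv_mul_cancel_left₀ hy]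

end Coefficients

/-! ### Multiplication by functions, and frames of the weak derived flag -/

open Filter VectorField

section MulOps

variable {E : Type*} [NormedAddCommGroup E] [NormedSpace ℝ E]
  {M : Type*} [TopologicalSpace M] [ChartedSpace E M] [IsManifold 𝓘(ℝ, E) ∞ M]

theorem SmoothFunNear.mul {x : M} {f g : M → ℝ} (hf : SmoothFunNear E x f)
    (hg : SmoothFunNear E x g) : SmoothFunNear E x (f * g) := by
  filter_upwards [hf, hg] with y h k using ContMDiffAt.mul h k

theorem SmoothFunNear.add {x : M} {f g : M → ℝ} (hf : SmoothFunNear E x f)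
    (hg : SmoothFunNear E x g) : SmoothFunNear E x (f + g) := by
  filter_upwards [hf, hg] with y h k using ContMDiffAt.add h k

/-- The algebra of multiplications by germs at `x` of smooth functions, inside the endomorphisms of
the space of germs of vector fields. -/
def mulOps (x : M) : Subalgebra ℝ (Module.End ℝ (VGerm E x)) where
  carrier := {φ | ∃ f hf, φ = VGerm.fsmul f hf}
  mul_mem' := by
    rintro _ _ ⟨f, hf, rfl⟩ ⟨g, hg, rfl⟩
    refine ⟨f * g, hf.mul hg, ?_⟩
    refine LinearMap.ext fun a => ?_
    obtain ⟨X, hX, rfl⟩ := VGerm.exists_of a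
    rw [Module.End.mul_apply, VGerm.fsmul_of, VGerm.fsmul_of, VGerm.fsmul_of]
    exact (VGerm.of_eq_of_iff _ _).2 (Eventually.of_forall fun y => smul_smul _ _ _)
  add_mem' := by
    rintro _ _ ⟨f, hf, rfl⟩ ⟨g, hg, rfl⟩
    refine ⟨f + g, hf.add hg, ?_⟩
    refine LinearMap.ext fun a => ?_
    obtain ⟨X, hX, rfl⟩ := VGerm.exists_of a
    rw [LinearMap.add_apply, VGerm.fsmul_of, VGerm.fsmul_of, VGerm.fsmul_of]
    exact (VGerm.of_eq_of_iff ((hX.fsmul hf).add (hX.fsmul hg)) _).2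
      (Eventually.of_forall fun y => (add_smul _ _ _).symm)
  algebraMap_mem' c := by
    refine ⟨fun _ => c, Eventually.of_forall fun y => contMDiffAt_const, ?_⟩
    refine LinearMap.ext fun a => ?_
    obtain ⟨X, hX, rfl⟩ := VGerm.exists_of a
    rfl

theorem fsmul_mem_mulOps {x : M} (f : M → ℝ) (hf : SmoothFunNear E x f) :
    (VGerm.fsmul f hf : Module.End ℝ (VGerm E x)) ∈ mulOps x := ⟨f, hf, rfl⟩

theorem exists_ev_mulOps {x : M} {φ : Module.End ℝ (VGerm E x)} (hφ : φ ∈ mulOps x) :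
    ∃ c : ℝ, ∀ a, VGerm.ev x (φ a) = c • VGerm.ev x a := by
  obtain ⟨f, hf, rfl⟩ := hφ
  refine ⟨f x, fun a => ?_⟩
  obtain ⟨X, hX, rfl⟩ := VGerm.exists_of a
  rfl

variable [FiniteDimensional ℝ E]

/-- For the multiplication `φ` by a function `f`, this is the multiplication by the derivative of
`f` along `z`. -/
def der {x : M} (z : VGerm E x) :
    Module.End ℝ (VGerm E x) →ₗ[ℝ] Module.End ℝ (VGerm E x) :=
  LinearMap.mulLeft ℝ (LieAlgebra.ad ℝ (VGerm E x) z) -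
    LinearMap.mulRight ℝ (LieAlgebra.ad ℝ (VGerm E x) z)

theorem der_apply {x : M} (z : VGerm E x) (φ : Module.End ℝ (VGerm E x)) (a : VGerm E x) :
    der z φ a = ⁅z, φ a⁆ - φ ⁅z, a⁆ := rfl

theorem mul_lie {x : M} (z : VGerm E x) (φ : Module.End ℝ (VGerm E x)) (a : VGerm E x) :
    ⁅φ a, z⁆ = φ ⁅a, z⁆ - der z φ a := by
  rw [der_apply, ← lie_skew z, ← lie_skew z a, map_neg]
  abel

theorem lie_mul {x : M} (z : VGerm E x) (φ : Module.End ℝ (VGerm E x)) (a : VGerm E x) :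
    ⁅z, φ a⁆ = der z φ a + φ ⁅z, a⁆ := by
  rw [der_apply]
  abel

theorem der_mul {x : M} (z : VGerm E x) (φ ψ : Module.End ℝ (VGerm E x)) :
    der z (φ * ψ) = der z φ * ψ + φ * der z ψ := by
  refine LinearMap.ext fun a => ?_
  simp only [LinearMap.add_apply, Module.End.mul_apply, der_apply, map_sub]
  abel

theorem der_lie {x : M} (z w : VGerm E x) (φ : Module.End ℝ (VGerm E x)) :
    der ⁅z, w⁆ φ = der z (der w φ) - der w (der z φ) := by
  refine LinearMap.ext fun a => ?_
  simp only [LinearMap.sub_apply, der_apply, map_sub, lie_sub, lie_lie]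
  abel

theorem der_fsmul {x : M} {Z : VField E M} (hZ : SmoothNear x Z) {f : M → ℝ}
    (hf : SmoothFunNear E x f) :
    der (VGerm.of x Z hZ) (VGerm.fsmul f hf) = VGerm.fsmul _ (hf.lieDeriv hZ) := by
  refine LinearMap.ext fun a => ?_
  exact sub_right_injective ((mul_lie _ _ a).symm.trans (VGerm.fsmul_lie hf hZ a))

theorem der_mem_mulOps {x : M} (z : VGerm E x) {φ : Module.End ℝ (VGerm E x)} (hφ : φ ∈ mulOps x) :
    der z φ ∈ mulOps x := by
  obtain ⟨f, hf, rfl⟩ := hφ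
  obtain ⟨Z, hZ, rfl⟩ := VGerm.exists_of z
  exact ⟨_, _, der_fsmul hZ hf⟩

theorem ev_der_of_ev_eq_zero {x : M} {z : VGerm E x} (hz : VGerm.ev x z = 0)
    {φ : Module.End ℝ (VGerm E x)} (hφ : φ ∈ mulOps x) (a : VGerm E x) :
    VGerm.ev x (der z φ a) = 0 := by
  obtain ⟨f, hf, rfl⟩ := hφ
  obtain ⟨Z, hZ, rfl⟩ := VGerm.exists_of z
  obtain ⟨X, hX, rfl⟩ := VGerm.exists_of a
  have hz : Z x = 0 := hz
  rw [der_fsmul, VGerm.fsmul_of, VGerm.ev_of]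
  change mvfderiv 𝓘(ℝ, E) f x (Z x) • X x = 0
  rw [hz, map_zero, zero_smul]

end MulOps

namespace TangentDistribution

variable {E : Type*} [NormedAddCommGroup E] [NormedSpace ℝ E]
  {M : Type*} [TopologicalSpace M] [ChartedSpace E M] [IsManifold 𝓘(ℝ, E) ∞ M]
  [FiniteDimensional ℝ E] (Δ : TangentDistribution E M) (x : M)

theorem mulOps_apply_mem_sec {φ : Module.End ℝ (VGerm E x)} (hφ : φ ∈ mulOps x) {s : ℕ}
    {a : VGerm E x} (ha : a ∈ Δ.sec x s) : φ a ∈ Δ.sec x s := by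
  obtain ⟨f, hf, rfl⟩ := hφ
  exact Δ.fsmul_mem_sec x hf ha

/-- A section of `Δ_s` near `x` is one near all points close to `x`. -/
theorem eventually_mem_sec {s : ℕ} {C : VField E M} {hC : SmoothNear x C}
    (h : VGerm.of x C hC ∈ Δ.sec x s) :
    ∀ᶠ y in 𝓝 x, ∃ hy : SmoothNear y C, VGerm.of y C hy ∈ Δ.sec y s := by
  have hsm : ∀ {B : VField E M}, SmoothNear x B → ∀ᶠ y in 𝓝 x, SmoothNear y B :=
    fun hB => eventually_eventually_nhds.2 hB
  have heq : ∀ {A B : VField E M}, (∀ᶠ y in 𝓝 x, A y = B y) →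
      ∀ᶠ y in 𝓝 x, ∀ (hA : SmoothNear y A) (hB : SmoothNear y B),
        VGerm.of y A hA = VGerm.of y B hB := by
    intro A B hAB
    filter_upwards [eventually_eventually_nhds.2 hAB] with y hy hA hB
    exact (VGerm.of_eq_of_iff hA hB).2 hy
  induction s using Nat.strong_induction_on generalizing C with
  | _ s ih =>
    match s with
    | 0 =>
      have h0 : ∀ᶠ y in 𝓝 x, C y = (0 : VField E M) y :=
        (VGerm.of_eq_of_iff hC (smoothFields E x).zero_mem).1 ((Submodule.mem_bot ℝ).1 h)
      filter_upwards [hsm hC, heq h0] with y hy hy0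
      refine ⟨hy, ?_⟩
      rw [hy0 hy (smoothFields E y).zero_mem]
      exact Submodule.zero_mem _
    | 1 =>
      obtain ⟨X, hX, hXC, hXΔ⟩ := h
      have h0 := (VGerm.of_eq_of_iff hX hC).1 hXC
      filter_upwards [hsm hC, hsm hX, heq h0, eventually_eventually_nhds.2 hXΔ] with y hy hy' hy0 hyΔ
      exact ⟨hy, X, hy', hy0 hy' hy, hyΔ⟩
    | s + 2 =>
      have hspan : ∀ b ∈ Submodule.span ℝ
          {c | ∃ a ∈ Δ.germs x, ∃ b ∈ Δ.sec x (s + 1), c = ⁅a, b⁆},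
          ∀ (B : VField E M) (hB : SmoothNear x B), VGerm.of x B hB = b →
            ∀ᶠ y in 𝓝 x, ∃ hy : SmoothNear y B, VGerm.of y B hy ∈ Δ.sec y (s + 2) := by
        intro b hb
        induction hb using Submodule.span_induction with
        | mem b hb =>
          obtain ⟨p, hp, q, hq, rfl⟩ := hb
          obtain ⟨P, hP, rfl⟩ := p.exists_of
          obtain ⟨Q, hQ, rfl⟩ := q.exists_of
          intro B hB hBb
          rw [VGerm.lie_of] at hBb
          filter_upwards [hsm hB, ih 1 (by omega) (C := P) (hC := hP) hp, ih (s + 1) (by omega) hq,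
            heq ((VGerm.of_eq_of_iff _ _).1 hBb)] with y hy ⟨hyP, hyP'⟩ ⟨hyQ, hyQ'⟩ hye
          refine ⟨hy, ?_⟩
          rw [hye hy (hyP.bracket hyQ), ← VGerm.lie_of hyP hyQ]
          exact Δ.lie_mem_sec_succ y hyP' hyQ'
        | zero =>
          intro B hB hBb
          filter_upwards [hsm hB,
            heq ((VGerm.of_eq_of_iff hB (smoothFields E x).zero_mem).1 hBb)] with y hy hye
          refine ⟨hy, ?_⟩
          rw [hye hy (smoothFields E y).zero_mem]
          exact Submodule.zero_mem _
        | add u v _ _ hu hv =>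
          obtain ⟨U, hU, rfl⟩ := u.exists_of
          obtain ⟨V, hV, rfl⟩ := v.exists_of
          intro B hB hBb
          filter_upwards [hsm hB, hu U hU rfl, hv V hV rfl,
            heq ((VGerm.of_eq_of_iff hB (hU.add hV)).1 hBb)] with y hy ⟨hyU, hyU'⟩ ⟨hyV, hyV'⟩ hye
          refine ⟨hy, ?_⟩
          rw [hye hy (hyU.add hyV)]
          exact Submodule.add_mem _ hyU' hyV'
        | smul c u _ hu =>
          obtain ⟨U, hU, rfl⟩ := u.exists_of
          intro B hB hBb
          filter_upwards [hsm hB, hu U hU rfl,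
            heq ((VGerm.of_eq_of_iff hB (hU.smul c)).1 hBb)] with y hy ⟨hyU, hyU'⟩ hye
          refine ⟨hy, ?_⟩
          rw [hye hy (hyU.smul c)]
          exact Submodule.smul_mem _ c hyU'
      obtain ⟨a1, ha1, a2, ha2, ha⟩ := Submodule.mem_sup.1 h
      obtain ⟨A, hA, rfl⟩ := a1.exists_of
      obtain ⟨B, hB, rfl⟩ := a2.exists_of
      filter_upwards [hsm hC, ih (s + 1) (by omega) ha1, hspan _ ha2 B hB rfl,
        heq ((VGerm.of_eq_of_iff hC (hA.add hB)).1 ha.symm)] with y hy ⟨hyA, hyA'⟩ ⟨hyB, hyB'⟩ hye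
      refine ⟨hy, ?_⟩
      rw [hye hy (hyA.add hyB)]
      exact Submodule.add_mem _ (Δ.sec_mono y (by omega) hyA') hyB'

instance (y : M) : FiniteDimensional ℝ (TangentSpace 𝓘(ℝ, E) y) :=
  inferInstanceAs (FiniteDimensional ℝ E)

/-- If `Δ_s` has constant rank, then near `x` it has a frame of sections, and all vector fields with
values in `Δ_s` are combinations of the frame with smooth coefficients. -/
theorem exists_frame_sec (hreg : Δ.IsRegular) (s : ℕ) :
    ∃ (r : ℕ) (a : Fin r → VGerm E x), (∀ k, a k ∈ Δ.sec x s) ∧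
      LinearIndependent ℝ (fun k => VGerm.ev x (a k)) ∧
      ∀ (C : VField E M) (hC : SmoothNear x C), (∀ᶠ y in 𝓝 x, C y ∈ Δ.flag y s) →
        ∃ φ : Fin r → Module.End ℝ (VGerm E x), (∀ k, φ k ∈ mulOps x) ∧
          VGerm.of x C hC = ∑ k, φ k (a k) := by
  obtain ⟨r, hr⟩ := hreg s
  let b := Module.finBasisOfFinrankEq ℝ (Δ.flag x s) (hr x)
  have hb : ∀ k, ∃ (A : VField E M) (hA : SmoothNear x A), VGerm.of x A hA ∈ Δ.sec x s ∧
      A x = b k := by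
    intro k
    obtain ⟨a, ha, hab⟩ := (b k).2
    obtain ⟨A, hA, rfl⟩ := VGerm.exists_of a
    exact ⟨A, hA, ha, hab⟩
  choose A hA hAs hAb using hb
  have hind : LinearIndependent ℝ fun k => A k x := by
    simp only [hAb]
    exact b.linearIndependent.map' (Δ.flag x s).subtype (Submodule.ker_subtype _)
  obtain ⟨h1, h2⟩ := exists_smooth_coeff hA hind
  refine ⟨r, fun k => VGerm.of x (A k) (hA k), hAs, hind, fun C hC hCs => ?_⟩
  obtain ⟨f, hf, hfC⟩ := h2 C hC (by
    filter_upwards [hCs, h1, eventually_all.2 fun k => Δ.eventually_mem_sec x (hAs k)] with y hy hyi hyA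
    have hle : Submodule.span ℝ (Set.range fun k => A k y) ≤ Δ.flag y s := by
      rw [Submodule.span_le]
      rintro _ ⟨k, rfl⟩
      obtain ⟨hk, hk'⟩ := hyA k
      exact ⟨_, hk', rfl⟩
    rw [Submodule.eq_of_le_of_finrank_eq hle (by rw [finrank_span_eq_card hyi, hr y]; simp)]
    exact hy)
  refine ⟨fun k => VGerm.fsmul (f k) (hf k), fun k => fsmul_mem_mulOps _ _, ?_⟩
  have hsum : ∀ S : Finset (Fin r), ∃ hS : SmoothNear x (∑ k ∈ S, f k • A k),
      ∑ k ∈ S, VGerm.fsmul (f k) (hf k) (VGerm.of x (A k) (hA k)) = VGerm.of x _ hS := by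
    intro S
    induction S using Finset.induction_on with
    | empty => exact ⟨(smoothFields E x).zero_mem, rfl⟩
    | insert k S hk ih =>
      obtain ⟨hS, hS'⟩ := ih
      simp only [Finset.sum_insert hk, hS']
      exact ⟨((hA k).fsmul (hf k)).add hS, rfl⟩
  obtain ⟨hS, hS'⟩ := hsum Finset.univ
  rw [hS']
  refine (VGerm.of_eq_of_iff hC hS).2 ?_
  filter_upwards [hfC] with y hy
  rw [hy, Finset.sum_apply]
  rfl

theorem exists_frame_sec_of_mem (hreg : Δ.IsRegular) (s : ℕ) :
    ∃ (r : ℕ) (a : Fin r → VGerm E x), (∀ k, a k ∈ Δ.sec x s) ∧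
      LinearIndependent ℝ (fun k => VGerm.ev x (a k)) ∧
      ∀ c ∈ Δ.sec x s, ∃ φ : Fin r → Module.End ℝ (VGerm E x), (∀ k, φ k ∈ mulOps x) ∧
        c = ∑ k, φ k (a k) := by
  obtain ⟨r, a, ha, hi, h⟩ := Δ.exists_frame_sec x hreg s
  refine ⟨r, a, ha, hi, fun c hc => ?_⟩
  obtain ⟨C, hC, rfl⟩ := c.exists_of
  refine h C hC ?_
  filter_upwards [Δ.eventually_mem_sec x hc] with y ⟨hy, hy'⟩
  exact ⟨_, hy', rfl⟩

theorem ev_eq_zero_of_sum_ev_eq_zero {r : ℕ} {a : Fin r → VGerm E x}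
    (hi : LinearIndependent ℝ fun k => VGerm.ev x (a k)) {φ : Fin r → Module.End ℝ (VGerm E x)}
    (hφ : ∀ k, φ k ∈ mulOps x) (h : VGerm.ev x (∑ k, φ k (a k)) = 0) (k : Fin r) (b : VGerm E x) :
    VGerm.ev x (φ k b) = 0 := by
  choose c hc using fun k => exists_ev_mulOps (hφ k)
  rw [map_sum] at h
  simp only [hc] at h
  rw [hc, Fintype.linearIndependent_iff.1 hi c h k, zero_smul]

/-- A section of `Δ_s` that vanishes at `x` is in `μ_x Γ(Δ_s)`. -/
theorem exists_sum_of_ev_eq_zero (hreg : Δ.IsRegular) {s : ℕ} {a : VGerm E x} (ha : a ∈ Δ.sec x s)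
    (h0 : VGerm.ev x a = 0) :
    ∃ (r : ℕ) (b : Fin r → VGerm E x) (φ : Fin r → Module.End ℝ (VGerm E x)),
      (∀ k, b k ∈ Δ.sec x s) ∧ (∀ k, VGerm.ev x (b k) ≠ 0) ∧ (∀ k, φ k ∈ mulOps x) ∧
      (∀ k c, VGerm.ev x (φ k c) = 0) ∧
      a = ∑ k, φ k (b k) := by
  obtain ⟨r, b, hb, hi, h⟩ := Δ.exists_frame_sec_of_mem x hreg s
  obtain ⟨φ, hφ, rfl⟩ := h a ha
  exact ⟨r, b, φ, hb, hi.ne_zero, hφ, ev_eq_zero_of_sum_ev_eq_zero x hi hφ h0, rfl⟩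

/-- For a regular distribution, `symKer` consists of the sections of `Δ_s` with value in
`Δ_{s-1}(x)`. -/
theorem mem_symKer_of_ev_mem (hreg : Δ.IsRegular) {s : ℕ} {a : VGerm E x} (ha : a ∈ Δ.sec x s)
    (h : VGerm.ev x a ∈ Δ.flag x (s - 1)) : a ∈ Δ.symKer x s := by
  obtain ⟨b, hb, hab⟩ := h
  have hb' : b ∈ Δ.sec x s := Δ.sec_mono x (by omega) hb
  obtain ⟨r, c, φ, hc, hc0, hφ, hφ0, hsum⟩ := Δ.exists_sum_of_ev_eq_zero x hreg
    (Submodule.sub_mem _ ha hb') (by rw [map_sub, hab, sub_self])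
  rw [← sub_add_cancel a b, add_comm]
  refine Submodule.add_mem_sup hb ?_
  rw [hsum]
  refine Submodule.sum_mem _ fun k _ => ?_
  obtain ⟨f, hf, hφk⟩ := hφ k
  refine Submodule.subset_span ⟨f, hf, ?_, c k, hc k, by rw [hφk]⟩
  have h0 := hφ0 k (c k)
  have hck := hc0 k
  rw [hφk] at h0
  obtain ⟨C, hC, hCk⟩ := (c k).exists_of
  rw [← hCk] at h0 hck
  exact (smul_eq_zero.1 (show f x • C x = 0 from h0)).resolve_right hck

theorem sec_eq_top (hreg : Δ.IsRegular) {κ : ℕ} (hκ : ∀ y, Δ.flag y κ = ⊤) : Δ.sec x κ = ⊤ := by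
  rw [eq_top_iff]
  rintro c -
  obtain ⟨r, a, ha, -, h⟩ := Δ.exists_frame_sec x hreg κ
  obtain ⟨C, hC, rfl⟩ := c.exists_of
  obtain ⟨φ, hφ, hsum⟩ := h C hC (Eventually.of_forall fun y => by rw [hκ y]; trivial)
  rw [hsum]
  exact Submodule.sum_mem _ fun k _ => Δ.mulOps_apply_mem_sec x (hφ k) (ha k)

/-- The commutator of two vector fields vanishing at `x` vanishes at `x`: the first is a combination of
vector fields with coefficients that vanish at `x`, and the second does not differentiate them there. -/
theorem ev_lie_eq_zero (hreg : Δ.IsRegular) (hnh : Δ.IsCompletelyNonholonomic) {a b : VGerm E x}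
    (ha : VGerm.ev x a = 0) (hb : VGerm.ev x b = 0) : VGerm.ev x ⁅a, b⁆ = 0 := by
  obtain ⟨κ, hκ⟩ := hnh
  obtain ⟨r, c, φ, -, -, hφ, hφ0, rfl⟩ := Δ.exists_sum_of_ev_eq_zero x hreg (s := κ) (a := a)
    (by rw [Δ.sec_eq_top x hreg hκ]; trivial) ha
  rw [sum_lie, map_sum]
  refine Finset.sum_eq_zero fun k _ => ?_
  rw [mul_lie, map_sub, hφ0, ev_der_of_ev_eq_zero hb (hφ k), sub_zero]

end TangentDistribution

/-! ### The weighted filtration of vector fields -/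

namespace TangentDistribution

variable {E : Type*} [NormedAddCommGroup E] [NormedSpace ℝ E]
  {M : Type*} [TopologicalSpace M] [ChartedSpace E M] [IsManifold 𝓘(ℝ, E) ∞ M]
  [FiniteDimensional ℝ E] (Δ : TangentDistribution E M) (x : M)

/-- Multiplications by functions of weighted order at least `n` at `x`: all derivatives of order less
than `n` along sections of `Δ` vanish at `x`. -/
def ordOps : ℕ → Submodule ℝ (Module.End ℝ (VGerm E x))
  | 0 => Subalgebra.toSubmodule (mulOps x)
  | n + 1 =>
    { carrier := {φ | φ ∈ mulOps x ∧ (∀ a, VGerm.ev x (φ a) = 0) ∧ ∀ z ∈ Δ.germs x, der z φ ∈ ordOps n}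
      add_mem' := fun {φ ψ} hφ hψ => by
        refine ⟨add_mem hφ.1 hψ.1, fun a => ?_, fun z hz => ?_⟩
        · rw [LinearMap.add_apply, map_add, hφ.2.1, hψ.2.1, add_zero]
        · rw [map_add]; exact add_mem (hφ.2.2 z hz) (hψ.2.2 z hz)
      zero_mem' := by
        refine ⟨zero_mem _, fun a => ?_, fun z hz => ?_⟩
        · rw [LinearMap.zero_apply, map_zero]
        · rw [map_zero]; exact zero_mem _
      smul_mem' := fun c φ hφ => by
        refine ⟨Subalgebra.smul_mem _ hφ.1 c, fun a => ?_, fun z hz => ?_⟩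
        · rw [LinearMap.smul_apply, map_smul, hφ.2.1, smul_zero]
        · rw [map_smul]; exact Submodule.smul_mem _ c (hφ.2.2 z hz) }

variable {x}

theorem mem_ordOps_succ {n : ℕ} {φ : Module.End ℝ (VGerm E x)} : φ ∈ Δ.ordOps x (n + 1) ↔
    φ ∈ mulOps x ∧ (∀ a, VGerm.ev x (φ a) = 0) ∧ ∀ z ∈ Δ.germs x, der z φ ∈ Δ.ordOps x n := Iff.rfl

theorem mem_mulOps_of_mem_ordOps {n : ℕ} {φ : Module.End ℝ (VGerm E x)} (h : φ ∈ Δ.ordOps x n) :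
    φ ∈ mulOps x := by
  cases n with
  | zero => exact h
  | succ n => exact h.1

theorem ordOps_antitone : Antitone (Δ.ordOps x) := by
  refine antitone_nat_of_succ_le fun n => ?_
  induction n with
  | zero => exact fun φ h => h.1
  | succ n ih => exact fun φ h => ⟨h.1, h.2.1, fun z hz => ih (h.2.2 z hz)⟩

theorem ev_ordOps {n : ℕ} (hn : 1 ≤ n) {φ : Module.End ℝ (VGerm E x)} (h : φ ∈ Δ.ordOps x n)
    (a : VGerm E x) : VGerm.ev x (φ a) = 0 := (Δ.ordOps_antitone hn h).2.1 a

theorem der_mem_ordOps_of_germs {n : ℕ} {φ : Module.End ℝ (VGerm E x)} (h : φ ∈ Δ.ordOps x n)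
    {z : VGerm E x} (hz : z ∈ Δ.germs x) : der z φ ∈ Δ.ordOps x (n - 1) := by
  cases n with
  | zero => exact der_mem_mulOps z h
  | succ n => exact h.2.2 z hz

theorem mul_mem_ordOps {n m N : ℕ} (hN : N ≤ n + m) {φ ψ : Module.End ℝ (VGerm E x)}
    (hφ : φ ∈ Δ.ordOps x n) (hψ : ψ ∈ Δ.ordOps x m) : φ * ψ ∈ Δ.ordOps x N := by
  have hmul : φ * ψ ∈ mulOps x :=
    mul_mem (Δ.mem_mulOps_of_mem_ordOps hφ) (Δ.mem_mulOps_of_mem_ordOps hψ)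
  induction N generalizing n m φ ψ with
  | zero => exact hmul
  | succ N ih =>
    refine ⟨hmul, fun a => ?_, fun z hz => ?_⟩
    · rw [Module.End.mul_apply]
      rcases Nat.eq_zero_or_pos n with rfl | hn
      · obtain ⟨c, hc⟩ := exists_ev_mulOps (Δ.mem_mulOps_of_mem_ordOps hφ)
        rw [hc, Δ.ev_ordOps (by omega) hψ, smul_zero]
      · exact Δ.ev_ordOps hn hφ _
    · have h1 := Δ.der_mem_ordOps_of_germs hφ hz
      have h2 := Δ.der_mem_ordOps_of_germs hψ hz
      rw [der_mul]
      exact add_mem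
        (ih (by omega) h1 hψ (mul_mem (Δ.mem_mulOps_of_mem_ordOps h1) (Δ.mem_mulOps_of_mem_ordOps hψ)))
        (ih (by omega) hφ h2 (mul_mem (Δ.mem_mulOps_of_mem_ordOps hφ) (Δ.mem_mulOps_of_mem_ordOps h2)))

/-- The derivative of `φ` as a linear map in the vector field. -/
def derOf (φ : Module.End ℝ (VGerm E x)) : VGerm E x →ₗ[ℝ] Module.End ℝ (VGerm E x) where
  toFun z := der z φ
  map_add' z w := LinearMap.ext fun a => by simp only [LinearMap.add_apply, der_apply, add_lie, map_add]; abel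
  map_smul' c z := LinearMap.ext fun a => by
    simp only [LinearMap.smul_apply, der_apply, smul_lie, map_smul, smul_sub, RingHom.id_apply]

/-- Sections of `Δ_s` satisfy a linear condition as soon as it holds for sections of `Δ_{s-1}` and for
brackets with sections of `Δ`. -/
theorem sec_induction {s : ℕ} {N : Submodule ℝ (VGerm E x)} (h1 : Δ.sec x (s + 1) ≤ N)
    (h2 : ∀ a ∈ Δ.germs x, ∀ b ∈ Δ.sec x (s + 1), ⁅a, b⁆ ∈ N) : Δ.sec x (s + 2) ≤ N := by
  refine sup_le h1 (Submodule.span_le.2 ?_)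
  rintro _ ⟨a, ha, b, hb, rfl⟩
  exact h2 a ha b hb

theorem der_mem_ordOps_of_sec {n s : ℕ} {φ : Module.End ℝ (VGerm E x)} (h : φ ∈ Δ.ordOps x n)
    {z : VGerm E x} (hz : z ∈ Δ.sec x s) : der z φ ∈ Δ.ordOps x (n - s) := by
  induction s using Nat.strong_induction_on generalizing n φ z with
  | _ s ih =>
    match s with
    | 0 =>
      rw [(Submodule.mem_bot ℝ).1 hz, show der (0 : VGerm E x) φ = 0 from map_zero (derOf φ)]
      exact zero_mem _
    | 1 => exact Δ.der_mem_ordOps_of_germs h hz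
    | s + 2 =>
      refine Δ.sec_induction (N := (Δ.ordOps x (n - (s + 2))).comap (derOf φ)) (fun a ha => ?_)
        (fun a ha b hb => ?_) hz
      · exact Δ.ordOps_antitone (by omega) (ih (s + 1) (by omega) h ha)
      · change der ⁅a, b⁆ φ ∈ Δ.ordOps x (n - (s + 2))
        rw [der_lie]
        refine Submodule.sub_mem _ ?_ ?_
        · exact Δ.ordOps_antitone (by omega)
            (Δ.der_mem_ordOps_of_germs (ih (s + 1) (by omega) h hb) ha)
        · exact Δ.ordOps_antitone (by omega)
            (ih (s + 1) (by omega) (Δ.der_mem_ordOps_of_germs h ha) hb)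

variable (x)

/-- Combinations of sections of the `Δ_t` with coefficients of weighted order at least `t - c`. -/
def wtSec (c : ℤ) : Submodule ℝ (VGerm E x) :=
  Submodule.span ℝ {b | ∃ t : ℕ, ∃ a ∈ Δ.sec x t, ∃ φ ∈ Δ.ordOps x (t - c).toNat, b = φ a}

/-- Vector fields of weight at least `-c` at `x`: those with value in `Δ_c(x)` whose brackets with
sections of `Δ` are combinations of sections of the weak derived flag of weight at least
`-(c + 1)`. -/
def wtFields (c : ℤ) : Submodule ℝ (VGerm E x) where
  carrier := {u | VGerm.ev x u ∈ Δ.flag x c.toNat ∧ ∀ y ∈ Δ.germs x, ⁅u, y⁆ ∈ Δ.wtSec x (c + 1)}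
  add_mem' := fun hu hv => ⟨by rw [map_add]; exact add_mem hu.1 hv.1,
    fun y hy => by rw [add_lie]; exact add_mem (hu.2 y hy) (hv.2 y hy)⟩
  zero_mem' := ⟨by rw [map_zero]; exact zero_mem _, fun y _ => by rw [zero_lie]; exact zero_mem _⟩
  smul_mem' := fun c u hu => ⟨by rw [map_smul]; exact Submodule.smul_mem _ c hu.1,
    fun y hy => by rw [smul_lie]; exact Submodule.smul_mem _ c (hu.2 y hy)⟩

variable {x}

theorem mul_mem_wtSec {t : ℕ} {a : VGerm E x} (ha : a ∈ Δ.sec x t) {n : ℕ}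
    {φ : Module.End ℝ (VGerm E x)} (hφ : φ ∈ Δ.ordOps x n) {c : ℤ} (h : t ≤ n + c) :
    φ a ∈ Δ.wtSec x c :=
  Submodule.subset_span ⟨t, a, ha, φ, Δ.ordOps_antitone (by omega) hφ, rfl⟩

theorem sec_le_wtSec (s : ℕ) : Δ.sec x s ≤ Δ.wtSec x s := fun a ha =>
  Δ.mul_mem_wtSec ha (φ := 1) (n := 0) (show (1 : Module.End ℝ (VGerm E x)) ∈ mulOps x from one_mem _)
    (by omega)

theorem wtSec_mono : Monotone (Δ.wtSec x) := by
  intro c d h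
  refine Submodule.span_le.2 ?_
  rintro _ ⟨t, a, ha, φ, hφ, rfl⟩
  exact Δ.mul_mem_wtSec ha hφ (by omega)

theorem wtSec_le_wtFields (c : ℤ) : Δ.wtSec x c ≤ Δ.wtFields x c := by
  refine Submodule.span_le.2 ?_
  rintro _ ⟨t, a, ha, φ, hφ, rfl⟩
  refine ⟨?_, fun y hy => ?_⟩
  · rcases Nat.eq_zero_or_pos (t - c).toNat with h | h
    · obtain ⟨r, hr⟩ := exists_ev_mulOps (Δ.mem_mulOps_of_mem_ordOps hφ)
      rw [hr]
      exact Submodule.smul_mem _ r (Δ.flag_mono x (by omega) ⟨a, ha, rfl⟩)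
    · rw [Δ.ev_ordOps h hφ]
      exact zero_mem _
  · rw [mul_lie, ← lie_skew a, map_neg]
    refine sub_mem (neg_mem ?_) ?_
    · exact Δ.mul_mem_wtSec (Δ.lie_mem_sec_succ x hy ha) hφ (by push_cast; omega)
    · exact Δ.mul_mem_wtSec ha (Δ.der_mem_ordOps_of_germs hφ hy) (by omega)

theorem wtFields_mono : Monotone (Δ.wtFields x) := fun _ _ h _ hu =>
  ⟨Δ.flag_mono x (by omega) hu.1, fun y hy => Δ.wtSec_mono (by omega) (hu.2 y hy)⟩

theorem lie_sec_mem_wtSec {c : ℤ} {u : VGerm E x} (hu : u ∈ Δ.wtFields x c) {s : ℕ} {a : VGerm E x}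
    (ha : a ∈ Δ.sec x s) : ⁅u, a⁆ ∈ Δ.wtSec x (c + s) := by
  induction s using Nat.strong_induction_on generalizing c u a with
  | _ s ih =>
    match s with
    | 0 => rw [(Submodule.mem_bot ℝ).1 ha, lie_zero]; exact zero_mem _
    | 1 => exact hu.2 a ha
    | s + 2 =>
      refine Δ.sec_induction (N := (Δ.wtSec x (c + (s + 2 : ℕ))).comap
        (LieAlgebra.ad ℝ (VGerm E x) u : VGerm E x →ₗ[ℝ] VGerm E x)) (fun a ha => ?_)
        (fun a ha b hb => ?_) ha
      · exact Δ.wtSec_mono (by push_cast; omega) (ih (s + 1) (by omega) hu ha)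
      · change ⁅u, ⁅a, b⁆⁆ ∈ Δ.wtSec x (c + (s + 2 : ℕ))
        rw [leibniz_lie, ← lie_skew a, ← sub_eq_add_neg]
        refine sub_mem ?_ ?_
        · have := ih (s + 1) (by omega) (Δ.wtSec_le_wtFields _ (hu.2 a ha)) hb
          exact Δ.wtSec_mono (by push_cast; omega) this
        · have := (Δ.wtSec_le_wtFields _ (ih (s + 1) (by omega) hu hb)).2 a ha
          exact Δ.wtSec_mono (by push_cast; omega) this

theorem sec_toNat_le_wtFields (c : ℤ) : Δ.sec x c.toNat ≤ Δ.wtFields x c := by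
  rcases le_or_gt 0 c with h | h
  · exact fun a ha => Δ.wtSec_le_wtFields c (Δ.wtSec_mono (by omega) (Δ.sec_le_wtSec _ ha))
  · rw [Int.toNat_of_nonpos h.le]
    exact bot_le

theorem der_mem_ordOps {c : ℤ} {u : VGerm E x} (hu : u ∈ Δ.wtFields x c) {n k : ℕ}
    {φ : Module.End ℝ (VGerm E x)} (hφ : φ ∈ Δ.ordOps x n) (h : k = 0 ∨ k + c ≤ n) :
    der u φ ∈ Δ.ordOps x k := by
  induction k generalizing c u n φ with
  | zero => exact der_mem_mulOps u (Δ.mem_mulOps_of_mem_ordOps hφ)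
  | succ k ih =>
    have h : (k : ℤ) + 1 + c ≤ n := by simpa using h
    refine ⟨der_mem_mulOps u (Δ.mem_mulOps_of_mem_ordOps hφ), fun a => ?_, fun z hz => ?_⟩
    · -- the derivative at `x` depends only on the value of `u` at `x`
      obtain ⟨b, hb, hbu⟩ := hu.1
      have h1 : der u φ a = der (u - b) φ a + der b φ a := by
        simp only [der_apply, sub_lie, map_sub]; abel
      rw [h1, map_add, ev_der_of_ev_eq_zero (by rw [map_sub, hbu, sub_self])
        (Δ.mem_mulOps_of_mem_ordOps hφ), zero_add]
      rcases le_or_gt 0 c with hc | hc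
      · exact Δ.ev_ordOps (by omega) (Δ.der_mem_ordOps_of_sec hφ hb) a
      · have hb : b ∈ Δ.sec x c.toNat := hb
        rw [Int.toNat_of_nonpos hc.le] at hb
        rw [(Submodule.mem_bot ℝ).1 hb, der_apply, zero_lie, zero_lie, map_zero, sub_zero, map_zero]
    · have h1 : der z (der u φ) = der u (der z φ) - der ⁅u, z⁆ φ := by rw [der_lie]; abel
      rw [h1]
      refine Submodule.sub_mem _ ?_ ?_
      · exact ih hu (Δ.der_mem_ordOps_of_germs hφ hz) (by omega)
      · exact ih (Δ.wtSec_le_wtFields _ (hu.2 z hz)) hφ (by omega)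

theorem mul_wtSec {n : ℕ} {ψ : Module.End ℝ (VGerm E x)} (hψ : ψ ∈ Δ.ordOps x n) {c : ℤ}
    {b : VGerm E x} (hb : b ∈ Δ.wtSec x c) : ψ b ∈ Δ.wtSec x (c - n) := by
  have h : Δ.wtSec x c ≤ (Δ.wtSec x (c - n)).comap ψ := by
    refine Submodule.span_le.2 ?_
    rintro _ ⟨t, a, ha, φ, hφ, rfl⟩
    exact Δ.mul_mem_wtSec ha (Δ.mul_mem_ordOps le_rfl hψ hφ) (by push_cast; omega)
  exact h hb

theorem lie_mem_wtSec {c d : ℤ} {u b : VGerm E x} (hu : u ∈ Δ.wtFields x c)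
    (hb : b ∈ Δ.wtSec x d) : ⁅u, b⁆ ∈ Δ.wtSec x (c + d) := by
  have h : Δ.wtSec x d ≤ (Δ.wtSec x (c + d)).comap
      (LieAlgebra.ad ℝ (VGerm E x) u : VGerm E x →ₗ[ℝ] VGerm E x) := by
    refine Submodule.span_le.2 ?_
    rintro _ ⟨t, a, ha, φ, hφ, rfl⟩
    change ⁅u, φ a⁆ ∈ Δ.wtSec x (c + d)
    rw [lie_mul]
    refine add_mem ?_ ?_
    · exact Δ.mul_mem_wtSec ha (n := (t - (c + d)).toNat) (Δ.der_mem_ordOps hu hφ (by omega))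
        (by omega)
    · exact Δ.wtSec_mono (by omega) (Δ.mul_wtSec hφ (Δ.lie_sec_mem_wtSec hu ha))
  exact h hb

theorem ev_lie_sec_mem_flag {c d : ℤ} {u b : VGerm E x} (hu : u ∈ Δ.wtFields x c)
    (hb : b ∈ Δ.sec x d.toNat) : VGerm.ev x ⁅u, b⁆ ∈ Δ.flag x (c + d).toNat := by
  rcases le_or_gt 0 d with h | h
  · exact Δ.flag_mono x (by omega) (Δ.wtSec_le_wtFields _ (Δ.lie_sec_mem_wtSec hu hb)).1
  · rw [Int.toNat_of_nonpos h.le] at hb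
    rw [(Submodule.mem_bot ℝ).1 hb, lie_zero, map_zero]
    exact zero_mem _

theorem lie_mem_wtFields (hreg : Δ.IsRegular) (hnh : Δ.IsCompletelyNonholonomic) {c d : ℤ}
    {u v : VGerm E x} (hu : u ∈ Δ.wtFields x c) (hv : v ∈ Δ.wtFields x d) :
    ⁅u, v⁆ ∈ Δ.wtFields x (c + d) := by
  refine ⟨?_, fun y hy => ?_⟩
  · obtain ⟨a, ha, hau⟩ := hu.1
    obtain ⟨b, hb, hbv⟩ := hv.1
    have h : ⁅u, v⁆ = ⁅u, b⁆ - ⁅v, a⁆ - ⁅a, b⁆ + ⁅u - a, v - b⁆ := by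
      rw [sub_lie, lie_sub, lie_sub, ← lie_skew v a]; abel
    rw [h, map_add, Δ.ev_lie_eq_zero x hreg hnh (a := u - a) (b := v - b)
      (by rw [map_sub, hau, sub_self]) (by rw [map_sub, hbv, sub_self]), add_zero, map_sub, map_sub]
    refine sub_mem (sub_mem (Δ.ev_lie_sec_mem_flag hu hb) ?_)
      (Δ.ev_lie_sec_mem_flag (Δ.sec_toNat_le_wtFields c ha) hb)
    rw [add_comm]
    exact Δ.ev_lie_sec_mem_flag hv ha
  · rw [lie_lie_right, ← lie_skew]
    refine add_mem (neg_mem ?_) ?_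
    · exact Δ.wtSec_mono (by omega) (Δ.lie_mem_wtSec hv (hu.2 y hy))
    · exact Δ.wtSec_mono (by omega) (Δ.lie_mem_wtSec hu (hv.2 y hy))

variable (x) in
/-- The weighted filtration of all germs of vector fields at `x` is a filtration by Lie brackets. -/
theorem isLieFiltration_wtFields (hreg : Δ.IsRegular) (hnh : Δ.IsCompletelyNonholonomic) :
    IsLieFiltration fun i : ℤ => Δ.wtFields x (-i) where
  antitone _ _ h := Δ.wtFields_mono (by omega)
  lie_mem i j u hu v hv := by
    rw [neg_add]
    exact Δ.lie_mem_wtFields hreg hnh hu hv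

/-! ### The filtration of the local symmetries -/

/-- The iterated bracket as a linear map in its first entry. -/
def iterLieHom (l : List (VGerm E x)) : VGerm E x →ₗ[ℝ] VGerm E x where
  toFun a := iterLie a l
  map_add' a b := iterLie_add a b l
  map_smul' c a := iterLie_smul c a l

theorem ev_iterLie_mul {n : ℕ} {φ : Module.End ℝ (VGerm E x)} (hφ : φ ∈ Δ.ordOps x n)
    (l : List (VGerm E x)) (hl : ∀ b ∈ l, b ∈ Δ.germs x) (hn : l.length < n) (a : VGerm E x) :
    VGerm.ev x (iterLie (φ a) l) = 0 := by
  induction l generalizing n φ a with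
  | nil => exact Δ.ev_ordOps hn hφ a
  | cons y l ih =>
    have hl' : ∀ b ∈ l, b ∈ Δ.germs x := fun b hb => hl b (List.mem_cons_of_mem y hb)
    rw [List.length_cons] at hn
    change VGerm.ev x (iterLieHom l ⁅φ a, y⁆) = 0
    rw [mul_lie, map_sub, map_sub]
    change VGerm.ev x (iterLie _ l) - VGerm.ev x (iterLie _ l) = 0
    rw [ih hφ hl' (by omega), ih (Δ.der_mem_ordOps_of_germs hφ (hl y (by simp))) hl' (by omega),
      sub_zero]

/-- A combination of independent sections has coefficients of weighted order at least `n` as soon as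
its iterated brackets with fewer than `n` sections of `Δ` vanish at `x`. -/
theorem mem_ordOps_of_ev_iterLie {r : ℕ} {a : Fin r → VGerm E x}
    (hi : LinearIndependent ℝ fun k => VGerm.ev x (a k)) {n : ℕ}
    {φ : Fin r → Module.End ℝ (VGerm E x)} (hφ : ∀ k, φ k ∈ mulOps x)
    (h : ∀ l : List (VGerm E x), (∀ b ∈ l, b ∈ Δ.germs x) → l.length < n →
      VGerm.ev x (iterLie (∑ k, φ k (a k)) l) = 0) (k : Fin r) : φ k ∈ Δ.ordOps x n := by
  induction n generalizing φ k with
  | zero => exact hφ k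
  | succ n ih =>
    refine ⟨hφ k, fun b => ?_, fun z hz => ?_⟩
    · exact ev_eq_zero_of_sum_ev_eq_zero x hi hφ (h [] (by simp) (by simp)) k b
    · have hn : ∀ k, φ k ∈ Δ.ordOps x n := ih hφ fun l hl hln => h l hl (by omega)
      refine ih (fun k => der_mem_mulOps z (hφ k)) (fun l hl hln => ?_) k
      have h1 : ∑ k, der z (φ k) (a k) = ∑ k, φ k ⁅a k, z⁆ - ⁅∑ k, φ k (a k), z⁆ := by
        rw [sum_lie, ← Finset.sum_sub_distrib]
        exact Finset.sum_congr rfl fun k _ => by rw [mul_lie]; abel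
      have h2 : VGerm.ev x (iterLieHom l ⁅∑ k, φ k (a k), z⁆) = 0 :=
        h (z :: l) (by rintro b (_ | ⟨_, hb⟩); exacts [hz, hl b hb]) (by simpa using hln)
      change VGerm.ev x (iterLieHom l _) = 0
      rw [h1, map_sub, map_sub, h2, sub_zero, map_sum, map_sum]
      exact Finset.sum_eq_zero fun k _ => Δ.ev_iterLie_mul (hn k) l hl hln _

/-- For a symmetry `X` in the `i`-th step of the filtration and a section `y` of `Δ`, the bracket `[X, y]`
is a combination of sections of `Δ` with coefficients of weighted order at least `i`. -/
theorem exists_sum_lie_eq (hreg : Δ.IsRegular) {i : ℤ} {X : Δ.localSym x}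
    (hX : X ∈ Δ.filtration x i) {y : VGerm E x} (hy : y ∈ Δ.germs x) :
    ∃ (r : ℕ) (a : Fin r → VGerm E x) (φ : Fin r → Module.End ℝ (VGerm E x)),
      (∀ k, a k ∈ Δ.sec x 1) ∧ (∀ k, φ k ∈ Δ.ordOps x i.toNat) ∧
      ⁅(X : VGerm E x), y⁆ = ∑ k, φ k (a k) := by
  obtain ⟨r, a, ha, hi, h⟩ := Δ.exists_frame_sec_of_mem x hreg 1
  obtain ⟨φ, hφ, hsum⟩ := h _ (X.2 y hy)
  refine ⟨r, a, φ, ha, Δ.mem_ordOps_of_ev_iterLie hi hφ fun l hl hln => ?_, hsum⟩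
  rw [← hsum]
  exact hX.2 (y :: l) (by rintro b (_ | ⟨_, hb⟩); exacts [hy, hl b hb])
    (by rw [List.length_cons]; push_cast; omega)

theorem iterLie_mem_wtFields {c : ℤ} {u : VGerm E x} (hu : u ∈ Δ.wtFields x c)
    (l : List (VGerm E x)) (hl : ∀ b ∈ l, b ∈ Δ.germs x) :
    iterLie u l ∈ Δ.wtFields x (c + l.length) := by
  induction l generalizing u c with
  | nil => simpa [iterLie] using hu
  | cons y l ih =>
    have := ih (Δ.wtSec_le_wtFields _ (hu.2 y (hl y (by simp)))) fun b hb =>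
      hl b (List.mem_cons_of_mem y hb)
    rw [List.length_cons]
    push_cast
    rwa [show c + 1 + (l.length : ℤ) = c + (l.length + 1) by ring] at this

/-- The filtration of the local symmetries is the restriction of the weighted filtration of all vector
fields. -/
theorem mem_filtration_iff (hreg : Δ.IsRegular) {i : ℤ} {X : Δ.localSym x} :
    X ∈ Δ.filtration x i ↔ (X : VGerm E x) ∈ Δ.wtFields x (-i) := by
  constructor
  · refine fun hX => ⟨hX.1, fun y hy => ?_⟩
    obtain ⟨r, a, φ, ha, hφ, hsum⟩ := Δ.exists_sum_lie_eq hreg hX hy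
    rw [hsum]
    exact sum_mem fun k _ => Δ.mul_mem_wtSec (ha k) (hφ k) (by push_cast; omega)
  · refine fun hX => ⟨hX.1, fun l hl hli => ?_⟩
    have := (Δ.iterLie_mem_wtFields hX l hl).1
    rw [Int.toNat_of_nonpos (by omega)] at this
    simpa [flag, sec] using this

theorem isLieFiltration_filtration (hreg : Δ.IsRegular) (hnh : Δ.IsCompletelyNonholonomic) :
    IsLieFiltration (Δ.filtration x) where
  antitone := Δ.filtration_antitone x
  lie_mem i j X hX Y hY := by
    rw [Δ.mem_filtration_iff hreg] at hX hY ⊢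
    rw [neg_add]
    exact Δ.lie_mem_wtFields hreg hnh hX hY

end TangentDistribution

/-! ### Maps of graded Lie algebras -/

namespace GradedLieAlg

universe v v'

variable {D : GradedLieAlg.{v}} {D' : GradedLieAlg.{v'}}

/-- The map of direct sums given by linear maps of the components. -/
def totalMap (f : ∀ i, D.V i →ₗ[ℝ] D'.V i) : D.Total →ₗ[ℝ] D'.Total :=
  DirectSum.toModule ℝ ℤ D'.Total fun i => D'.incl i ∘ₗ f i

theorem totalMap_incl (f : ∀ i, D.V i →ₗ[ℝ] D'.V i) (i : ℤ) (X : D.V i) :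
    totalMap f (D.incl i X) = D'.incl i (f i X) :=
  DirectSum.toModule_lof (M := D.V) ℝ i X

theorem comp_totalMap (f : ∀ i, D.V i →ₗ[ℝ] D'.V i) (i : ℤ) (X : D.Total) :
    D'.comp i (totalMap f X) = f i (D.comp i X) := by
  induction X using D.total_induction with
  | h0 => simp
  | ha X Y hX hY => simp [hX, hY]
  | hi j X =>
    rw [totalMap_incl]
    rcases eq_or_ne j i with rfl | h
    · rw [comp_incl_self, comp_incl_self]
    · rw [comp_incl_of_ne D' h, comp_incl_of_ne D h, map_zero]

theorem totalMap_injective {f : ∀ i, D.V i →ₗ[ℝ] D'.V i} (hf : ∀ i, Function.Injective (f i)) :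
    Function.Injective (totalMap f) := by
  intro X Y h
  refine DFinsupp.ext fun i => hf i ?_
  have := congrArg (D'.comp i) h
  rwa [comp_totalMap, comp_totalMap] at this

/-- Linear maps of the components that respect the brackets give a homomorphism of Lie algebras. -/
def totalLieHom (f : ∀ i, D.V i →ₗ[ℝ] D'.V i)
    (hf : ∀ i j (X : D.V i) (Y : D.V j), f (i + j) (D.br i j X Y) = D'.br i j (f i X) (f j Y)) :
    D.Total →ₗ⁅ℝ⁆ D'.Total :=
  { totalMap f with
    map_lie' := fun {X Y} => by
      change totalMap f ⁅X, Y⁆ = ⁅totalMap f X, totalMap f Y⁆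
      induction X using D.total_induction with
      | h0 => simp
      | ha X X' hX hX' => rw [add_lie, map_add, map_add, add_lie, hX, hX']
      | hi i X =>
        induction Y using D.total_induction with
        | h0 => simp
        | ha Y Y' hY hY' => rw [lie_add, map_add, map_add, lie_add, hY, hY']
        | hi j Y => rw [lie_incl, totalMap_incl, totalMap_incl, totalMap_incl, lie_incl, hf] }

end GradedLieAlg

namespace IsGradedPair

variable {L : Type*} [LieRing L] [LieAlgebra ℝ L] {F N : ℤ → Submodule ℝ L}

/-- The class of degree `i` of an element of `F i`, in the total graded Lie algebra. -/
def totalProj (h : IsGradedPair F N) (i : ℤ) : F i →ₗ[ℝ] h.toGraded.Total :=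
  h.toGraded.incl i ∘ₗ h.proj i

theorem proj_surjective (h : IsGradedPair F N) (i : ℤ) : Function.Surjective (h.proj i) :=
  Submodule.Quotient.mk_surjective _

theorem proj_eq_zero_iff (h : IsGradedPair F N) {i : ℤ} (x : F i) : h.proj i x = 0 ↔ (x : L) ∈ N i :=
  Submodule.Quotient.mk_eq_zero _

theorem totalProj_congr (h : IsGradedPair F N) {i j : ℤ} (e : i = j) (x : F i) (y : F j)
    (hxy : (x : L) = y) : h.totalProj i x = h.totalProj j y := by
  subst e
  rw [Subtype.ext hxy]

theorem lie_totalProj (h : IsGradedPair F N) {i j : ℤ} (x : F i) (y : F j) :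
    ⁅h.totalProj i x, h.totalProj j y⁆ =
      h.totalProj (i + j) ⟨⁅(x : L), (y : L)⁆, h.lie_mem i j x x.2 y y.2⟩ :=
  h.toGraded.lie_incl i j _ _

theorem totalProj_eq_zero (h : IsGradedPair F N) {i : ℤ} (x : F i) (hx : (x : L) ∈ N i) :
    h.totalProj i x = 0 := by
  rw [totalProj, LinearMap.comp_apply, (h.proj_eq_zero_iff _).2 hx, map_zero]

end IsGradedPair

/-! ### The symbol of a section of the weak derived flag -/

namespace TangentDistribution

variable {E : Type*} [NormedAddCommGroup E] [NormedSpace ℝ E]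
  {M : Type*} [TopologicalSpace M] [ChartedSpace E M] [IsManifold 𝓘(ℝ, E) ∞ M]
  [FiniteDimensional ℝ E] (Δ : TangentDistribution E M) (x : M)

theorem isNegative_gnla : (Δ.gnla x).IsNegative := by
  intro i hi X
  obtain ⟨Y, rfl⟩ := (Δ.isGradedPair_symbol x).proj_surjective i X
  refine ((Δ.isGradedPair_symbol x).proj_eq_zero_iff _).2 ?_
  have h : Δ.sec x (-i).toNat = ⊥ := by rw [Int.toNat_of_nonpos (by omega)]; rfl
  rw [(Submodule.mem_bot ℝ).1 (h.le Y.2)]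
  exact zero_mem _

variable {x}

theorem symbol_eq_totalProj {s : ℕ} (Y : Δ.sec x s) {i : ℤ} (hi : i = -(s : ℤ))
    (Z : Δ.sec x (-i).toNat) (h : (Y : VGerm E x) = Z) :
    Δ.symbol x s Y = (Δ.isGradedPair_symbol x).totalProj i Z :=
  (Δ.isGradedPair_symbol x).totalProj_congr hi.symm _ _ h

theorem symbol_congr {s t : ℕ} (e : s = t) (Y : Δ.sec x s) (Z : Δ.sec x t)
    (h : (Y : VGerm E x) = Z) : Δ.symbol x s Y = Δ.symbol x t Z := by
  subst e
  rw [Subtype.ext h]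

theorem lie_symbol {s t : ℕ} (Y : Δ.sec x s) (Z : Δ.sec x t) :
    ⁅Δ.symbol x s Y, Δ.symbol x t Z⁆ =
      Δ.symbol x (s + t) ⟨⁅(Y : VGerm E x), (Z : VGerm E x)⁆, Δ.lie_mem_sec x Y.2 Z.2⟩ := by
  refine Eq.trans ((Δ.isGradedPair_symbol x).lie_totalProj _ _) ?_
  exact (Δ.symbol_eq_totalProj (s := s + t) (i := -(s : ℤ) + -(t : ℤ)) _ (by push_cast; ring) _ rfl).symm

theorem symbol_eq_zero {s : ℕ} (Y : Δ.sec x s) (hY : (Y : VGerm E x) ∈ Δ.symKer x s) :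
    Δ.symbol x s Y = 0 := by
  refine (Δ.isGradedPair_symbol x).totalProj_eq_zero _ ?_
  change (Y : VGerm E x) ∈ Δ.symKer x (- -(s : ℤ)).toNat
  rwa [neg_neg, Int.toNat_natCast]

theorem symbol_mem_piece {s : ℕ} (Y : Δ.sec x s) : Δ.symbol x s Y ∈ (Δ.gnla x).piece (-(s : ℤ)) :=
  (Δ.gnla x).incl_mem_piece _ _

theorem exists_symbol_eq {i : ℤ} {s : ℕ} (h : i = -(s : ℤ)) (X : (Δ.gnla x).V i) :
    ∃ Y : Δ.sec x s, Δ.symbol x s Y = (Δ.gnla x).incl i X := by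
  obtain ⟨Y, rfl⟩ := (Δ.isGradedPair_symbol x).proj_surjective i X
  have h' : (-i).toNat = s := by omega
  exact ⟨⟨Y, h' ▸ Y.2⟩, Δ.symbol_eq_totalProj _ h Y rfl⟩

theorem gnla_induction {p : (Δ.gnla x).Total → Prop} (h0 : p 0)
    (hs : ∀ s : ℕ, 1 ≤ s → ∀ Y : Δ.sec x s, p (Δ.symbol x s Y))
    (ha : ∀ a b, p a → p b → p (a + b)) (a : (Δ.gnla x).Total) : p a := by
  refine (Δ.isNegative_gnla x).induction h0 (fun i hi X => ?_) ha a
  obtain ⟨Y, hY⟩ := Δ.exists_symbol_eq (s := (-i).toNat) (by omega) X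
  rw [← hY]
  exact hs _ (by omega) Y

variable (x) in
theorem isFundamental_gnla : (Δ.gnla x).IsFundamental := by
  intro K hK
  have key : ∀ s : ℕ, 1 ≤ s → ∀ Y : Δ.sec x s, Δ.symbol x s Y ∈ K := by
    intro s
    induction s using Nat.strong_induction_on with
    | _ s ih =>
      match s with
      | 0 => intro h; omega
      | 1 => exact fun _ Y => hK _
      | s + 2 =>
        intro _
        have h := Δ.sec_induction (x := x) (s := s) (N := Submodule.map (Δ.sec x (s + 2)).subtype
          (K.toSubmodule.comap (Δ.symbol x (s + 2)))) (fun b hb => ?_) (fun a ha b hb => ?_)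
        · intro Y
          obtain ⟨Z, hZ, hZY⟩ := h Y.2
          rwa [← Subtype.ext hZY]
        · refine ⟨⟨b, Δ.sec_mono x (by omega) hb⟩, ?_, rfl⟩
          change Δ.symbol x (s + 2) _ ∈ K
          rw [symbol_eq_zero]
          · exact zero_mem _
          · exact Submodule.mem_sup_left hb
        · refine ⟨⟨⁅a, b⁆, Δ.lie_mem_sec_succ x ha hb⟩, ?_, rfl⟩
          change Δ.symbol x (s + 2) _ ∈ K
          have := K.lie_mem (ih 1 (by omega) le_rfl ⟨a, ha⟩) (ih (s + 1) (by omega) (by omega) ⟨b, hb⟩)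
          rw [lie_symbol] at this
          rwa [Δ.symbol_congr (t := 1 + (s + 1)) (by ring)]
          rfl
  rw [eq_top_iff]
  rintro X -
  induction X using Δ.gnla_induction with
  | h0 => exact zero_mem _
  | ha X Y hX hY => exact add_mem hX hY
  | hs s h Y => exact key s h Y

/-! ### The symbol of a vector field -/

theorem exists_linearMap_map_apply_eq {V W : Type*} [AddCommGroup V] [Module ℝ V] [AddCommGroup W]
    [Module ℝ W] (f : V →ₗ[ℝ] W) (S : Submodule ℝ V) :
    ∃ r : S.map f →ₗ[ℝ] S, ∀ v, f (r v) = v := by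
  obtain ⟨r, hr⟩ := (f.submoduleMap S).exists_rightInverse_of_surjective
    (LinearMap.range_eq_top.2 (LinearMap.submoduleMap_surjective _ _))
  exact ⟨r, fun v => congrArg Subtype.val (LinearMap.congr_fun hr v)⟩

theorem ev_fsmul (f : M → ℝ) (hf : SmoothFunNear E x f) (a : VGerm E x) :
    VGerm.ev x (VGerm.fsmul f hf a) = f x • VGerm.ev x a := by
  obtain ⟨X, hX, rfl⟩ := VGerm.exists_of a
  rfl

theorem ev_symKer_mem_flag {s : ℕ} {a : VGerm E x} (ha : a ∈ Δ.symKer x s) :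
    VGerm.ev x a ∈ Δ.flag x (s - 1) := by
  have h : Δ.symKer x s ≤ (Δ.flag x (s - 1)).comap (VGerm.ev x) := by
    refine sup_le (fun b hb => ⟨b, hb, rfl⟩) (Submodule.span_le.2 ?_)
    rintro _ ⟨f, hf, h0, b, -, rfl⟩
    change VGerm.ev x (VGerm.fsmul f hf b) ∈ Δ.flag x (s - 1)
    rw [ev_fsmul, h0, zero_smul]
    exact zero_mem _
  exact h ha

variable (x) in
/-- The class in `𝔤ᵢ` of a section of `Δ_{-i}`. -/
def secClass (i : ℤ) : Δ.sec x (-i).toNat →ₗ[ℝ] (Δ.gnla x).V i := (Δ.isGradedPair_symbol x).proj i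

theorem secClass_surjective (i : ℤ) : Function.Surjective (Δ.secClass x i) :=
  Submodule.Quotient.mk_surjective _

theorem secClass_eq_zero_iff {i : ℤ} (Y : Δ.sec x (-i).toNat) :
    Δ.secClass x i Y = 0 ↔ (Y : VGerm E x) ∈ Δ.symKer x (-i).toNat :=
  Submodule.Quotient.mk_eq_zero _

/-- Regularity makes the class in `𝔤ᵢ` of a section of `Δ_{-i}` depend only on its value at `x`. -/
theorem exists_tangentSymbol (x : M) (hreg : Δ.IsRegular) (i : ℤ) :
    ∃ g : Δ.flag x (-i).toNat →ₗ[ℝ] (Δ.gnla x).V i,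
      (∀ (Y : Δ.sec x (-i).toNat) (v : Δ.flag x (-i).toNat), VGerm.ev x (Y : VGerm E x) = v →
        g v = Δ.secClass x i Y) ∧
      ∀ v : Δ.flag x (-i).toNat, g v = 0 ↔
        (v : TangentSpace 𝓘(ℝ, E) x) ∈ Δ.flag x (-(i + 1)).toNat := by
  obtain ⟨r, hr'⟩ : ∃ r : Δ.flag x (-i).toNat →ₗ[ℝ] Δ.sec x (-i).toNat,
      ∀ v, VGerm.ev x (r v : VGerm E x) = v :=
    exists_linearMap_map_apply_eq (VGerm.ev x) (Δ.sec x (-i).toNat)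
  have hi : (-(i + 1)).toNat = (-i).toNat - 1 := by omega
  refine ⟨Δ.secClass x i ∘ₗ r, fun Y v h => ?_, fun v => ?_⟩
  · rw [LinearMap.comp_apply, ← sub_eq_zero, ← map_sub, secClass_eq_zero_iff]
    refine Δ.mem_symKer_of_ev_mem x hreg (r v - Y).2 ?_
    rw [Submodule.coe_sub, map_sub, hr', h, sub_self]
    exact zero_mem _
  · rw [LinearMap.comp_apply, secClass_eq_zero_iff, hi]
    refine ⟨fun h => ?_, fun h => Δ.mem_symKer_of_ev_mem x hreg (r v).2 ?_⟩
    · have := Δ.ev_symKer_mem_flag h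
      rwa [hr'] at this
    · rwa [hr']

/-- The class in `𝔤ᵢ` of a tangent vector in `Δ_{-i}(x)`. -/
def tangentSymbol (x : M) (hreg : Δ.IsRegular) (i : ℤ) : Δ.flag x (-i).toNat →ₗ[ℝ] (Δ.gnla x).V i :=
  (Δ.exists_tangentSymbol x hreg i).choose

theorem tangentSymbol_eq (hreg : Δ.IsRegular) {i : ℤ} (Y : Δ.sec x (-i).toNat)
    (v : Δ.flag x (-i).toNat) (h : VGerm.ev x (Y : VGerm E x) = v) :
    Δ.tangentSymbol x hreg i v = Δ.secClass x i Y :=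
  (Δ.exists_tangentSymbol x hreg i).choose_spec.1 Y v h

theorem tangentSymbol_eq_zero_iff (hreg : Δ.IsRegular) {i : ℤ} (v : Δ.flag x (-i).toNat) :
    Δ.tangentSymbol x hreg i v = 0 ↔
      (v : TangentSpace 𝓘(ℝ, E) x) ∈ Δ.flag x (-(i + 1)).toNat :=
  (Δ.exists_tangentSymbol x hreg i).choose_spec.2 v

/-- The associated graded Lie algebra of the germs of vector fields, filtered by weight. The fields of
weight at least `i` are `wtFields (-i)`. -/
def wtGr (x : M) (hreg : Δ.IsRegular) (hnh : Δ.IsCompletelyNonholonomic) : GradedLieAlg :=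
  (Δ.isLieFiltration_wtFields (x := x) hreg hnh).gr

/-- The class in degree `i` of a vector field of weight at least `i`. -/
def wtClass (x : M) (hreg : Δ.IsRegular) (hnh : Δ.IsCompletelyNonholonomic) (i : ℤ) :
    Δ.wtFields x (-i) →ₗ[ℝ] (Δ.wtGr x hreg hnh).V i :=
  (Δ.isLieFiltration_wtFields (x := x) hreg hnh).cls i

section

variable {hreg : Δ.IsRegular} {hnh : Δ.IsCompletelyNonholonomic}

theorem wtClass_surjective (i : ℤ) : Function.Surjective (Δ.wtClass x hreg hnh i) :=
  Submodule.Quotient.mk_surjective _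

theorem wtClass_eq_zero_iff {i : ℤ} (u : Δ.wtFields x (-i)) :
    Δ.wtClass x hreg hnh i u = 0 ↔ (u : VGerm E x) ∈ Δ.wtFields x (-(i + 1)) :=
  Submodule.Quotient.mk_eq_zero _

theorem br_wtClass {i j : ℤ} (u : Δ.wtFields x (-i)) (v : Δ.wtFields x (-j))
    (w : Δ.wtFields x (-(i + j))) (h : (w : VGerm E x) = ⁅(u : VGerm E x), (v : VGerm E x)⁆) :
    (Δ.wtGr x hreg hnh).br i j (Δ.wtClass x hreg hnh i u) (Δ.wtClass x hreg hnh j v) =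
      Δ.wtClass x hreg hnh (i + j) w := by
  obtain ⟨w, hw⟩ := w
  subst h
  rfl

theorem br_secClass {i j : ℤ} (Y : Δ.sec x (-i).toNat) (Z : Δ.sec x (-j).toNat)
    (W : Δ.sec x (-(i + j)).toNat) (h : (W : VGerm E x) = ⁅(Y : VGerm E x), (Z : VGerm E x)⁆) :
    (Δ.gnla x).br i j (Δ.secClass x i Y) (Δ.secClass x j Z) = Δ.secClass x (i + j) W := by
  obtain ⟨W, hW⟩ := W
  subst h
  rfl

theorem symKer_le_wtFields {i : ℤ} : Δ.symKer x (-i).toNat ≤ Δ.wtFields x (-(i + 1)) := by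
  rcases le_or_gt 0 i with h | h
  · rw [Int.toNat_of_nonpos (by omega), symKer_zero]
    exact bot_le
  · refine sup_le ?_ (Submodule.span_le.2 ?_)
    · rw [show (-i).toNat - 1 = (-(i + 1)).toNat by omega]
      exact Δ.sec_toNat_le_wtFields _
    · rintro _ ⟨f, hf, h0, a, ha, rfl⟩
      refine Δ.wtSec_le_wtFields _ (Δ.mul_mem_wtSec ha (n := 1) ?_ (by omega))
      refine Δ.mem_ordOps_succ.2 ⟨fsmul_mem_mulOps f hf, fun b => ?_, fun z _ => ?_⟩
      · rw [ev_fsmul, h0, zero_smul]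
      · exact der_mem_mulOps z (fsmul_mem_mulOps f hf)

/-- A section of `Δ_{-i}` as a vector field of weight `i`. -/
def fieldOfSymbol (x : M) (hreg : Δ.IsRegular) (hnh : Δ.IsCompletelyNonholonomic) (i : ℤ) :
    (Δ.gnla x).V i →ₗ[ℝ] (Δ.wtGr x hreg hnh).V i :=
  Submodule.mapQ _ _ (Submodule.inclusion (Δ.sec_toNat_le_wtFields (-i)))
    fun _ hY => Δ.symKer_le_wtFields hY

theorem fieldOfSymbol_proj (i : ℤ) (Y : Δ.sec x (-i).toNat) :
    Δ.fieldOfSymbol x hreg hnh i (Δ.secClass x i Y) =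
      Δ.wtClass x hreg hnh i
        ⟨Y, Δ.sec_toNat_le_wtFields (-i) Y.2⟩ := rfl

variable (x hreg hnh) in
/-- The Lie algebra homomorphism from `𝔪_x` to the graded Lie algebra of vector fields. -/
def fieldHom : (Δ.gnla x).Total →ₗ⁅ℝ⁆ (Δ.wtGr x hreg hnh).Total :=
  GradedLieAlg.totalLieHom (Δ.fieldOfSymbol x hreg hnh) fun i j X Y => by
    obtain ⟨X, rfl⟩ := Δ.secClass_surjective i X
    obtain ⟨Y, rfl⟩ := Δ.secClass_surjective j Y
    rfl

theorem fieldHom_incl (i : ℤ) (X : (Δ.gnla x).V i) :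
    Δ.fieldHom x hreg hnh ((Δ.gnla x).incl i X) =
      (Δ.wtGr x hreg hnh).incl i (Δ.fieldOfSymbol x hreg hnh i X) :=
  GradedLieAlg.totalMap_incl _ i X

theorem fieldHom_symbol {s : ℕ} (Y : Δ.sec x s) {i : ℤ} (hi : i = -(s : ℤ))
    (u : Δ.wtFields x (-i)) (hu : (u : VGerm E x) = Y) :
    Δ.fieldHom x hreg hnh (Δ.symbol x s Y) = (Δ.wtGr x hreg hnh).incl i (Δ.wtClass x hreg hnh i u) := by
  subst hi
  refine (Δ.fieldHom_incl _ _).trans ?_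
  rw [show u = ⟨Y, hu ▸ u.2⟩ from Subtype.ext hu]
  rfl

variable (x hreg hnh) in
/-- The value at `x` of a vector field of weight `i`, in `𝔤ᵢ`. -/
def fieldValue (i : ℤ) : (Δ.wtGr x hreg hnh).V i →ₗ[ℝ] (Δ.gnla x).V i :=
  Submodule.liftQ _ (Δ.tangentSymbol x hreg i ∘ₗ
    LinearMap.codRestrict _ (VGerm.ev x ∘ₗ (Δ.wtFields x (-i)).subtype) fun u => u.2.1) fun _ hu =>
      (Δ.tangentSymbol_eq_zero_iff hreg _).2 (Submodule.mem_comap.1 hu).1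

theorem fieldValue_proj {i : ℤ} (u : Δ.wtFields x (-i)) (Y : Δ.sec x (-i).toNat)
    (h : VGerm.ev x (Y : VGerm E x) = VGerm.ev x (u : VGerm E x)) :
    Δ.fieldValue x hreg hnh i
      (Δ.wtClass x hreg hnh i u) =
      Δ.secClass x i Y :=
  Δ.tangentSymbol_eq hreg Y _ h

theorem fieldValue_proj_eq_zero_iff {i : ℤ} (u : Δ.wtFields x (-i)) :
    Δ.fieldValue x hreg hnh i
      (Δ.wtClass x hreg hnh i u) = 0 ↔
      VGerm.ev x (u : VGerm E x) ∈ Δ.flag x (-(i + 1)).toNat :=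
  Δ.tangentSymbol_eq_zero_iff hreg _

/-- The value of a commutator is determined by the values of the two fields and by the commutators
of each of them with sections of the weak derived flag. -/
theorem fieldValue_br (i j : ℤ) (a : (Δ.wtGr x hreg hnh).V i) (b : (Δ.wtGr x hreg hnh).V j) :
    Δ.fieldValue x hreg hnh (i + j) ((Δ.wtGr x hreg hnh).br i j a b) =
      Δ.fieldValue x hreg hnh (i + j) ((Δ.wtGr x hreg hnh).br i j a
        (Δ.fieldOfSymbol x hreg hnh j (Δ.fieldValue x hreg hnh j b))) +
      Δ.fieldValue x hreg hnh (i + j) ((Δ.wtGr x hreg hnh).br i j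
        (Δ.fieldOfSymbol x hreg hnh i (Δ.fieldValue x hreg hnh i a)) b) -
      (Δ.gnla x).br i j (Δ.fieldValue x hreg hnh i a) (Δ.fieldValue x hreg hnh j b) := by
  obtain ⟨u, rfl⟩ := Δ.wtClass_surjective i a
  obtain ⟨v, rfl⟩ := Δ.wtClass_surjective j b
  obtain ⟨Y, hY, hYu⟩ := u.2.1
  obtain ⟨Z, hZ, hZv⟩ := v.2.1
  have hY' := Δ.sec_toNat_le_wtFields _ hY
  have hZ' := Δ.sec_toNat_le_wtFields _ hZ
  have h : ∀ {p q : VGerm E x}, p ∈ Δ.wtFields x (-i) → q ∈ Δ.wtFields x (-j) →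
      ⁅p, q⁆ ∈ Δ.wtFields x (-(i + j)) := fun hp hq => by
    rw [neg_add]; exact Δ.lie_mem_wtFields hreg hnh hp hq
  have hYZ := (Δ.isGradedPair_symbol x).lie_mem i j Y hY Z hZ
  rw [Δ.fieldValue_proj u ⟨Y, hY⟩ hYu, Δ.fieldValue_proj v ⟨Z, hZ⟩ hZv, fieldOfSymbol_proj,
    fieldOfSymbol_proj, Δ.br_wtClass u v ⟨_, h u.2 v.2⟩ rfl, Δ.br_wtClass u _ ⟨_, h u.2 hZ'⟩ rfl,
    Δ.br_wtClass _ v ⟨_, h hY' v.2⟩ rfl, Δ.br_secClass _ _ ⟨_, hYZ⟩ rfl,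
    ← Δ.fieldValue_proj (hreg := hreg) (hnh := hnh) ⟨_, h hY' hZ'⟩ ⟨_, hYZ⟩ rfl, ← sub_eq_zero,
    ← map_add, ← map_sub, ← map_sub, ← map_add, ← map_sub, ← map_sub, fieldValue_proj_eq_zero_iff]
  have h0 := Δ.ev_lie_eq_zero x hreg hnh (a := (u : VGerm E x) - Y) (b := (v : VGerm E x) - Z)
    (by rw [map_sub, hYu, sub_self]) (by rw [map_sub, hZv, sub_self])
  have key : ∀ p, p = ⁅(u : VGerm E x) - Y, (v : VGerm E x) - Z⁆ →
      VGerm.ev x p ∈ Δ.flag x (-(i + j + 1)).toNat := by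
    rintro _ rfl
    rw [h0]
    exact zero_mem _
  refine key _ ?_
  simp only [Submodule.coe_sub, Submodule.coe_add, lie_sub, sub_lie]
  abel

end

end TangentDistribution

/-! ### The symbol as a formal vector field on the group of `𝔪_x` -/

namespace Coind

open GradedLieAlg

universe v v'

variable {D : GradedLieAlg.{v}} {D' : GradedLieAlg.{v'}}

theorem isHomog_lift (f : ∀ i, D.V i →ₗ[ℝ] D'.V i) (g : ∀ i, D'.V i →ₗ[ℝ] D.V i)
    (j : D.Total →ₗ⁅ℝ⁆ D'.Total) (hj : ∀ i X, j (D.incl i X) = D'.incl i (f i X)) (i : ℤ) (a : D'.V i) :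
    IsHomog i (lift j (totalMap g) (D'.incl i a)) := fun l => by
  induction l generalizing i a with
  | nil =>
    rw [show i + degSum ([] : List (Σ n, D.V n)) = i from add_zero i]
    exact ⟨g i a, (totalMap_incl g i a).symm⟩
  | cons p l ih =>
    rw [show p = ⟨p.1, p.2⟩ from rfl, degSum_cons, ← add_assoc, homogList_cons, lift_cons, hj, lie_incl]
    exact ih _ _

end Coind

open GradedLieAlg

namespace TangentDistribution

variable {E : Type*} [NormedAddCommGroup E] [NormedSpace ℝ E]
  {M : Type*} [TopologicalSpace M] [ChartedSpace E M] [IsManifold 𝓘(ℝ, E) ∞ M]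
  [FiniteDimensional ℝ E] (Δ : TangentDistribution E M) (x : M)
  (hreg : Δ.IsRegular) (hnh : Δ.IsCompletelyNonholonomic)

/-- The homomorphism from the graded Lie algebra of vector fields, filtered by weight, to the formal
vector fields on the group of `𝔪_x`. -/
def grSymbol : (Δ.wtGr x hreg hnh).Total →ₗ[ℝ] Coind (Δ.gnla x).Total :=
  Coind.lift (Δ.fieldHom x hreg hnh) (totalMap (Δ.fieldValue x hreg hnh))

theorem grSymbol_lie (a b : (Δ.wtGr x hreg hnh).Total) :
    Δ.grSymbol x hreg hnh ⁅a, b⁆ = ⁅Δ.grSymbol x hreg hnh a, Δ.grSymbol x hreg hnh b⁆ := by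
  refine Coind.lift_lie _ _ (fun a b => ?_) a b
  induction a using (Δ.wtGr x hreg hnh).total_induction with
  | h0 => simp
  | ha a a' ha ha' => simp only [add_lie, map_add, ha, ha']; abel
  | hi i a =>
    induction b using (Δ.wtGr x hreg hnh).total_induction with
    | h0 => simp
    | ha b b' hb hb' => simp only [lie_add, map_add, hb, hb']; abel
    | hi j b =>
      simp only [lie_incl, totalMap_incl, fieldHom_incl]
      rw [fieldValue_br, map_sub, map_add]

/-- The symbol of degree `i` of a vector field of weight `i`, a formal vector field on the group
of `𝔪_x`. -/
def fieldSymbol (i : ℤ) : Δ.wtFields x (-i) →ₗ[ℝ] Coind (Δ.gnla x).Total :=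
  Δ.grSymbol x hreg hnh ∘ₗ (Δ.wtGr x hreg hnh).incl i ∘ₗ Δ.wtClass x hreg hnh i

variable {x hreg hnh}

theorem fieldSymbol_eq_zero {i : ℤ} (u : Δ.wtFields x (-i))
    (hu : (u : VGerm E x) ∈ Δ.wtFields x (-(i + 1))) : Δ.fieldSymbol x hreg hnh i u = 0 := by
  rw [fieldSymbol, LinearMap.comp_apply, LinearMap.comp_apply, (Δ.wtClass_eq_zero_iff u).2 hu,
    map_zero, map_zero]

theorem fieldSymbol_congr {i j : ℤ} (e : i = j) (u : Δ.wtFields x (-i)) (v : Δ.wtFields x (-j))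
    (h : (u : VGerm E x) = v) : Δ.fieldSymbol x hreg hnh i u = Δ.fieldSymbol x hreg hnh j v := by
  subst e
  rw [Subtype.ext h]

theorem isHomog_fieldSymbol {i : ℤ} (u : Δ.wtFields x (-i)) :
    Coind.IsHomog i (Δ.fieldSymbol x hreg hnh i u) :=
  Coind.isHomog_lift _ _ _ Δ.fieldHom_incl i _

theorem fieldSymbol_lie {i j k : ℤ} (hk : k = i + j) (u : Δ.wtFields x (-i)) (v : Δ.wtFields x (-j))
    (w : Δ.wtFields x (-k)) (h : (w : VGerm E x) = ⁅(u : VGerm E x), (v : VGerm E x)⁆) :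
    Δ.fieldSymbol x hreg hnh k w =
      ⁅Δ.fieldSymbol x hreg hnh i u, Δ.fieldSymbol x hreg hnh j v⁆ := by
  subst hk
  simp only [fieldSymbol, LinearMap.comp_apply]
  rw [← grSymbol_lie, lie_incl, Δ.br_wtClass u v w h]

theorem act_fieldSymbol {i k : ℤ} {s : ℕ} (hk : k = i - s) (u : Δ.wtFields x (-i)) (Y : Δ.sec x s)
    (w : Δ.wtFields x (-k)) (h : (w : VGerm E x) = ⁅(u : VGerm E x), (Y : VGerm E x)⁆) :
    Coind.act (Δ.fieldSymbol x hreg hnh i u) (Δ.symbol x s Y) = Δ.fieldSymbol x hreg hnh k w := by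
  have hY : (Y : VGerm E x) ∈ Δ.wtFields x (- -(s : ℤ)) := by
    rw [neg_neg]
    exact Δ.sec_toNat_le_wtFields (s : ℤ) (by simp)
  obtain rfl : k = i + -(s : ℤ) := by omega
  simp only [fieldSymbol, LinearMap.comp_apply]
  rw [grSymbol, Coind.act_lift, Δ.fieldHom_symbol Y rfl ⟨Y, hY⟩ rfl, lie_incl,
    Δ.br_wtClass u ⟨Y, hY⟩ w h]

/-- The value of the symbol at the origin is the class of the value of the field. -/
theorem fieldSymbol_nil {i : ℤ} {s : ℕ} (hi : i = -(s : ℤ)) (u : Δ.wtFields x (-i)) (Y : Δ.sec x s)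
    (h : VGerm.ev x (Y : VGerm E x) = VGerm.ev x (u : VGerm E x)) :
    (Δ.fieldSymbol x hreg hnh i u).1 [] = Δ.symbol x s Y := by
  have hs : (-i).toNat = s := by omega
  refine (totalMap_incl _ i _).trans ?_
  rw [Δ.fieldValue_proj u ⟨Y, hs ▸ Y.2⟩ h]
  exact (Δ.symbol_eq_totalProj Y hi ⟨Y, hs ▸ Y.2⟩ rfl).symm

theorem fieldSymbol_nil_eq_zero_iff {i : ℤ} (u : Δ.wtFields x (-i)) :
    (Δ.fieldSymbol x hreg hnh i u).1 [] = 0 ↔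
      VGerm.ev x (u : VGerm E x) ∈ Δ.flag x (-(i + 1)).toNat := by
  rw [← Δ.fieldValue_proj_eq_zero_iff (hreg := hreg) (hnh := hnh) u,
    ← ((Δ.gnla x).incl_injective i).eq_iff, map_zero]
  exact iff_of_eq (congrArg (· = 0) (totalMap_incl _ i _))

/-! ### Symbols of sections of `Δ` are horizontal -/

theorem ordOps_apply_mem_wtFields {m : ℤ} {s : ℕ} {φ : Module.End ℝ (VGerm E x)}
    (hφ : φ ∈ Δ.ordOps x m.toNat) {a : VGerm E x} (ha : a ∈ Δ.sec x s) :
    φ a ∈ Δ.wtFields x (-(m - s)) :=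
  Δ.wtSec_le_wtFields _ (Δ.mul_mem_wtSec ha hφ (by omega))

variable (hreg hnh) in
/-- The symbol of degree `m - s` of the section `φ a` of `Δ_s`, where the function `φ` vanishes to order
`m` and `a` is a section of `Δ_s`. -/
def mulSymbol (m : ℤ) (s : ℕ) (φ : Δ.ordOps x m.toNat) (a : Δ.sec x s) : Coind (Δ.gnla x).Total :=
  Δ.fieldSymbol x hreg hnh (m - s) ⟨φ.1 a, Δ.ordOps_apply_mem_wtFields φ.2 a.2⟩

/-- The bracket of a section of `Δ_s` with a section of `Δ_t`, as a section of `Δ_{s+t}`. -/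
def secLie {s t : ℕ} (a : Δ.sec x s) (Y : Δ.sec x t) : Δ.sec x (s + t) :=
  ⟨⁅(a : VGerm E x), (Y : VGerm E x)⁆, Δ.lie_mem_sec x a.2 Y.2⟩

/-- The derivative along a section of `Δ_t` of a function vanishing to order `m`. -/
def ordDer {m : ℤ} {t : ℕ} (φ : Δ.ordOps x m.toNat) (Y : Δ.sec x t) : Δ.ordOps x (m - t).toNat :=
  ⟨der Y φ.1, Δ.ordOps_antitone (by omega) (Δ.der_mem_ordOps_of_sec φ.2 Y.2)⟩

theorem act_mulSymbol {m : ℤ} {s t : ℕ} (φ : Δ.ordOps x m.toNat) (a : Δ.sec x s) (Y : Δ.sec x t) :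
    Coind.act (Δ.mulSymbol hreg hnh m s φ a) (Δ.symbol x t Y) =
      Δ.mulSymbol hreg hnh m (s + t) φ (Δ.secLie a Y) -
        Δ.mulSymbol hreg hnh (m - t) s (Δ.ordDer φ Y) a := by
  have e1 : -(m - ((s + t : ℕ) : ℤ)) = -(m - s - t) := by push_cast; ring
  have e2 : -(m - t - s) = -(m - (s : ℤ) - t) := by ring
  have h1 : φ.1 ⁅(a : VGerm E x), (Y : VGerm E x)⁆ ∈ Δ.wtFields x (-(m - s - t)) :=
    e1 ▸ Δ.ordOps_apply_mem_wtFields φ.2 (Δ.secLie a Y).2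
  have h2 : der (Y : VGerm E x) φ.1 a ∈ Δ.wtFields x (-(m - s - t)) :=
    e2 ▸ Δ.ordOps_apply_mem_wtFields (Δ.ordDer φ Y).2 a.2
  have h : ⁅φ.1 (a : VGerm E x), (Y : VGerm E x)⁆ = φ.1 ⁅(a : VGerm E x), (Y : VGerm E x)⁆ -
      der (Y : VGerm E x) φ.1 a := mul_lie _ _ _
  rw [mulSymbol, Δ.act_fieldSymbol (k := m - s - t) rfl _ Y (⟨_, h1⟩ - ⟨_, h2⟩) h.symm, map_sub]
  congr 1
  · exact Δ.fieldSymbol_congr (by push_cast; ring) _ _ rfl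
  · exact Δ.fieldSymbol_congr (by ring) _ _ rfl

theorem exists_mulSymbol_nil {m : ℤ} (φ : Δ.ordOps x m.toNat) : ∃ r : ℝ, ∀ (s : ℕ) (a : Δ.sec x s),
    (Δ.mulSymbol hreg hnh m s φ a).1 [] = r • Δ.symbol x s a := by
  rcases lt_trichotomy m 0 with h | rfl | h
  · refine ⟨0, fun s a => ?_⟩
    rw [mulSymbol, fieldSymbol_eq_zero, zero_smul]
    · rfl
    · refine Δ.wtSec_le_wtFields _ (Δ.mul_mem_wtSec a.2 (n := 0) (Δ.mem_mulOps_of_mem_ordOps φ.2) ?_)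
      omega
  · obtain ⟨r, hr⟩ := exists_ev_mulOps (Δ.mem_mulOps_of_mem_ordOps φ.2)
    refine ⟨r, fun s a => ?_⟩
    rw [mulSymbol, Δ.fieldSymbol_nil (zero_sub (s : ℤ)) _ (r • a), map_smul]
    rw [Submodule.coe_smul, map_smul]
    exact (hr a).symm
  · refine ⟨0, fun s a => ?_⟩
    rw [zero_smul, mulSymbol, fieldSymbol_nil_eq_zero_iff]
    refine (Δ.ev_ordOps ?_ φ.2 (a : VGerm E x)).symm ▸ zero_mem _
    omega

/-- The values of the symbol of `φ a` lie in degrees at most `-s`. -/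
theorem proj_mulSymbol_eq_zero {m : ℤ} {s : ℕ} (φ : Δ.ordOps x m.toNat) (a : Δ.sec x s) {k : ℤ}
    (hk : -(s : ℤ) < k) (l : List (Δ.gnla x).Total) :
    (Δ.gnla x).proj k ((Δ.mulSymbol hreg hnh m s φ a).1 l) = 0 := by
  induction l generalizing m s φ a with
  | nil =>
    obtain ⟨r, hr⟩ := Δ.exists_mulSymbol_nil (hreg := hreg) (hnh := hnh) φ
    rw [hr, map_smul, (Δ.gnla x).proj_eq_zero hk.ne (Δ.symbol_mem_piece a), smul_zero]
  | cons Y l ih =>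
    rw [← Coind.act_apply]
    induction Y using Δ.gnla_induction with
    | h0 => simp
    | ha Y Z hY hZ => rw [Coind.act_add, Submodule.coe_add, Pi.add_apply, map_add, hY, hZ, add_zero]
    | hs t ht Y =>
      rw [act_mulSymbol, Submodule.coe_sub, Pi.sub_apply, map_sub, ih _ _ (by omega), ih _ _ hk, sub_zero]

/-- The coefficient function of the symbol of `φ a` depends only on `φ`, and its derivatives are the
coefficient functions of the derivatives of `φ`. -/
theorem proj_mulSymbol_cons {m : ℤ} {s t : ℕ} (ht : 1 ≤ t) (φ : Δ.ordOps x m.toNat) (a : Δ.sec x s)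
    (Y : Δ.sec x t) (l : List (Δ.gnla x).Total) :
    (Δ.gnla x).proj (-s) ((Δ.mulSymbol hreg hnh m s φ a).1 (Δ.symbol x t Y :: l)) =
      - (Δ.gnla x).proj (-s) ((Δ.mulSymbol hreg hnh (m - t) s (Δ.ordDer φ Y) a).1 l) := by
  rw [← Coind.act_apply, act_mulSymbol, Submodule.coe_sub, Pi.sub_apply, map_sub,
    proj_mulSymbol_eq_zero Δ φ (Δ.secLie a Y) (by omega), zero_sub]

theorem lie_proj_mulSymbol {m : ℤ} {s t : ℕ} (φ : Δ.ordOps x m.toNat) (a : Δ.sec x s)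
    (Y : Δ.sec x t) (l : List (Δ.gnla x).Total) :
    ⁅(Δ.gnla x).proj (-s) ((Δ.mulSymbol hreg hnh m s φ a).1 l), Δ.symbol x t Y⁆ =
      (Δ.gnla x).proj (-(s + t : ℕ)) ((Δ.mulSymbol hreg hnh m (s + t) φ (Δ.secLie a Y)).1 l) := by
  induction l generalizing m φ with
  | nil =>
    obtain ⟨r, hr⟩ := Δ.exists_mulSymbol_nil (hreg := hreg) (hnh := hnh) φ
    rw [hr, hr, map_smul, map_smul, (Δ.gnla x).proj_eq_self (Δ.symbol_mem_piece a),
      (Δ.gnla x).proj_eq_self (Δ.symbol_mem_piece _), smul_lie, lie_symbol]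
    rfl
  | cons Z l ih =>
    rw [← Coind.act_apply, ← Coind.act_apply]
    induction Z using Δ.gnla_induction with
    | h0 => simp
    | ha Z W hZ hW =>
      simp only [Coind.act_add, Submodule.coe_add, Pi.add_apply, map_add, add_lie, hZ, hW]
    | hs k hk Z =>
      rw [Coind.act_apply, Coind.act_apply, Δ.proj_mulSymbol_cons hk, Δ.proj_mulSymbol_cons hk, neg_lie, ih]

/-- The symbol of `φ a` is the product of the symbol of `φ` with the left-invariant field given by
the symbol of `a`. -/
theorem expand_mulSymbol {m : ℤ} {s : ℕ} (φ : Δ.ordOps x m.toNat) (a : Δ.sec x s)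
    (l : List (Δ.gnla x).Total) :
    Coind.expand (fun l => (Δ.gnla x).proj (-s) ((Δ.mulSymbol hreg hnh m s φ a).1 l)) l =
      (Δ.mulSymbol hreg hnh m s φ a).1 l := by
  induction l generalizing m s φ a with
  | nil =>
    obtain ⟨r, hr⟩ := Δ.exists_mulSymbol_nil (hreg := hreg) (hnh := hnh) φ
    simp only [Coind.expand]
    rw [hr, map_smul, (Δ.gnla x).proj_eq_self (Δ.symbol_mem_piece a)]
  | cons Y l ih =>
    simp only [Coind.expand, ← Coind.act_apply]
    induction Y using Δ.gnla_induction with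
    | h0 => simp [Coind.expand_zero]
    | ha Y Z hY hZ =>
      simp only [Coind.act_add, Submodule.coe_add, Pi.add_apply, map_add, lie_add, Coind.expand_add,
        ← hY, ← hZ]
      abel
    | hs t ht Y =>
      simp only [Coind.act_apply, Δ.proj_mulSymbol_cons ht, Δ.lie_proj_mulSymbol, Coind.expand_neg, ih]
      rw [← Coind.act_apply, act_mulSymbol, Submodule.coe_sub, Pi.sub_apply]
      abel

/-- The symbol of a local symmetry is a symmetry of the left-invariant distribution on the group
of `𝔪_x`. -/
theorem isSymmetry_fieldSymbol {i : ℤ} {X : Δ.localSym x} (hX : X ∈ Δ.filtration x i)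
    (hX' : (X : VGerm E x) ∈ Δ.wtFields x (-i)) :
    Coind.IsSymmetry i (Δ.fieldSymbol x hreg hnh i ⟨X, hX'⟩) where
  homog := Δ.isHomog_fieldSymbol _
  horizontal Y := by
    obtain ⟨y, hy⟩ := Δ.exists_symbol_eq (s := 1) (by simp) Y
    obtain ⟨r, a, φ, ha, hφ, hsum⟩ := Δ.exists_sum_lie_eq hreg hX y.2
    have hk : ∀ k, φ k (a k) ∈ Δ.wtFields x (-(i - (1 : ℕ))) := fun k =>
      Δ.ordOps_apply_mem_wtFields (hφ k) (ha k)
    rw [← hy, Δ.act_fieldSymbol (k := i - (1 : ℕ)) rfl _ y (∑ k, ⟨φ k (a k), hk k⟩)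
      (by rw [hsum]; simp), map_sum]
    refine Finset.sum_induction _ Coind.IsHorizontal (fun _ _ => Coind.IsHorizontal.add)
      Coind.isHorizontal_zero fun k _ => funext fun l => ?_
    exact Δ.expand_mulSymbol (s := 1) ⟨φ k, hφ k⟩ ⟨a k, ha k⟩ l

end TangentDistribution

/-! ### Dimension of the completion of a filtered Lie algebra -/

namespace IsLieFiltration

universe u

variable {L : Type u} [LieRing L] [LieAlgebra ℝ L] {F : ℤ → Submodule ℝ L}

theorem cls_surjective (h : IsLieFiltration F) (i : ℤ) : Function.Surjective (h.cls i) :=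
  Submodule.Quotient.mk_surjective _

theorem cls_eq_zero_iff (h : IsLieFiltration F) {i : ℤ} (X : F i) :
    h.cls i X = 0 ↔ (X : L) ∈ F (i + 1) :=
  Submodule.Quotient.mk_eq_zero _

/-- The quotients of an exhaustive filtration are spanned by representatives of the classes in the
associated graded algebra. -/
theorem rank_quotient_le (h : IsLieFiltration F) {κ : ℕ} (hκ : F (-(κ : ℤ)) = ⊤) (n : ℕ) :
    Module.rank ℝ (L ⧸ F n) ≤ Module.rank ℝ h.gr.Total := by
  have hs : ∀ i, ∃ s : h.gr.V i →ₗ[ℝ] F i, h.cls i ∘ₗ s = LinearMap.id := fun i =>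
    (h.cls i).exists_rightInverse_of_surjective (LinearMap.range_eq_top.2 (h.cls_surjective i))
  choose s hs using hs
  let f : h.gr.Total →ₗ[ℝ] L ⧸ F n :=
    DirectSum.toModule ℝ ℤ _ fun i => (F n).mkQ ∘ₗ (F i).subtype ∘ₗ s i
  have hf : ∀ i a, f (h.gr.incl i a) = (F n).mkQ (s i a) := fun i a =>
    DirectSum.toModule_lof (M := h.gr.V) ℝ i a
  have key : ∀ k : ℕ, F (n - k) ≤ (LinearMap.range f).comap (F n).mkQ := by
    intro k
    induction k with
    | zero =>
      intro X hX
      rw [Nat.cast_zero, sub_zero] at hX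
      rw [Submodule.mem_comap, Submodule.mkQ_apply, (Submodule.Quotient.mk_eq_zero _).2 hX]
      exact zero_mem _
    | succ k ih =>
      intro X hX
      have h1 : h.cls _ (⟨X, hX⟩ - s _ (h.cls _ ⟨X, hX⟩)) = 0 := by
        rw [map_sub, sub_eq_zero]
        exact (LinearMap.congr_fun (hs _) _).symm
      rw [cls_eq_zero_iff, show (n : ℤ) - (k + 1 : ℕ) + 1 = n - k by push_cast; ring] at h1
      rw [← sub_add_cancel X (s _ (h.cls _ ⟨X, hX⟩) : L)]
      exact add_mem (ih h1) ⟨_, hf _ _⟩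
  refine LinearMap.rank_le_of_surjective f fun q => ?_
  obtain ⟨X, rfl⟩ := (F n).mkQ_surjective q
  refine key (n + κ) ?_
  rw [Nat.cast_add, sub_add_cancel_left, hκ]
  trivial

/-- The completion of a Lie algebra for an exhaustive filtration has at most the dimension of the
associated graded algebra. -/
theorem toENat_rank_limit_le (h : IsLieFiltration F) {κ : ℕ} (hκ : F (-(κ : ℤ)) = ⊤)
    (P : Submodule ℝ (∀ i : ℕ, L ⧸ F i))
    (hP : ∀ a ∈ P, ∀ i j : ℕ, ∀ e : i ≤ j,
      Submodule.factor (h.antitone (Int.ofNat_le.2 e)) (a j) = a i) :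
    Cardinal.toENat (Module.rank ℝ P) ≤ Cardinal.toENat (Module.rank ℝ h.gr.Total) := by
  rcases le_or_gt Cardinal.aleph0 (Module.rank ℝ h.gr.Total) with hinf | hfin
  · rw [Cardinal.toENat_eq_top.2 hinf]
    exact le_top
  have hfd : ∀ n : ℕ, Module.Finite ℝ (L ⧸ F n) := fun n =>
    Module.rank_lt_aleph0_iff.1 ((h.rank_quotient_le hκ n).trans_lt hfin)
  have hmono : ∀ n : ℕ, Module.finrank ℝ (L ⧸ F n) ≤ Module.finrank ℝ h.gr.Total := fun n =>
    Cardinal.toNat_le_toNat (h.rank_quotient_le hκ n) hfin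
  -- At an index where the dimension is maximal, the quotients become stationary.
  obtain ⟨n, hn⟩ : ∃ n : ℕ, ∀ j : ℕ, Module.finrank ℝ (L ⧸ F j) ≤ Module.finrank ℝ (L ⧸ F n) := by
    have hb : BddAbove (Set.range fun n : ℕ => Module.finrank ℝ (L ⧸ F n)) :=
      ⟨_, by rintro _ ⟨n, rfl⟩; exact hmono n⟩
    obtain ⟨n, hn⟩ := Nat.sSup_mem (Set.range_nonempty _) hb
    exact ⟨n, fun j => (le_csSup hb ⟨j, rfl⟩).trans hn.ge⟩
  refine OrderHomClass.mono Cardinal.toENat ((LinearMap.rank_le_of_injective (LinearMap.proj n ∘ₗ P.subtype) ?_).trans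
    (h.rank_quotient_le hκ n))
  rw [← LinearMap.ker_eq_bot, LinearMap.ker_eq_bot']
  intro a ha
  have ha : a.1 n = 0 := ha
  refine Subtype.ext (funext fun j => ?_)
  change a.1 j = 0
  rcases le_total j n with e | e
  · rw [← hP a a.2 j n e, ha, map_zero]
  · have hsurj : Function.Surjective (Submodule.factor (h.antitone (Int.ofNat_le.2 e))) :=
      Submodule.factor_surjective _
    have hinj := (LinearMap.injective_iff_surjective_of_finrank_eq_finrank
      (le_antisymm (hn j) (LinearMap.finrank_le_finrank_of_surjective hsurj))).2 hsurj
    refine hinj ?_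
    rw [hP a a.2 n j e, ha, map_zero]

end IsLieFiltration

/-! ### The embedding of the graded algebra of symmetries into the Tanaka algebra -/

open GradedLieAlg

namespace TangentDistribution

variable {E : Type*} [NormedAddCommGroup E] [NormedSpace ℝ E]
  {M : Type*} [TopologicalSpace M] [ChartedSpace E M] [IsManifold 𝓘(ℝ, E) ∞ M]
  [FiniteDimensional ℝ E] (Δ : TangentDistribution E M) (x : M)
  (hreg : Δ.IsRegular) (hnh : Δ.IsCompletelyNonholonomic)

/-- The symbol of degree `i` of a local symmetry of degree `i`. -/
def symSymbol (i : ℤ) : Δ.filtration x i →ₗ[ℝ] Coind (Δ.gnla x).Total :=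
  Δ.fieldSymbol x hreg hnh i ∘ₗ
    LinearMap.codRestrict _ ((Δ.localSym x).toSubmodule.subtype ∘ₗ (Δ.filtration x i).subtype)
      fun X => (Δ.mem_filtration_iff hreg).1 X.2

/-- The symbol of a local symmetry, turned into an element of the Tanaka algebra by inversion. -/
def prolOfSym (i : ℤ) : Δ.filtration x i →ₗ[ℝ] (Δ.tanaka x).V i :=
  LinearMap.codRestrict (prolGrade (Δ.gnla x) i)
    ((-1 : ℝ) ^ i • (Coind.inv ∘ₗ Δ.symSymbol x hreg hnh i)) fun X =>
      IsProl.smul _ _ ((Δ.isSymmetry_fieldSymbol X.2 _).isProl_inv (Δ.isNegative_gnla x)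
        (Δ.isFundamental_gnla x))

variable {x hreg hnh}

theorem prolVal_prolOfSym {i : ℤ} (X : Δ.filtration x i) :
    (Δ.gnla x).prolVal i (Δ.prolOfSym x hreg hnh i X) =
      (-1 : ℝ) ^ i • Coind.inv (Δ.symSymbol x hreg hnh i X) := rfl

theorem prolOfSym_eq_zero_iff {i : ℤ} (X : Δ.filtration x i) :
    Δ.prolOfSym x hreg hnh i X = 0 ↔ Δ.symSymbol x hreg hnh i X = 0 := by
  have h : Δ.prolOfSym x hreg hnh i X = 0 ↔
      (-1 : ℝ) ^ i • Coind.inv (Δ.symSymbol x hreg hnh i X) = 0 :=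
    ⟨fun h => congrArg Subtype.val h, fun h => Subtype.ext h⟩
  rw [h]
  rw [smul_eq_zero_iff_right (zpow_ne_zero _ (by norm_num)), ← map_zero Coind.inv,
    Coind.inv_injective.eq_iff, map_zero]

/-- The values of the symbol of `X` at elements of `𝔤₋₁` are the classes of the values of iterated
brackets of `X` with sections of `Δ`. -/
theorem fieldSymbol_map_symbol {i k : ℤ} (u : Δ.wtFields x (-i)) (l : List (Δ.sec x 1))
    (hk : k = i - l.length) (w : Δ.wtFields x (-k))
    (hw : (w : VGerm E x) = iterLie (u : VGerm E x) (l.map Subtype.val)) :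
    (Δ.fieldSymbol x hreg hnh i u).1 (l.map (Δ.symbol x 1)) =
      (Δ.fieldSymbol x hreg hnh k w).1 [] := by
  induction l generalizing i u with
  | nil => rw [Δ.fieldSymbol_congr (i := k) (j := i) (by simpa using hk) w u hw]; rfl
  | cons Y l ih =>
    have h : ⁅(u : VGerm E x), (Y : VGerm E x)⁆ ∈ Δ.wtFields x (-(i - (1 : ℕ))) := by
      rw [show -(i - (1 : ℕ)) = -i + 1 by push_cast; ring]
      exact Δ.wtSec_le_wtFields _ (u.2.2 Y Y.2)
    rw [List.map_cons, ← Coind.act_apply, Δ.act_fieldSymbol rfl u Y ⟨_, h⟩ rfl]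
    refine ih ⟨_, h⟩ ?_ hw
    rw [hk, List.length_cons]
    push_cast
    ring

theorem symSymbol_eq_zero_iff {i : ℤ} (X : Δ.filtration x i) :
    Δ.symSymbol x hreg hnh i X = 0 ↔ (X : Δ.localSym x) ∈ Δ.filtration x (i + 1) := by
  refine ⟨fun h => ⟨?_, fun l hl hi => ?_⟩, fun h => ?_⟩
  · refine (Δ.fieldSymbol_nil_eq_zero_iff (hreg := hreg) (hnh := hnh)
      ⟨_, (Δ.mem_filtration_iff hreg).1 X.2⟩).1 ?_
    exact congrArg (fun w : Coind (Δ.gnla x).Total => w.1 []) h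
  · rcases le_or_gt (l.length : ℤ) i with hi' | hi'
    · exact X.2.2 l hl hi'
    have hX := (Δ.mem_filtration_iff hreg).1 X.2
    have hw : iterLie ((X : Δ.localSym x) : VGerm E x) l ∈ Δ.wtFields x (- -1) := by
      rw [show - -(1 : ℤ) = -i + l.length by omega]
      exact Δ.iterLie_mem_wtFields hX l hl
    have hl' : (l.attach.map fun b : {b // b ∈ l} => (⟨b.1, hl b.1 b.2⟩ : Δ.sec x 1)).map Subtype.val = l := by
      rw [List.map_map]
      exact List.attach_map_subtype_val l
    have := Δ.fieldSymbol_map_symbol (hreg := hreg) (hnh := hnh) ⟨_, hX⟩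
      (l.attach.map fun b : {b // b ∈ l} => (⟨b.1, hl b.1 b.2⟩ : Δ.sec x 1)) (k := -1) (by simp; omega) ⟨_, hw⟩
      (by rw [hl'])
    have h0 : (Δ.fieldSymbol x hreg hnh (-1) ⟨_, hw⟩).1 [] = 0 :=
      this.symm.trans (congrArg (fun w : Coind (Δ.gnla x).Total => w.1 _) h)
    obtain ⟨a, ha, ha'⟩ := (Δ.fieldSymbol_nil_eq_zero_iff _).1 h0
    rw [← ha', (Submodule.mem_bot ℝ).1 ha, map_zero]
  · exact Δ.fieldSymbol_eq_zero _ ((Δ.mem_filtration_iff hreg).1 h)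

theorem symSymbol_lie {i j : ℤ} (X : Δ.filtration x i) (Y : Δ.filtration x j)
    (Z : Δ.filtration x (i + j)) (h : (Z : Δ.localSym x) = ⁅(X : Δ.localSym x), (Y : Δ.localSym x)⁆) :
    Δ.symSymbol x hreg hnh (i + j) Z =
      ⁅Δ.symSymbol x hreg hnh i X, Δ.symSymbol x hreg hnh j Y⁆ :=
  Δ.fieldSymbol_lie rfl _ _ _ (congrArg Subtype.val h)

variable (x hreg hnh) in
/-- The embedding of the component of degree `i` of the graded algebra of symmetries. -/
def grEmbedding (i : ℤ) : (Δ.isLieFiltration_filtration (x := x) hreg hnh).gr.V i →ₗ[ℝ] (Δ.tanaka x).V i :=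
  Submodule.liftQ _ (Δ.prolOfSym x hreg hnh i) fun X hX =>
    (Δ.prolOfSym_eq_zero_iff X).2 ((Δ.symSymbol_eq_zero_iff X).2 hX)

theorem grEmbedding_cls {i : ℤ} (X : Δ.filtration x i) :
    Δ.grEmbedding x hreg hnh i ((Δ.isLieFiltration_filtration hreg hnh).cls i X) =
      Δ.prolOfSym x hreg hnh i X := rfl

theorem grEmbedding_injective (i : ℤ) : Function.Injective (Δ.grEmbedding x hreg hnh i) := by
  rw [← LinearMap.ker_eq_bot, LinearMap.ker_eq_bot']
  intro a ha
  obtain ⟨X, rfl⟩ := (Δ.isLieFiltration_filtration hreg hnh).cls_surjective i a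
  rw [grEmbedding_cls, prolOfSym_eq_zero_iff, symSymbol_eq_zero_iff] at ha
  exact ((Δ.isLieFiltration_filtration hreg hnh).cls_eq_zero_iff X).2 ha

theorem grEmbedding_br (i j : ℤ) (a : (Δ.isLieFiltration_filtration (x := x) hreg hnh).gr.V i)
    (b : (Δ.isLieFiltration_filtration (x := x) hreg hnh).gr.V j) :
    Δ.grEmbedding x hreg hnh (i + j)
        ((Δ.isLieFiltration_filtration (x := x) hreg hnh).gr.br i j a b) =
      (Δ.tanaka x).br i j (Δ.grEmbedding x hreg hnh i a) (Δ.grEmbedding x hreg hnh j b) := by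
  obtain ⟨X, rfl⟩ := (Δ.isLieFiltration_filtration hreg hnh).cls_surjective i a
  obtain ⟨Y, rfl⟩ := (Δ.isLieFiltration_filtration hreg hnh).cls_surjective j b
  refine Subtype.ext ?_
  change (-1 : ℝ) ^ (i + j) • Coind.inv (Δ.symSymbol x hreg hnh (i + j) _) =
    ⁅(-1 : ℝ) ^ i • Coind.inv (Δ.symSymbol x hreg hnh i X),
      (-1 : ℝ) ^ j • Coind.inv (Δ.symSymbol x hreg hnh j Y)⁆
  rw [Δ.symSymbol_lie X Y _ rfl, Coind.inv_lie, smul_lie, lie_smul, smul_smul,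
    zpow_add₀ (by norm_num)]

/-- In nonnegative degrees the embedding is given by iterated brackets with sections of `Δ`; the two
signs from inversion cancel. -/
theorem prolVal_grEmbedding_of_nonneg (i : ℕ) (X : Δ.filtration x i) (l : List (Δ.sec x 1))
    (hl : l.length = i + 1) :
    ∃ Z : Δ.sec x 1,
      VGerm.ev x (Z : VGerm E x) =
        VGerm.ev x (iterLie ((X : Δ.localSym x) : VGerm E x) (l.map Subtype.val)) ∧
      ((Δ.gnla x).prolVal i (Δ.prolOfSym x hreg hnh i X)).1 ((l.map (Δ.symbol x 1)).reverse) =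
        Δ.symbol x 1 Z := by
  have hX := (Δ.mem_filtration_iff hreg).1 X.2
  have hw : iterLie ((X : Δ.localSym x) : VGerm E x) (l.map Subtype.val) ∈ Δ.wtFields x (- -1) := by
    have := Δ.iterLie_mem_wtFields hX (l.map Subtype.val) (by
      intro b hb
      obtain ⟨c, -, rfl⟩ := List.mem_map.1 hb
      exact c.2)
    rwa [List.length_map, hl, show -(i : ℤ) + (i + 1 : ℕ) = - -1 by push_cast; ring] at this
  obtain ⟨Z, hZ, hZw⟩ := hw.1
  refine ⟨⟨Z, hZ⟩, hZw, ?_⟩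
  have hV : ∀ Y : Δ.sec x 1, ∃ V : (Δ.gnla x).V (-1), (Δ.gnla x).incl (-1) V = Δ.symbol x 1 Y :=
    fun Y => Δ.symbol_mem_piece Y
  choose V hV using hV
  have hmap : (l.map (Δ.symbol x 1)).reverse = (l.reverse.map V).map ((Δ.gnla x).incl (-1)) := by
    rw [List.map_map, ← List.map_reverse]
    exact List.map_congr_left fun Y _ => (hV Y).symm
  have hinv := Coind.inv_apply_of_length (Δ.isHomog_fieldSymbol (hreg := hreg) (hnh := hnh) ⟨_, hX⟩)
    (Δ.isNegative_gnla x) (l.reverse.map V) (by simp [hl])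
  rw [← hmap, List.reverse_reverse, Δ.fieldSymbol_map_symbol ⟨_, hX⟩ l (k := -1)
    (by rw [hl]; push_cast; ring) ⟨_, hw⟩ rfl, Δ.fieldSymbol_nil (i := -1) (s := 1) rfl _ ⟨Z, hZ⟩ hZw] at hinv
  rw [prolVal_prolOfSym, Submodule.coe_smul, Pi.smul_apply]
  refine (congrArg _ hinv).trans ?_
  rw [smul_smul, ← mul_zpow]
  norm_num

/-- In negative degrees the symbol of a symmetry is right-invariant, and inversion turns it into the
left-invariant field with the opposite value. -/
theorem prolVal_grEmbedding_of_neg (s : ℕ) (hs : 1 ≤ s) (X : Δ.filtration x (-(s : ℤ)))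
    (Y : Δ.sec x s) (h : VGerm.ev x (Y : VGerm E x) = VGerm.ev x ((X : Δ.localSym x) : VGerm E x)) :
    (Δ.gnla x).prolVal (-(s : ℤ)) (Δ.prolOfSym x hreg hnh (-(s : ℤ)) X) =
      (-1 : ℝ) ^ (s + 1) • Coind.emb (Δ.symbol x s Y) := by
  have hX := (Δ.mem_filtration_iff hreg).1 X.2
  have hsym : Δ.symSymbol x hreg hnh (-(s : ℤ)) X = Coind.delta (Δ.symbol x s Y) := by
    refine ((Δ.isSymmetry_fieldSymbol X.2 hX).eq_delta (Δ.isNegative_gnla x)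
      (Δ.isFundamental_gnla x) (by omega)).trans ?_
    rw [Δ.fieldSymbol_nil rfl _ Y h]
  rw [prolVal_prolOfSym, hsym, Coind.inv_delta, pow_succ, zpow_neg, ← inv_zpow, zpow_natCast]
  norm_num

end TangentDistribution

end TanakaTheory

end

theorem mainTheorem4
    {E : Type*} [NormedAddCommGroup E] [NormedSpace ℝ E] [FiniteDimensional ℝ E]
    {M : Type*} [TopologicalSpace M] [ChartedSpace E M] [IsManifold 𝓘(ℝ, E) ∞ M]
    (Δ : TangentDistribution E M) (hreg : Δ.IsRegular) (hnh : Δ.IsCompletelyNonholonomic) (x : M) :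
    ∃ (h : IsLieFiltration (Δ.filtration x))
      (ι : ∀ i : ℤ, h.gr.V i →ₗ[ℝ] (Δ.tanaka x).V i),
      -- each grade injects
      (∀ i : ℤ, Function.Injective (ι i)) ∧
      -- in grades `i ≥ 0` the inclusion is `X ↦ Ψ_X^{i+1}`
      (∀ (i : ℕ) (X : Δ.filtration x i) (l : List (Δ.sec x 1)), l.length = i + 1 →
        ∃ Z : Δ.sec x 1,
          VGerm.ev x (Z : VGerm E x) =
            VGerm.ev x (TangentDistribution.iterLie ((X : Δ.localSym x) : VGerm E x)
              (l.map Subtype.val)) ∧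
          ((Δ.gnla x).prolVal i (ι i (h.cls i X))).1 ((l.map (Δ.symbol x 1)).reverse) =
            Δ.symbol x 1 Z) ∧
      -- in grades `-s < 0` it is, up to the sign `(-1)^{s+1}`, the evaluation at `x`
      (∀ (s : ℕ), 1 ≤ s → ∀ (X : Δ.filtration x (-(s : ℤ))) (Y : Δ.sec x s),
        VGerm.ev x (Y : VGerm E x) = VGerm.ev x ((X : Δ.localSym x) : VGerm E x) →
        (Δ.gnla x).prolVal (-(s : ℤ)) (ι (-(s : ℤ)) (h.cls (-(s : ℤ)) X)) =
          (-1 : ℝ) ^ (s + 1) • Coind.emb (Δ.symbol x s Y)) ∧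
      -- together they form a monomorphism of graded Lie algebras
      (∃ φ : h.gr.Total →ₗ⁅ℝ⁆ (Δ.tanaka x).Total, Function.Injective φ ∧
        ∀ (i : ℤ) (a : h.gr.V i), φ (h.gr.incl i a) = (Δ.tanaka x).incl i (ι i a)) ∧
      -- dimension inequality in `ℕ ∪ {∞}`
      Cardinal.toENat (Module.rank ℝ (Δ.formalAlgebra x)) ≤
        Cardinal.toENat (Module.rank ℝ (Δ.tanaka x).Total) := by
  have hlie := fun i j => Δ.grEmbedding_br (x := x) (hreg := hreg) (hnh := hnh) i j
  have hinj := fun i => Δ.grEmbedding_injective (x := x) (hreg := hreg) (hnh := hnh) i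
  have hφ := GradedLieAlg.totalMap_injective hinj
  obtain ⟨κ, hκ⟩ := hnh
  have htop : Δ.filtration x (-(κ : ℤ)) = ⊤ := by
    refine eq_top_iff.2 fun X _ => (Δ.mem_filtration_iff hreg).2 ?_
    have := Δ.sec_toNat_le_wtFields (x := x) (- -(κ : ℤ))
    rw [neg_neg, Int.toNat_natCast, Δ.sec_eq_top x hreg hκ] at this
    rw [neg_neg]
    exact this trivial
  refine ⟨Δ.isLieFiltration_filtration hreg ⟨κ, hκ⟩, Δ.grEmbedding x hreg ⟨κ, hκ⟩, hinj,
    Δ.prolVal_grEmbedding_of_nonneg, Δ.prolVal_grEmbedding_of_neg,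
    ⟨GradedLieAlg.totalLieHom _ hlie, hφ, GradedLieAlg.totalMap_incl _⟩, ?_⟩
  exact ((Δ.isLieFiltration_filtration hreg ⟨κ, hκ⟩).toENat_rank_limit_le htop
    (Δ.formalAlgebra x) fun _ ha => ha).trans
      (OrderHomClass.mono Cardinal.toENat (LinearMap.rank_le_of_injective _ hφ))
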